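/- Let $n,p\ge 1$, let $X\in\mathbb R^{n\times p}$ be a deterministic matrix with columns $x_1,\dots,x_p$, and let $\beta\in\mathbb R^p$, $\lambda>0$, $\sigma>0$. Assume the following rank condition: for all signs $\delta_1,\dots,\delta_p\in\{-1,1\}$ and all $1\le j_1<\dots<j_k\le p$ with $k=\min(n+1,p)$, $$\operatorname{rank}\begin{pmatrix} x_{j_1} & \cdots & x_{j_k}\\ \delta_{j_1} & \cdots & \delta_{j_k}\end{pmatrix}=k .$$ Let $\varepsilon\sim N(0,\sigma^2 I_n)$, $y=X\beta+\varepsilon$, and let $\hat\beta=\hat\beta(y)$ be the Lasso estimator, i.e. the minimizer of $b\mapsto \|Xb-y\|^2/(2n)+\lambda\|b\|_1$ over $\mathbb R^p$ (under the rank condition it exists and is unique for every $y\in\mathbb R^n$). Let $\hat S=\{j:\hat\beta_j\ne0\}$, let $P_{\hat S}$ be the orthogonal projection of $\mathbb R^n$ onto $\operatorname{span}\{x_j:j\in\hat S\}$, and let $g(\varepsilon)=\varepsilon^\top X(\hat\beta(X\beta+\varepsilon)-\beta)/\sigma^2$, which is differentiable at almost every $\varepsilon$. Then all the expectations and variances below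 are finite, $$\operatorname{Var}|\hat S| = \mathbb E|\hat S| + \mathbb E\big[\|P_{\hat S}\,\varepsilon\|^2/\sigma^2\big] + \Big(\operatorname{Var}(g(\varepsilon))-\sigma^2\,\mathbb E\|\nabla g(\varepsilon)\|^2\Big),$$ the last bracket is non-positive, and hence $$\operatorname{Var}|\hat S| \le \mathbb E|\hat S| + \mathbb E\big[\|P_{\hat S}\,\varepsilon\|^2/\sigma^2\big].$$ Consequently $\operatorname{Var}|\hat S|\le 2n$, and $$\operatorname{Var}|\hat S| \le 3\,\mathbb E|\hat S| + 4\,\mathbb E\Big[|\hat S|\log\Big(\frac{ep}{1\vee|\hat S|}\Big)\Big] \le 3\,\mathbb E|\hat S| + 4\,\mathbb E|\hat S|\,\log\Big(\frac{ep}{1\vee\mathbb E|\hat S|}\Big).$$ -/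

import Mathlib

open MeasureTheory ProbabilityTheory
open scoped Matrix RealInnerProductSpace

noncomputable section

namespace LassoSize

variable {n p : ℕ}

/-- The vector `X b` of the Euclidean space `ℝⁿ`, for `b ∈ ℝᵖ`. -/
def fit (X : Matrix (Fin n) (Fin p) ℝ) (b : EuclideanSpace ℝ (Fin p)) :
    EuclideanSpace ℝ (Fin n) :=
  WithLp.toLp 2 (X *ᵥ WithLp.ofLp b)

/-- The column `x_j` of the design, as a vector of the Euclidean space `ℝⁿ`. -/
def column (X : Matrix (Fin n) (Fin p) ℝ) (j : Fin p) : EuclideanSpace ℝ (Fin n) :=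
  WithLp.toLp 2 (fun i => X i j)

/-- For a choice `e 0 < ⋯ < e (k-1)` of `k` columns, the matrix with `n + 1` rows and `k` columns
whose columns are `(x_{e i}, δ_{e i})`. -/
def signedColumns (X : Matrix (Fin n) (Fin p) ℝ) (δ : Fin p → ℝ) {k : ℕ} (e : Fin k ↪o Fin p) :
    Matrix (Fin n ⊕ Unit) (Fin k) ℝ :=
  Matrix.fromRows (X.submatrix id e) (Matrix.of fun _ i => δ (e i))

/-- The rank condition on the design: for all signs `δ`, any `n + 1` of the columns `(x_j, δ_j)`
are linearly independent (all of the columns, when there are at most `n` of them). -/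
def RankCondition (X : Matrix (Fin n) (Fin p) ℝ) : Prop :=
  ∀ δ : Fin p → ℝ, (∀ j, δ j = -1 ∨ δ j = 1) →
    ∀ e : Fin (min (n + 1) p) ↪o Fin p, (signedColumns X δ e).rank = min (n + 1) p

/-- The Lasso criterion `‖X b - y‖² / (2 n) + λ ‖b‖₁`. -/
def lassoObjective (X : Matrix (Fin n) (Fin p) ℝ) (lam : ℝ) (y : EuclideanSpace ℝ (Fin n))
    (b : EuclideanSpace ℝ (Fin p)) : ℝ :=
  ‖fit X b - y‖ ^ 2 / (2 * (n : ℝ)) + lam * ∑ j, |b j|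

/-- `b` minimizes the Lasso criterion over `ℝᵖ`. -/
def IsLassoSolution (X : Matrix (Fin n) (Fin p) ℝ) (lam : ℝ) (y : EuclideanSpace ℝ (Fin n))
    (b : EuclideanSpace ℝ (Fin p)) : Prop :=
  IsMinOn (lassoObjective X lam y) Set.univ b

/-- The Lasso estimator computed from the data `(X, y)`: a minimizer of the Lasso criterion. -/
def lasso (X : Matrix (Fin n) (Fin p) ℝ) (lam : ℝ) (y : EuclideanSpace ℝ (Fin n)) :
    EuclideanSpace ℝ (Fin p) :=
  Classical.epsilon (IsLassoSolution X lam y)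

/-- The selected support `Ŝ = {j : (lasso)_j ≠ 0}`. -/
def selected (X : Matrix (Fin n) (Fin p) ℝ) (lam : ℝ) (y : EuclideanSpace ℝ (Fin n)) :
    Finset (Fin p) :=
  {j | lasso X lam y j ≠ 0}

/-- The orthogonal projection `P_S` of `ℝⁿ` onto the span of the columns `x_j`, `j ∈ S`. It is
`X_S (X_Sᵀ X_S)⁻¹ X_Sᵀ` when these columns are linearly independent. -/
def proj (X : Matrix (Fin n) (Fin p) ℝ) (S : Finset (Fin p)) :
    EuclideanSpace ℝ (Fin n) →L[ℝ] EuclideanSpace ℝ (Fin n) :=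
  (Submodule.span ℝ (column X '' (S : Set (Fin p)))).starProjection

/-- The function `g(ε) = εᵀ X (lasso(X β + ε) - β) / σ²`. -/
def stein (X : Matrix (Fin n) (Fin p) ℝ) (β : EuclideanSpace ℝ (Fin p)) (lam σ : ℝ)
    (ε : EuclideanSpace ℝ (Fin n)) : ℝ :=
  ⟪ε, fit X (lasso X lam (fit X β + ε) - β)⟫ / σ ^ 2

end LassoSize

end

/-! Put `z = ε / σ`, a standard Gaussian vector, `B(z) = σ⁻¹ β̂(Xβ + σz)`, `F = X B`, and let `S` be
the support of `B`. As long as the signs of the Lasso do not change, stationarity prescribes the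
correlations of the columns in `S` with the residual, and the rank condition makes these columns
independent. Hence the Lasso is continuous and piecewise affine, therefore Lipschitz, and at almost
every `z` one has `DF = P_S` and `DB(F) = B`. In particular `div F = tr P_S = |S|`.

Stein's formula for the field `k F` thus reads `E[k ⟨z, F⟩] = E[k |S|] + E[Dk(F)]`. The choice `k =
1` gives `E⟨z, F⟩ = E|S|`. The choice `k = |S|` gives `E[|S| ⟨z, F⟩] = E|S|²`: moving in the
direction `F` rescales `B`, so smooth approximations of `|S|` have no derivative in that direction
in the limit. The choice `k = ⟨z, F⟩`, with gradient `F + P_S z`, gives `E⟨z, F⟩² = E|S|² + E‖F‖² +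
E|S|`. With `c = σ⁻¹ Xβ` and `G(z) = ⟨z, F - c⟩ = g(σz)`, expanding `Var G` and `E‖∇G‖² = E‖F + P_S
z - c‖²` turns these identities into the variance formula. Its last bracket is the Gaussian Poincaré
deficit of `G`, hence non-positive. The bound `2n` follows from `|S| ≤ n` and `‖P_S z‖ ≤ ‖z‖`.

For the logarithmic bound write `N₁ = E|S|`, `Λ = E[|S| log(ep / (1 ∨ |S|))]`, `q = P(S ≠ ∅)` and `L
= log(1/q)`. If `p ≤ 7`, then `|S|² ≤ 7|S|` is enough. If `p ≥ 8`, the identity `E exp(4/9 ‖P_T z‖²)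
= 3 ^ rank`, a weighted union bound over all nonempty `T` and the Gibbs variational principle yield
`E‖P_S z‖² ≤ 2N₁ + 4Λ + (9/4) q (L - 2)`. When `L ≤ 2` the variance inequality concludes. When `L >
2` the selection is rarely nonempty, and `⟨z, F⟩` vanishes wherever `S = ∅`; a Faber–Krahn
inequality `E⟨z, F⟩² · L ≤ 2 E‖∇⟨z, F⟩‖²` then replaces Poincaré and absorbs the excess. Concavity
of `x log(ep / (1 ∨ x))` gives the last inequality.

The Gaussian inequalities are proved for locally Lipschitz functions by interpolating with `M_θ f(x)
= E f(cos θ x + sin θ y)`. Along it `E ψ(M_θ f)` has derivative `-sin θ cos θ E[ψ''(M_θ f) ‖M_θ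
∇f‖²]`. Taking `ψ = x²` gives Poincaré and `ψ = x log x` the logarithmic Sobolev inequality, from
which Faber–Krahn follows by Jensen. -/

noncomputable section

/-! ### Functions of polynomial growth and locally Lipschitz functions. -/

namespace GaussianCalculus

open Filter Topology

section Growth

variable {V W F : Type*} [NormedAddCommGroup V] [NormedAddCommGroup W] [NormedAddCommGroup F]

/-- The function `h` grows at most polynomially. -/
def PolyGrowth (h : V → F) : Prop :=
  ∃ C : ℝ, ∃ m : ℕ, 0 ≤ C ∧ ∀ x, ‖h x‖ ≤ C * (1 + ‖x‖) ^ m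

/-- The function `h` is Lipschitz on balls, with a constant that grows at most polynomially. -/
def PolyLip (h : V → F) : Prop :=
  ∃ C : ℝ, ∃ m : ℕ, 0 ≤ C ∧ ∀ x y, ‖h x - h y‖ ≤ C * ((1 + ‖x‖) * (1 + ‖y‖)) ^ m * ‖x - y‖

lemma one_le_one_add_norm (x : V) : 1 ≤ 1 + ‖x‖ := by linarith [norm_nonneg x]

lemma one_le_weight (x : V) (y : W) : 1 ≤ (1 + ‖x‖) * (1 + ‖y‖) :=
  one_le_mul_of_one_le_of_one_le (one_le_one_add_norm x) (one_le_one_add_norm y)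

lemma one_add_norm_le_weight (x : V) (y : W) : 1 + ‖x‖ ≤ (1 + ‖x‖) * (1 + ‖y‖) :=
  le_mul_of_one_le_right (by positivity) (one_le_one_add_norm y)

lemma one_add_norm_le_weight' (x : V) (y : W) : 1 + ‖y‖ ≤ (1 + ‖x‖) * (1 + ‖y‖) :=
  le_mul_of_one_le_left (by positivity) (one_le_one_add_norm x)

lemma PolyGrowth.of_norm_le {h : V → F} {k : V → W} (hk : PolyGrowth k)
    (H : ∀ x, ‖h x‖ ≤ ‖k x‖) : PolyGrowth h := by
  obtain ⟨C, m, hC, h'⟩ := hk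
  exact ⟨C, m, hC, fun x => (H x).trans (h' x)⟩

lemma polyGrowth_const (c : F) : PolyGrowth (fun _ : V => c) :=
  ⟨‖c‖, 0, norm_nonneg _, fun x => by simp⟩

lemma polyGrowth_id : PolyGrowth (fun x : V => x) :=
  ⟨1, 1, zero_le_one, fun x => by simp⟩

lemma PolyGrowth.add {h k : V → F} (hh : PolyGrowth h) (hk : PolyGrowth k) :
    PolyGrowth (fun x => h x + k x) := by
  obtain ⟨C, m, hC, h1⟩ := hh
  obtain ⟨D, l, hD, h2⟩ := hk
  refine ⟨C + D, max m l, by positivity, fun x => (norm_add_le _ _).trans ?_⟩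
  have e1 := pow_le_pow_right₀ (one_le_one_add_norm x) (le_max_left m l)
  have e2 := pow_le_pow_right₀ (one_le_one_add_norm x) (le_max_right m l)
  rw [add_mul]
  exact add_le_add ((h1 x).trans (by gcongr)) ((h2 x).trans (by gcongr))

lemma PolyGrowth.norm {h : V → F} (hh : PolyGrowth h) : PolyGrowth (fun x => ‖h x‖) :=
  hh.of_norm_le fun x => by simp

lemma PolyGrowth.mul {h k : V → ℝ} (hh : PolyGrowth h) (hk : PolyGrowth k) :
    PolyGrowth (fun x => h x * k x) := by
  obtain ⟨C, m, hC, h1⟩ := hh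
  obtain ⟨D, l, hD, h2⟩ := hk
  refine ⟨C * D, m + l, by positivity, fun x => ?_⟩
  rw [norm_mul, pow_add, mul_mul_mul_comm]
  exact mul_le_mul (h1 x) (h2 x) (norm_nonneg _) (by positivity)

lemma PolyGrowth.pow {h : V → ℝ} (hh : PolyGrowth h) (k : ℕ) :
    PolyGrowth (fun x => h x ^ k) := by
  induction k with
  | zero => simpa using polyGrowth_const (V := V) (1 : ℝ)
  | succ k ih => simpa [pow_succ] using ih.mul hh

lemma PolyGrowth.of_norm_le_mul {G H : Type*} [NormedAddCommGroup G] [NormedAddCommGroup H]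
    {h : V → F} {k : V → G} {l : V → H} (hk : PolyGrowth k) (hl : PolyGrowth l)
    (hle : ∀ x, ‖h x‖ ≤ ‖k x‖ * ‖l x‖) : PolyGrowth h :=
  (hk.norm.mul hl.norm).of_norm_le fun x => (hle x).trans (le_abs_self _)

lemma PolyGrowth.inner {E : Type*} [NormedAddCommGroup E] [InnerProductSpace ℝ E]
    {h k : V → E} (hh : PolyGrowth h) (hk : PolyGrowth k) : PolyGrowth (fun x => ⟪h x, k x⟫) :=
  hh.of_norm_le_mul hk fun _ => norm_inner_le_norm _ _

lemma PolyGrowth.smul [NormedSpace ℝ F] {h : V → ℝ} {k : V → F} (hh : PolyGrowth h)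
    (hk : PolyGrowth k) : PolyGrowth (fun x => h x • k x) :=
  hh.of_norm_le_mul hk fun _ => (norm_smul _ _).le

lemma PolyLip.polyGrowth {h : V → F} (hh : PolyLip h) : PolyGrowth h := by
  obtain ⟨C, m, hC, h1⟩ := hh
  have : PolyGrowth (fun x => h x - h 0) := by
    refine ⟨C, m + 1, hC, fun x => (h1 x 0).trans ?_⟩
    rw [norm_zero, add_zero, mul_one, sub_zero, pow_succ, mul_assoc]
    gcongr
    linarith
  simpa using this.add (polyGrowth_const (h 0))

lemma polyLip_of_lipschitz {h : V → F} (C : ℝ) (hC : ∀ x y, ‖h x - h y‖ ≤ C * ‖x - y‖) :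
    PolyLip h :=
  ⟨|C|, 0, abs_nonneg _, fun x y => (hC x y).trans (by
    rw [pow_zero, mul_one]; gcongr; exact le_abs_self _)⟩

lemma polyLip_const (c : F) : PolyLip (fun _ : V => c) :=
  polyLip_of_lipschitz 0 fun x y => by simp

lemma polyLip_id : PolyLip (fun x : V => x) :=
  polyLip_of_lipschitz 1 fun x y => by simp

lemma PolyLip.of_norm_le {h : V → F} {k : V → W} (hk : PolyLip k)
    (H : ∀ x y, ‖h x - h y‖ ≤ ‖k x - k y‖) : PolyLip h := by
  obtain ⟨C, m, hC, h'⟩ := hk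
  exact ⟨C, m, hC, fun x y => (H x y).trans (h' x y)⟩

lemma PolyLip.add {h k : V → F} (hh : PolyLip h) (hk : PolyLip k) :
    PolyLip (fun x => h x + k x) := by
  obtain ⟨C, m, hC, h1⟩ := hh
  obtain ⟨D, l, hD, h2⟩ := hk
  refine ⟨C + D, max m l, by positivity, fun x y => ?_⟩
  have e1 := pow_le_pow_right₀ (one_le_weight x y) (le_max_left m l)
  have e2 := pow_le_pow_right₀ (one_le_weight x y) (le_max_right m l)
  rw [add_sub_add_comm, add_mul, add_mul]
  exact (norm_add_le _ _).trans
    (add_le_add ((h1 x y).trans (by gcongr)) ((h2 x y).trans (by gcongr)))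

lemma PolyLip.neg {h : V → F} (hh : PolyLip h) : PolyLip (fun x => -h x) :=
  hh.of_norm_le fun x y => by rw [← neg_sub', norm_neg]

lemma PolyLip.sub {h k : V → F} (hh : PolyLip h) (hk : PolyLip k) :
    PolyLip (fun x => h x - k x) := by
  simpa [sub_eq_add_neg] using hh.add hk.neg

/-- The hypothesis on `B` is the only trace of bilinearity that a product estimate uses; scalar
multiples, products and inner products are all instances. -/
lemma PolyLip.bilinear {G H : Type*} [NormedAddCommGroup G] [NormedAddCommGroup H]
    (B : G → H → F)
    (hB : ∀ a a' b b', ‖B a b - B a' b'‖ ≤ ‖a - a'‖ * ‖b‖ + ‖a'‖ * ‖b - b'‖)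
    {h : V → G} {k : V → H} (hh : PolyLip h) (hk : PolyLip k) :
    PolyLip (fun x => B (h x) (k x)) := by
  obtain ⟨C, m, hC, h1⟩ := hh.polyGrowth
  obtain ⟨D, l, hD, h2⟩ := hk.polyGrowth
  obtain ⟨C', m', hC', h1'⟩ := hh
  obtain ⟨D', l', hD', h2'⟩ := hk
  refine ⟨C' * D + C * D', m + l + m' + l', by positivity, fun x y => (hB _ _ _ _).trans ?_⟩
  have e1 : D * (1 + ‖x‖) ^ l ≤ D * ((1 + ‖x‖) * (1 + ‖y‖)) ^ l := by
    gcongr; exact one_add_norm_le_weight x y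
  have e2 : C * (1 + ‖y‖) ^ m ≤ C * ((1 + ‖x‖) * (1 + ‖y‖)) ^ m := by
    gcongr; exact one_add_norm_le_weight' x y
  have w := one_le_weight x y
  set w' := (1 + ‖x‖) * (1 + ‖y‖)
  have e3 : w' ^ (m' + l) ≤ w' ^ (m + l + m' + l') := pow_le_pow_right₀ w (by omega)
  have e4 : w' ^ (m + l') ≤ w' ^ (m + l + m' + l') := pow_le_pow_right₀ w (by omega)
  have f1 : ‖h x - h y‖ * ‖k x‖ ≤ (C' * w' ^ m' * ‖x - y‖) * (D * w' ^ l) :=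
    mul_le_mul (h1' x y) ((h2 x).trans e1) (norm_nonneg _) (by positivity)
  have f2 : ‖h y‖ * ‖k x - k y‖ ≤ (C * w' ^ m) * (D' * w' ^ l' * ‖x - y‖) :=
    mul_le_mul ((h1 y).trans e2) (h2' x y) (norm_nonneg _) (by positivity)
  calc _ ≤ _ := add_le_add f1 f2
    _ = (C' * D * w' ^ (m' + l) + C * D' * w' ^ (m + l')) * ‖x - y‖ := by ring
    _ ≤ (C' * D * w' ^ (m + l + m' + l') + C * D' * w' ^ (m + l + m' + l')) * ‖x - y‖ := by gcongr
    _ = _ := by ring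

lemma PolyLip.smul [NormedSpace ℝ F] {h : V → ℝ} {k : V → F} (hh : PolyLip h) (hk : PolyLip k) :
    PolyLip (fun x => h x • k x) :=
  PolyLip.bilinear (fun a b => a • b) (fun a a' b b' => by
    rw [show a • b - a' • b' = (a - a') • b + a' • (b - b') by module]
    exact (norm_add_le _ _).trans (by rw [norm_smul, norm_smul])) hh hk

lemma PolyLip.mul {h k : V → ℝ} (hh : PolyLip h) (hk : PolyLip k) :
    PolyLip (fun x => h x * k x) := hh.smul hk

lemma PolyLip.inner {E : Type*} [NormedAddCommGroup E] [InnerProductSpace ℝ E]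
    {h k : V → E} (hh : PolyLip h) (hk : PolyLip k) : PolyLip (fun x => ⟪h x, k x⟫) :=
  PolyLip.bilinear (fun a b : E => ⟪a, b⟫) (fun a a' b b' => by
    rw [show ⟪a, b⟫ - ⟪a', b'⟫ = ⟪a - a', b⟫ + ⟪a', b - b'⟫ by
      rw [inner_sub_left, inner_sub_right]; ring]
    exact (norm_add_le _ _).trans
      (add_le_add (norm_inner_le_norm _ _) (norm_inner_le_norm _ _))) hh hk

lemma PolyLip.sum {ι : Type*} (s : Finset ι) {h : ι → V → F} (hh : ∀ i, PolyLip (h i)) :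
    PolyLip (fun x => ∑ i ∈ s, h i x) := by
  classical
  induction s using Finset.induction_on with
  | empty => simpa using polyLip_const (V := V) (0 : F)
  | insert a s ha ih => simpa [Finset.sum_insert ha] using (hh a).add ih

lemma PolyLip.comp_lipschitz {h : V → F} (hh : PolyLip h) {k : W → V} (C : ℝ)
    (hk : ∀ x y, ‖k x - k y‖ ≤ C * ‖x - y‖) : PolyLip (fun x => h (k x)) := by
  obtain ⟨D, m, hD, h1⟩ := hh
  obtain ⟨A, a, hA, h2⟩ := (polyLip_of_lipschitz C hk).polyGrowth
  have key : ∀ x, 1 + ‖k x‖ ≤ (1 + A) * (1 + ‖x‖) ^ a := fun x => by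
    have := one_le_pow₀ (n := a) (one_le_one_add_norm x)
    have := h2 x
    nlinarith
  refine ⟨D * ((1 + A) * (1 + A)) ^ m * |C|, a * m, by positivity, fun x y => (h1 _ _).trans ?_⟩
  calc D * ((1 + ‖k x‖) * (1 + ‖k y‖)) ^ m * ‖k x - k y‖
      ≤ D * (((1 + A) * (1 + ‖x‖) ^ a) * ((1 + A) * (1 + ‖y‖) ^ a)) ^ m * (|C| * ‖x - y‖) := by
        gcongr
        · exact key x
        · exact key y
        · exact (hk x y).trans (by gcongr; exact le_abs_self _)
    _ = _ := by
        rw [mul_mul_mul_comm (1 + A), mul_pow ((1 + A) * (1 + A)), pow_mul, mul_pow (1 + ‖x‖)]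
        ring

lemma PolyLip.exists_lipschitzOnWith_ball {h : V → F} (hh : PolyLip h) (R : ℝ) :
    ∃ K, LipschitzOnWith K h (Metric.ball 0 R) := by
  obtain ⟨C, m, hC, h1⟩ := hh
  refine ⟨Real.toNNReal (C * ((1 + R) * (1 + R)) ^ m),
    LipschitzOnWith.of_dist_le' fun x hx y hy => ?_⟩
  rw [mem_ball_zero_iff] at hx hy
  rw [dist_eq_norm, dist_eq_norm]
  have hR : 0 ≤ R := (norm_nonneg x).trans hx.le
  refine (h1 x y).trans ?_
  gcongr

lemma PolyLip.continuous {h : V → F} (hh : PolyLip h) : Continuous h := by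
  rw [continuous_iff_continuousAt]
  intro x
  obtain ⟨K, hK⟩ := hh.exists_lipschitzOnWith_ball (‖x‖ + 1)
  exact hK.continuousOn.continuousAt (Metric.isOpen_ball.mem_nhds (by simp))

end Growth

section Derivative

variable {V F : Type*} [NormedAddCommGroup V] [NormedSpace ℝ V]
  [NormedAddCommGroup F] [NormedSpace ℝ F]

/-- On the unit ball around `x` the Lipschitz constant is polynomial in `‖x‖`. Differentiability is
not needed, since `fderiv` is zero where it fails. -/
lemma PolyLip.polyGrowth_fderiv {h : V → F} (hh : PolyLip h) : PolyGrowth (fderiv ℝ h) := by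
  obtain ⟨C, m, hC, h1⟩ := hh
  refine ⟨C * 2 ^ m, m + m, by positivity, fun x => ?_⟩
  refine norm_fderiv_le_of_lip' ℝ (by positivity) ?_
  filter_upwards [Metric.ball_mem_nhds x one_pos] with y hy
  refine (h1 y x).trans (mul_le_mul_of_nonneg_right ?_ (norm_nonneg _))
  have : ‖y‖ ≤ ‖x‖ + 1 := by
    rw [mem_ball_iff_norm] at hy
    linarith [norm_sub_norm_le y x]
  calc C * ((1 + ‖y‖) * (1 + ‖x‖)) ^ m ≤ C * ((2 * (1 + ‖x‖)) * (1 + ‖x‖)) ^ m := by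
        gcongr; linarith [norm_nonneg x]
    _ = _ := by rw [mul_assoc 2, mul_pow 2, mul_pow, pow_add]; ring

/-- Rademacher's theorem on each ball of integer radius. -/
lemma PolyLip.ae_differentiableAt [FiniteDimensional ℝ V] [MeasurableSpace V] [BorelSpace V]
    [FiniteDimensional ℝ F] {h : V → F} (hh : PolyLip h) (μ : Measure V) [μ.IsAddHaarMeasure] :
    ∀ᵐ x ∂μ, DifferentiableAt ℝ h x := by
  have : ∀ n : ℕ, ∀ᵐ x ∂μ, x ∈ Metric.ball (0 : V) n → DifferentiableAt ℝ h x := fun n => by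
    obtain ⟨K, hK⟩ := hh.exists_lipschitzOnWith_ball (n : ℝ)
    filter_upwards [hK.ae_differentiableWithinAt_of_mem (μ := μ)] with x hx hx'
    exact (hx hx').differentiableAt (Metric.isOpen_ball.mem_nhds hx')
  filter_upwards [ae_all_iff.2 this] with x hx
  obtain ⟨n, hn⟩ := exists_nat_gt ‖x‖
  exact hx n (by simpa using hn)

end Derivative

end GaussianCalculus

/-! ### Rotations of a pair of Gaussian vectors, and Stein's lemma. -/

namespace GaussianCalculus

open Filter Topology

section Gradient

variable {E : Type*} [NormedAddCommGroup E] [InnerProductSpace ℝ E] [FiniteDimensional ℝ E]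

lemma inner_gradient_left_eq (k : E → ℝ) (x v : E) : ⟪gradient k x, v⟫ = fderiv ℝ k x v := by
  simp [gradient]

lemma norm_gradient (k : E → ℝ) (x : E) : ‖gradient k x‖ = ‖fderiv ℝ k x‖ := by
  simp [gradient]

lemma PolyLip.polyGrowth_gradient {k : E → ℝ} (hk : PolyLip k) : PolyGrowth (gradient k) :=
  hk.polyGrowth_fderiv.of_norm_le fun x => (norm_gradient k x).le

end Gradient

section Rotation

variable {E : Type*} [NormedAddCommGroup E] [NormedSpace ℝ E]

/-- The first coordinate of the rotation of angle `θ` of `E × E`. -/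
def rot (θ : ℝ) (z : E × E) : E := Real.cos θ • z.1 + Real.sin θ • z.2

/-- The second coordinate of the rotation of angle `θ` of `E × E`. -/
def rot' (θ : ℝ) (z : E × E) : E := -Real.sin θ • z.1 + Real.cos θ • z.2

@[fun_prop]
lemma continuous_rot (θ : ℝ) : Continuous (rot θ : E × E → E) := by unfold rot; fun_prop

@[fun_prop]
lemma continuous_rot' (θ : ℝ) : Continuous (rot' θ : E × E → E) := by unfold rot'; fun_prop

lemma norm_rot_le (θ : ℝ) (z : E × E) : ‖rot θ z‖ ≤ ‖z.1‖ + ‖z.2‖ := by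
  refine (norm_add_le _ _).trans ?_
  rw [norm_smul, norm_smul]
  have h1 := Real.abs_cos_le_one θ
  have h2 := Real.abs_sin_le_one θ
  rw [← Real.norm_eq_abs] at h1 h2
  exact add_le_add (mul_le_of_le_one_left (norm_nonneg _) h1)
    (mul_le_of_le_one_left (norm_nonneg _) h2)

lemma norm_rot'_le (θ : ℝ) (z : E × E) : ‖rot' θ z‖ ≤ ‖z.1‖ + ‖z.2‖ := by
  refine (norm_add_le _ _).trans ?_
  rw [norm_smul, norm_smul, norm_neg]
  have h1 := Real.abs_cos_le_one θ
  have h2 := Real.abs_sin_le_one θ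
  rw [← Real.norm_eq_abs] at h1 h2
  exact add_le_add (mul_le_of_le_one_left (norm_nonneg _) h2)
    (mul_le_of_le_one_left (norm_nonneg _) h1)

lemma one_add_norm_rot_le (θ : ℝ) (z : E × E) :
    1 + ‖rot θ z‖ ≤ (1 + ‖z.1‖) * (1 + ‖z.2‖) := by
  nlinarith [norm_rot_le θ z, norm_nonneg z.1, norm_nonneg z.2,
    mul_nonneg (norm_nonneg z.1) (norm_nonneg z.2)]

lemma one_add_norm_rot'_le (θ : ℝ) (z : E × E) :
    1 + ‖rot' θ z‖ ≤ (1 + ‖z.1‖) * (1 + ‖z.2‖) := by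
  nlinarith [norm_rot'_le θ z, norm_nonneg z.1, norm_nonneg z.2,
    mul_nonneg (norm_nonneg z.1) (norm_nonneg z.2)]

lemma norm_rot_sub_rot_le (θ φ : ℝ) (z : E × E) :
    ‖rot θ z - rot φ z‖ ≤ (‖z.1‖ + ‖z.2‖) * |θ - φ| := by
  have e : rot θ z - rot φ z
      = (Real.cos θ - Real.cos φ) • z.1 + (Real.sin θ - Real.sin φ) • z.2 := by
    unfold rot; module
  rw [e, add_mul, mul_comm, mul_comm ‖z.2‖]
  refine (norm_add_le _ _).trans ?_
  rw [norm_smul, norm_smul, Real.norm_eq_abs, Real.norm_eq_abs]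
  exact add_le_add (mul_le_mul_of_nonneg_right (Real.abs_cos_sub_cos_le θ φ) (norm_nonneg _))
    (mul_le_mul_of_nonneg_right (Real.abs_sin_sub_sin_le θ φ) (norm_nonneg _))

lemma norm_rot'_sub_rot'_le (θ φ : ℝ) (z : E × E) :
    ‖rot' θ z - rot' φ z‖ ≤ (‖z.1‖ + ‖z.2‖) * |θ - φ| := by
  have e : rot' θ z - rot' φ z
      = (Real.sin φ - Real.sin θ) • z.1 + (Real.cos θ - Real.cos φ) • z.2 := by
    unfold rot'; module
  rw [e, add_mul, mul_comm, mul_comm ‖z.2‖]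
  refine (norm_add_le _ _).trans ?_
  rw [norm_smul, norm_smul, Real.norm_eq_abs, Real.norm_eq_abs]
  exact add_le_add (mul_le_mul_of_nonneg_right
      ((Real.abs_sin_sub_sin_le φ θ).trans_eq (abs_sub_comm _ _)) (norm_nonneg _))
    (mul_le_mul_of_nonneg_right (Real.abs_cos_sub_cos_le θ φ) (norm_nonneg _))

lemma hasDerivAt_rot (θ : ℝ) (z : E × E) : HasDerivAt (fun t => rot t z) (rot' θ z) θ :=
  ((Real.hasDerivAt_cos θ).smul_const z.1).add ((Real.hasDerivAt_sin θ).smul_const z.2)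

lemma hasDerivAt_rot' (θ : ℝ) (z : E × E) : HasDerivAt (fun t => rot' t z) (-rot θ z) θ := by
  have := ((Real.hasDerivAt_sin θ).neg.smul_const z.1).add
    ((Real.hasDerivAt_cos θ).smul_const z.2)
  refine this.congr_deriv ?_
  unfold rot; module

lemma rot_rotation (θ : ℝ) (z : E × E) :
    Real.cos θ • rot θ z - Real.sin θ • rot' θ z = z.1 := by
  have h := Real.cos_sq_add_sin_sq θ
  unfold rot rot'
  calc _ = (Real.cos θ ^ 2 + Real.sin θ ^ 2) • z.1 := by module
    _ = z.1 := by rw [h, one_smul]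

end Rotation

variable {E : Type*} [NormedAddCommGroup E] [InnerProductSpace ℝ E] [FiniteDimensional ℝ E]
  [MeasurableSpace E] [BorelSpace E]

/-- The Gaussian density has the same characteristic function as `stdGaussian`. This is what
transfers Rademacher's theorem and other Lebesgue-almost-everywhere statements to the Gaussian
measure. -/
lemma stdGaussian_absolutelyContinuous : stdGaussian E ≪ (volume : Measure E) := by
  set d : ℝ := Module.finrank ℝ E / 2
  set a : ℝ := ((2 * Real.pi) ^ d)⁻¹ with ha
  have hpos : 0 < (2 * Real.pi) ^ d := by positivity
  have hint : Integrable (fun x : E => a * Real.exp (-‖x‖ ^ 2 / 2)) := by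
    have := (GaussianFourier.integrable_cexp_neg_mul_sq_norm_add (V := E) (b := 1 / 2)
      (by norm_num) 0 0).norm
    refine (this.const_mul a).congr (Eventually.of_forall fun x => ?_)
    simp only [Complex.norm_exp]
    congr 2
    simp [← Complex.ofReal_pow]
    ring
  set ρ : Measure E := volume.withDensity fun x => ENNReal.ofReal (a * Real.exp (-‖x‖ ^ 2 / 2))
  have : IsFiniteMeasure ρ := isFiniteMeasure_withDensity_ofReal hint.2
  suffices h : stdGaussian E = ρ by
    rw [h]; exact withDensity_absolutelyContinuous _ _
  refine Measure.ext_of_charFun (funext fun t => ?_)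
  rw [charFun_stdGaussian, charFun_apply, integral_withDensity_eq_integral_toReal_smul
    (by fun_prop) (by simp)]
  have h := GaussianFourier.integral_cexp_neg_mul_sq_norm_add (V := E) (b := 1 / 2)
      (by norm_num) Complex.I t
  have h2 : ((Real.pi : ℂ) / (1 / 2)) ^ (Module.finrank ℝ E / 2 : ℂ)
      = (((2 * Real.pi) ^ d : ℝ) : ℂ) := by
    rw [Complex.ofReal_cpow (by positivity)]
    simp [d]
    ring_nf
  rw [h2] at h
  have h3 : Complex.exp (Complex.I ^ 2 * ‖t‖ ^ 2 / (4 * (1 / 2))) = Complex.exp (-‖t‖ ^ 2 / 2) := by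
    rw [Complex.I_sq]; ring_nf
  rw [h3] at h
  have h4 : ∀ x : E, (ENNReal.ofReal (a * Real.exp (-‖x‖ ^ 2 / 2))).toReal
      • Complex.exp (⟪x, t⟫ * Complex.I)
      = (a : ℂ) * Complex.exp (-(1 / 2) * ‖x‖ ^ 2 + Complex.I * ⟪t, x⟫) := fun x => by
    rw [ENNReal.toReal_ofReal (by positivity), Complex.real_smul, Complex.ofReal_mul, mul_assoc,
      Complex.ofReal_exp, ← Complex.exp_add, real_inner_comm]
    congr 2
    push_cast
    ring
  have h5 : (a : ℂ) * (((2 * Real.pi) ^ d : ℝ) : ℂ) = 1 := by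
    rw [← Complex.ofReal_mul, ha, inv_mul_cancel₀ hpos.ne', Complex.ofReal_one]
  rw [integral_congr_ae (Eventually.of_forall h4), integral_const_mul, h, ← mul_assoc, h5, one_mul]

lemma integrable_weight {V : Type*} [NormedAddCommGroup V] [NormedSpace ℝ V]
    [MeasurableSpace V] [BorelSpace V] [CompleteSpace V] [SecondCountableTopology V]
    (μ : Measure V) [IsGaussian μ] (m : ℕ) : Integrable (fun x : V => (1 + ‖x‖) ^ m) μ := by
  have h1 : MemLp (fun x : V => ‖x‖) m μ := by
    simpa using (IsGaussian.memLp_id μ m (by simp)).norm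
  have h : MemLp (fun x : V => 1 + ‖x‖) m μ := (memLp_const (1 : ℝ)).add h1
  refine h.integrable_norm_pow'.congr (Eventually.of_forall fun x => ?_)
  simp only [Real.norm_eq_abs]
  rw [abs_of_nonneg (by positivity)]

section

variable {V F : Type*} [NormedAddCommGroup V] [NormedSpace ℝ V]
  [MeasurableSpace V] [BorelSpace V] [CompleteSpace V] [SecondCountableTopology V]
  [NormedAddCommGroup F] {μ : Measure V} [IsGaussian μ]

lemma PolyGrowth.integrable {h : V → F} (hh : PolyGrowth h) (hm : AEStronglyMeasurable h μ) :
    Integrable h μ := by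
  obtain ⟨C, m, hC, h1⟩ := hh
  exact ((integrable_weight μ m).const_mul C).mono' hm (Eventually.of_forall h1)

lemma PolyGrowth.memLp_two {h : V → F} (hh : PolyGrowth h) (hm : AEStronglyMeasurable h μ) :
    MemLp h 2 μ := by
  rw [← integrable_norm_rpow_iff hm (by simp) (by simp)]
  have := (hh.norm.pow 2).integrable (μ := μ) (hm.norm.pow 2)
  simpa using this

lemma PolyLip.integrable {h : V → F} (hh : PolyLip h) : Integrable h μ :=
  hh.polyGrowth.integrable hh.continuous.aestronglyMeasurable

lemma integrable_prod_of_le_weight {h : V × V → F}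
    (hm : AEStronglyMeasurable h (μ.prod μ)) (C : ℝ) (m : ℕ)
    (hle : ∀ z, ‖h z‖ ≤ C * ((1 + ‖z.1‖) * (1 + ‖z.2‖)) ^ m) : Integrable h (μ.prod μ) := by
  have := ((integrable_weight μ m).mul_prod (integrable_weight μ m)).const_mul C
  refine this.mono' hm (Eventually.of_forall fun z => (hle z).trans_eq ?_)
  rw [mul_pow]

end

lemma PolyLip.ae_differentiableAt_stdGaussian {F : Type*} [NormedAddCommGroup F] [NormedSpace ℝ F]
    [FiniteDimensional ℝ F] {h : E → F} (hh : PolyLip h) :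
    ∀ᵐ x ∂(stdGaussian E), DifferentiableAt ℝ h x :=
  stdGaussian_absolutelyContinuous.ae_le (hh.ae_differentiableAt volume)

@[fun_prop]
lemma measurable_rot (θ : ℝ) : Measurable (rot θ : E × E → E) := (continuous_rot θ).measurable

@[fun_prop]
lemma measurable_rot' (θ : ℝ) : Measurable (rot' θ : E × E → E) := (continuous_rot' θ).measurable

lemma measurePreserving_rotation (θ : ℝ) :
    MeasurePreserving (fun z : E × E => (rot θ z, rot' θ z))
      ((stdGaussian E).prod (stdGaussian E)) ((stdGaussian E).prod (stdGaussian E)) := by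
  refine ⟨by fun_prop, ?_⟩
  have := IsGaussian.map_rotation_eq_self (μ := stdGaussian E) (by simp) θ
  have e : (fun z : E × E => (rot θ z, rot' θ z)) = ContinuousLinearMap.rotation θ := by
    funext z; rw [ContinuousLinearMap.rotation_apply]; rfl
  rwa [e]

lemma measurePreserving_rot (θ : ℝ) :
    MeasurePreserving (rot θ : E × E → E) ((stdGaussian E).prod (stdGaussian E))
      (stdGaussian E) :=
  measurePreserving_fst.comp (measurePreserving_rotation θ)

lemma integral_comp_rotation {F : Type*} [NormedAddCommGroup F] [NormedSpace ℝ F] (θ : ℝ)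
    {h : E × E → F}
    (hm : AEStronglyMeasurable h ((stdGaussian E).prod (stdGaussian E))) :
    ∫ z, h (rot θ z, rot' θ z) ∂((stdGaussian E).prod (stdGaussian E))
      = ∫ z, h z ∂((stdGaussian E).prod (stdGaussian E)) := by
  have := integral_map (measurePreserving_rotation (E := E) θ).aemeasurable
    (f := h) (by rwa [(measurePreserving_rotation θ).map_eq])
  rw [(measurePreserving_rotation θ).map_eq] at this
  exact this.symm

lemma integral_inner_mul_inner_stdGaussian (a b : E) :
    ∫ x, ⟪a, x⟫ * ⟪b, x⟫ ∂(stdGaussian E) = ⟪a, b⟫ := by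
  have h := covarianceBilin_apply_eq_cov (μ := stdGaussian E) IsGaussian.memLp_two_id a b
  rw [covarianceBilin_stdGaussian, innerSL_apply_apply, covariance_eq_sub] at h
  · have e : ∀ c : E, ∫ x, ⟪c, x⟫ ∂(stdGaussian E) = 0 := fun c =>
      integral_strongDual_stdGaussian (innerSL ℝ c)
    rw [e, zero_mul, sub_zero] at h
    exact h.symm
  · exact (polyGrowth_const a |>.inner polyGrowth_id).memLp_two (by fun_prop)
  · exact (polyGrowth_const b |>.inner polyGrowth_id).memLp_two (by fun_prop)

/-- The bound is uniform in the angles, so that it can serve as a dominating function for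
differentiation in `θ`. -/
lemma PolyLip.exists_rot_bound {E F : Type*} [NormedAddCommGroup E] [NormedSpace ℝ E]
    [NormedAddCommGroup F] {k : E → F} (hk : PolyLip k) :
    ∃ C : ℝ, ∃ m : ℕ, 0 ≤ C ∧ ∀ θ φ (z : E × E),
      ‖k (rot θ z) - k (rot φ z)‖ ≤ C * ((1 + ‖z.1‖) * (1 + ‖z.2‖)) ^ m * |θ - φ| := by
  obtain ⟨C, m, hC, h⟩ := hk
  refine ⟨C, 2 * m + 1, hC, fun θ φ z => (h _ _).trans ?_⟩
  have h1 := one_add_norm_rot_le θ z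
  have h2 := one_add_norm_rot_le φ z
  have h3 := norm_rot_sub_rot_le θ φ z
  have h4 : ‖z.1‖ + ‖z.2‖ ≤ (1 + ‖z.1‖) * (1 + ‖z.2‖) := by
    nlinarith [norm_nonneg z.1, norm_nonneg z.2, mul_nonneg (norm_nonneg z.1) (norm_nonneg z.2)]
  set w := (1 + ‖z.1‖) * (1 + ‖z.2‖)
  calc C * ((1 + ‖rot θ z‖) * (1 + ‖rot φ z‖)) ^ m * ‖rot θ z - rot φ z‖
      ≤ C * (w * w) ^ m * (w * |θ - φ|) := by
        gcongr
        exact h3.trans (by gcongr)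
    _ = _ := by rw [← pow_two, ← pow_mul]; ring

lemma PolyGrowth.exists_rot_bound {E F : Type*} [NormedAddCommGroup E] [NormedSpace ℝ E]
    [NormedAddCommGroup F] {k : E → F} (hk : PolyGrowth k) :
    ∃ C : ℝ, ∃ m : ℕ, 0 ≤ C ∧ ∀ θ (z : E × E),
      ‖k (rot θ z)‖ ≤ C * ((1 + ‖z.1‖) * (1 + ‖z.2‖)) ^ m := by
  obtain ⟨C, m, hC, h⟩ := hk
  refine ⟨C, m, hC, fun θ z => (h _).trans ?_⟩
  gcongr
  exact one_add_norm_rot_le θ z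

lemma measurable_gradient (k : E → ℝ) : Measurable (gradient k) :=
  (LinearIsometryEquiv.continuous _).measurable.comp (measurable_fderiv ℝ k)

/-- Differentiation under the integral sign, for integrands that are Lipschitz at a point. -/
lemma hasDerivAt_integral_of_norm_sub_le {α : Type*} [MeasurableSpace α] {μ : Measure α}
    {F : ℝ → α → ℝ} {F' : α → ℝ} {x₀ : ℝ} {s : Set ℝ} {bound : α → ℝ} (hs : s ∈ 𝓝 x₀)
    (hF_meas : ∀ x ∈ s, AEStronglyMeasurable (F x) μ) (hF_int : Integrable (F x₀) μ)
    (hF'_meas : AEStronglyMeasurable F' μ)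
    (h_lipsch : ∀ᵐ a ∂μ, ∀ x ∈ s, ‖F x a - F x₀ a‖ ≤ bound a * ‖x - x₀‖)
    (bound_integrable : Integrable bound μ)
    (h_diff : ∀ᵐ a ∂μ, HasDerivAt (F · a) (F' a) x₀) :
    Integrable F' μ ∧ HasDerivAt (fun x ↦ ∫ a, F x a ∂μ) (∫ a, F' a ∂μ) x₀ := by
  set L : ℝ →L[ℝ] ℝ →L[ℝ] ℝ := ContinuousLinearMap.smulRightL ℝ ℝ ℝ 1
  obtain ⟨h1, h2⟩ := hasFDerivAt_integral_of_dominated_loc_of_lip' (F' := fun a => L (F' a)) hs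
    hF_meas hF_int (L.continuous.comp_aestronglyMeasurable hF'_meas) h_lipsch bound_integrable
    (h_diff.mono fun a ha => by
      have e : L (F' a) = ContinuousLinearMap.toSpanSingleton ℝ (F' a) := by ext; simp [L]
      rw [e]; exact ha.hasFDerivAt)
  have hint : Integrable F' μ := by
    simpa [L] using h1.apply_continuousLinearMap 1
  rw [L.integral_comp_comm hint] at h2
  exact ⟨hint, by simpa [L] using h2.hasDerivAt⟩

/-- **Stein's lemma** for locally Lipschitz functions. -/
theorem stein_lemma {k : E → ℝ} (hk : PolyLip k) (a : E) :
    ∫ x, k x * ⟪a, x⟫ ∂(stdGaussian E) = ∫ x, fderiv ℝ k x a ∂(stdGaussian E) := by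
  set γ := stdGaussian E
  have hkc := hk.continuous
  have hmeas : ∀ t, Continuous fun z : E × E => k (rot t z) * ⟪a, rot' t z⟫ := fun t => by fun_prop
  obtain ⟨C, m, hC, h1⟩ := hk.exists_rot_bound
  obtain ⟨D, l, hD, h2⟩ := hk.polyGrowth.exists_rot_bound
  obtain ⟨D', l', hD', h2'⟩ := hk.polyGrowth_fderiv
  have hw : ∀ z : E × E, 1 ≤ (1 + ‖z.1‖) * (1 + ‖z.2‖) := fun z => one_le_weight _ _
  have hr' : ∀ t (z : E × E), |⟪a, rot' t z⟫| ≤ ‖a‖ * ((1 + ‖z.1‖) * (1 + ‖z.2‖)) := fun t z =>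
    (abs_real_inner_le_norm _ _).trans (by gcongr; linarith [one_add_norm_rot'_le t z])
  -- By rotation invariance the integral does not depend on the angle, and at angle zero it factors
  -- with a centred second factor. Stein's formula is the vanishing of its derivative at zero.
  have hconst : ∀ t, ∫ z, k (rot t z) * ⟪a, rot' t z⟫ ∂(γ.prod γ) = 0 := fun t => by
    rw [integral_comp_rotation t (h := fun z => k z.1 * ⟪a, z.2⟫)
      (Continuous.aestronglyMeasurable (by fun_prop)), integral_prod_mul (fun x => k x)
      (fun y => ⟪a, y⟫)]
    have : ∫ y, ⟪a, y⟫ ∂γ = 0 := integral_strongDual_stdGaussian (innerSL ℝ a)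
    rw [this, mul_zero]
  have hint : Integrable (fun z : E × E => k (rot 0 z) * ⟪a, rot' 0 z⟫) (γ.prod γ) := by
    refine integrable_prod_of_le_weight (hmeas 0).aestronglyMeasurable (D * ‖a‖) (l + 1)
      fun z => ?_
    rw [norm_mul]
    calc _ ≤ _ := mul_le_mul (h2 0 z) (hr' 0 z) (abs_nonneg _) (by positivity)
      _ = _ := by ring
  have hder := hasDerivAt_integral_of_norm_sub_le
    (μ := γ.prod γ) (x₀ := (0 : ℝ)) (s := Set.univ)
    (F := fun t z => k (rot t z) * ⟪a, rot' t z⟫)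
    (F' := fun z => fderiv ℝ k z.1 z.2 * ⟪a, z.2⟫ - k z.1 * ⟪a, z.1⟫)
    (bound := fun z => (C * ‖a‖ + D * ‖a‖) * ((1 + ‖z.1‖) * (1 + ‖z.2‖)) ^ (m + l + 1))
    univ_mem (fun t _ => (hmeas t).aestronglyMeasurable) hint ?_ ?_ ?_ ?_
  · obtain ⟨hi, hd⟩ := hder
    have h0 : ∫ z, (fderiv ℝ k z.1 z.2 * ⟪a, z.2⟫ - k z.1 * ⟪a, z.1⟫) ∂(γ.prod γ) = 0 := by
      have : HasDerivAt (fun t => ∫ z, k (rot t z) * ⟪a, rot' t z⟫ ∂(γ.prod γ)) 0 0 := by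
        simp_rw [hconst]; exact hasDerivAt_const _ _
      exact hd.unique this
    have hi2 : Integrable (fun z : E × E => k z.1 * ⟪a, z.1⟫) (γ.prod γ) :=
      ((hk.mul ((polyLip_const a).inner polyLip_id)).integrable (μ := γ)).comp_fst γ
    have hi1 : Integrable (fun z : E × E => fderiv ℝ k z.1 z.2 * ⟪a, z.2⟫) (γ.prod γ) := by
      exact (hi.add hi2).congr (Eventually.of_forall fun z => by simp)
    rw [integral_sub hi1 hi2, sub_eq_zero, integral_prod _ hi1,
      integral_prod _ hi2] at h0
    simp only [integral_const, probReal_univ, one_smul] at h0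
    rw [← h0]
    congr 1
    funext x
    -- With `x` fixed, the average over `y` is the covariance of `⟪∇k(x), y⟫` and `⟪a, y⟫`.
    have := integral_inner_mul_inner_stdGaussian ((InnerProductSpace.toDual ℝ E).symm
      (fderiv ℝ k x)) a
    simpa using this
  · have h1 : Measurable fun z : E × E => fderiv ℝ k z.1 z.2 := by
      simp_rw [← inner_gradient_left_eq]
      exact ((measurable_gradient k).comp measurable_fst).inner measurable_snd
    exact ((h1.mul (by fun_prop)).sub (by fun_prop)).aestronglyMeasurable
  · refine Eventually.of_forall fun z t _ => ?_
    have e : k (rot t z) * ⟪a, rot' t z⟫ - k (rot 0 z) * ⟪a, rot' 0 z⟫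
        = (k (rot t z) - k (rot 0 z)) * ⟪a, rot' t z⟫ + k (rot 0 z) * ⟪a, rot' t z - rot' 0 z⟫ := by
      rw [inner_sub_right]; ring
    have f2 : |⟪a, rot' t z - rot' 0 z⟫| ≤ ‖a‖ * (((1 + ‖z.1‖) * (1 + ‖z.2‖)) * |t - 0|) := by
      refine (abs_real_inner_le_norm _ _).trans ?_
      gcongr
      refine (norm_rot'_sub_rot'_le t 0 z).trans ?_
      gcongr
      nlinarith [norm_nonneg z.1, norm_nonneg z.2, mul_nonneg (norm_nonneg z.1) (norm_nonneg z.2)]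
    have f1 := h1 t 0 z
    have f3 := h2 0 z
    have f4 := hr' t z
    have w := hw z
    set w' := (1 + ‖z.1‖) * (1 + ‖z.2‖)
    have e3 : w' ^ (m + 1) ≤ w' ^ (m + l + 1) := pow_le_pow_right₀ w (by omega)
    have e4 : w' ^ (l + 1) ≤ w' ^ (m + l + 1) := pow_le_pow_right₀ w (by omega)
    rw [e]
    refine (norm_add_le _ _).trans ?_
    rw [norm_mul, norm_mul]
    calc _ ≤ (C * w' ^ m * |t - 0|) * (‖a‖ * w') + (D * w' ^ l) * (‖a‖ * (w' * |t - 0|)) :=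
          add_le_add (mul_le_mul f1 f4 (abs_nonneg _) (by positivity))
            (mul_le_mul f3 f2 (abs_nonneg _) (by positivity))
      _ = (C * ‖a‖ * w' ^ (m + 1) + D * ‖a‖ * w' ^ (l + 1)) * |t - 0| := by ring
      _ ≤ (C * ‖a‖ * w' ^ (m + l + 1) + D * ‖a‖ * w' ^ (m + l + 1)) * |t - 0| := by gcongr
      _ = _ := by rw [Real.norm_eq_abs]; ring
  · exact integrable_prod_of_le_weight (Continuous.aestronglyMeasurable (by fun_prop))
      (C * ‖a‖ + D * ‖a‖) (m + l + 1) fun z => by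
        rw [Real.norm_eq_abs, abs_of_nonneg (by positivity)]
  · have : ∀ᵐ z ∂(γ.prod γ), DifferentiableAt ℝ k z.1 :=
      (measurePreserving_fst (μ := γ) (ν := γ)).quasiMeasurePreserving.ae
        hk.ae_differentiableAt_stdGaussian
    filter_upwards [this] with z hz
    have hz' : HasFDerivAt k (fderiv ℝ k z.1) (rot 0 z) := by simpa [rot] using hz.hasFDerivAt
    have d1 := hz'.comp_hasDerivAt (0 : ℝ) (hasDerivAt_rot 0 z)
    have d2 := ((innerSL ℝ a).hasFDerivAt (x := rot' 0 z)).comp_hasDerivAt (0 : ℝ)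
      (hasDerivAt_rot' 0 z)
    refine (d1.mul d2).congr_deriv ?_
    simp [rot, rot']
    ring

end GaussianCalculus

/-! ### The Mehler operators. -/

namespace GaussianCalculus

open Filter Topology

section

variable {V W F : Type*} [NormedAddCommGroup V] [NormedAddCommGroup W] [NormedAddCommGroup F]

lemma PolyGrowth.comp {h : V → F} (hh : PolyGrowth h) {k : W → V} (hk : PolyGrowth k) :
    PolyGrowth (fun x => h (k x)) := by
  obtain ⟨C, m, hC, h1⟩ := hh
  obtain ⟨D, l, hD, h2⟩ := hk
  refine ⟨C * (1 + D) ^ m, l * m, by positivity, fun x => (h1 _).trans ?_⟩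
  have := one_le_pow₀ (n := l) (one_le_one_add_norm x)
  have := h2 x
  rw [mul_assoc, pow_mul, ← mul_pow]
  gcongr
  nlinarith

lemma polyGrowth_fst : PolyGrowth (fun z : V × W => z.1) :=
  polyGrowth_id.of_norm_le fun z => norm_fst_le z

lemma polyGrowth_snd : PolyGrowth (fun z : V × W => z.2) :=
  polyGrowth_id.of_norm_le fun z => norm_snd_le z

lemma polyGrowth_rot [NormedSpace ℝ V] (θ : ℝ) : PolyGrowth (rot θ : V × V → V) :=
  ((polyGrowth_const _).smul polyGrowth_fst).add ((polyGrowth_const _).smul polyGrowth_snd)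

lemma polyGrowth_rot' [NormedSpace ℝ V] (θ : ℝ) : PolyGrowth (rot' θ : V × V → V) :=
  ((polyGrowth_const _).smul polyGrowth_fst).add ((polyGrowth_const _).smul polyGrowth_snd)

lemma polyGrowth_weight (C : ℝ) (m : ℕ) : PolyGrowth (fun x : V => C * (1 + ‖x‖) ^ m) :=
  (polyGrowth_const C).mul (((polyGrowth_const (1 : ℝ)).add polyGrowth_id.norm).pow m)

lemma norm_rot_sub_left [NormedSpace ℝ V] (θ : ℝ) (x x' y : V) :
    rot θ (x, y) - rot θ (x', y) = Real.cos θ • (x - x') := by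
  simp only [rot]; module

lemma norm_rot_sub_right [NormedSpace ℝ V] (θ : ℝ) (x y y' : V) :
    rot θ (x, y) - rot θ (x, y') = Real.sin θ • (y - y') := by
  simp only [rot]; module

lemma PolyLip.comp_rot_right [NormedSpace ℝ V] {f : V → F} (hf : PolyLip f) (θ : ℝ) (x : V) :
    PolyLip (fun y => f (rot θ (x, y))) :=
  hf.comp_lipschitz |Real.sin θ| fun y y' => by
    rw [norm_rot_sub_right, norm_smul, Real.norm_eq_abs]

end

set_option linter.unusedSectionVars false

variable {E : Type*} [NormedAddCommGroup E] [InnerProductSpace ℝ E] [FiniteDimensional ℝ E]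
  [MeasurableSpace E] [BorelSpace E] {F : Type*} [NormedAddCommGroup F] [NormedSpace ℝ F]

/-- The Mehler operator: the average of `f` over `cos θ • x + sin θ • y`, for `y` standard
Gaussian. -/
def mehler (θ : ℝ) (f : E → F) (x : E) : F := ∫ y, f (rot θ (x, y)) ∂(stdGaussian E)

lemma integral_weight_const_mul (C : ℝ) (m : ℕ) (x : E) :
    ∫ y, C * ((1 + ‖x‖) * (1 + ‖y‖)) ^ m ∂(stdGaussian E)
      = (C * ∫ y : E, (1 + ‖y‖) ^ m ∂(stdGaussian E)) * (1 + ‖x‖) ^ m := by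
  rw [← integral_const_mul, ← integral_mul_const]
  congr 1; funext y; rw [mul_pow]; ring

lemma integrable_const_mul_weight (C : ℝ) (m : ℕ) (x : E) :
    Integrable (fun y : E => C * ((1 + ‖x‖) * (1 + ‖y‖)) ^ m) (stdGaussian E) := by
  simp_rw [mul_pow]
  exact ((integrable_weight _ m).const_mul _).const_mul _

lemma PolyGrowth.mehler {f : E → F} (hf : PolyGrowth f) (θ : ℝ) : PolyGrowth (mehler θ f) := by
  obtain ⟨C, m, hC, h⟩ := hf.exists_rot_bound
  have h0 : 0 ≤ ∫ y : E, (1 + ‖y‖) ^ m ∂(stdGaussian E) := integral_nonneg fun y => by positivity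
  refine ⟨C * ∫ y : E, (1 + ‖y‖) ^ m ∂(stdGaussian E), m, by positivity, fun x => ?_⟩
  rw [← integral_weight_const_mul]
  exact norm_integral_le_of_norm_le (integrable_const_mul_weight C m x)
    (Eventually.of_forall fun y => h θ (x, y))

lemma PolyGrowth.integrable_rot {f : E → F} (hf : PolyGrowth f)
    (hm : StronglyMeasurable f) (θ : ℝ) (x : E) :
    Integrable (fun y => f (rot θ (x, y))) (stdGaussian E) := by
  obtain ⟨C, m, hC, h⟩ := hf.exists_rot_bound
  exact (integrable_const_mul_weight C m x).mono' (hm.comp_measurable (by fun_prop)).aestronglyMeasurable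
    (Eventually.of_forall fun y => h θ (x, y))

lemma stronglyMeasurable_mehler {f : E → F} (hm : StronglyMeasurable f) (θ : ℝ) :
    StronglyMeasurable (mehler θ f) :=
  StronglyMeasurable.integral_prod_right' (hm.comp_measurable (measurable_rot θ))

lemma integral_mehler {f : E → F} (hf : PolyGrowth f) (hm : StronglyMeasurable f) (θ : ℝ) :
    ∫ x, mehler θ f x ∂(stdGaussian E) = ∫ x, f x ∂(stdGaussian E) := by
  have hi : Integrable (fun z : E × E => f (rot θ z)) ((stdGaussian E).prod (stdGaussian E)) :=
    (hf.comp (polyGrowth_rot θ)).integrable (hm.comp_measurable (by fun_prop)).aestronglyMeasurable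
  have := integral_map (measurePreserving_rot (E := E) θ).aemeasurable
    (f := f) (by rw [(measurePreserving_rot θ).map_eq]; exact hm.aestronglyMeasurable)
  rw [(measurePreserving_rot θ).map_eq, integral_prod _ hi] at this
  exact this.symm

lemma PolyLip.exists_mehler_bound {f : E → F} (hf : PolyLip f) :
    ∃ C : ℝ, ∃ m : ℕ, 0 ≤ C ∧ ∀ θ φ (x : E),
      ‖GaussianCalculus.mehler θ f x - GaussianCalculus.mehler φ f x‖ ≤ C * (1 + ‖x‖) ^ m * |θ - φ| := by
  obtain ⟨C, m, hC, h⟩ := hf.exists_rot_bound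
  have h0 : 0 ≤ ∫ y : E, (1 + ‖y‖) ^ m ∂(stdGaussian E) := integral_nonneg fun y => by positivity
  refine ⟨C * ∫ y : E, (1 + ‖y‖) ^ m ∂(stdGaussian E), m, by positivity, fun θ φ x => ?_⟩
  unfold GaussianCalculus.mehler
  rw [← integral_sub (hf.comp_rot_right θ x).integrable (hf.comp_rot_right φ x).integrable,
    ← integral_weight_const_mul, ← integral_mul_const]
  exact norm_integral_le_of_norm_le ((integrable_const_mul_weight C m x).mul_const _)
    (Eventually.of_forall fun y => h θ φ (x, y))

lemma PolyLip.exists_rot_left_bound {f : E → F} (hf : PolyLip f) :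
    ∃ C : ℝ, ∃ m : ℕ, 0 ≤ C ∧ ∀ θ (x x' y : E),
      ‖f (rot θ (x, y)) - f (rot θ (x', y))‖
        ≤ C * ((1 + ‖x‖) * (1 + ‖x'‖)) ^ m * (1 + ‖y‖) ^ (2 * m) * ‖x - x'‖ := by
  obtain ⟨C, m, hC, h⟩ := hf
  refine ⟨C, m, hC, fun θ x x' y => (h _ _).trans ?_⟩
  have h1 := one_add_norm_rot_le θ (x, y)
  have h2 := one_add_norm_rot_le θ (x', y)
  have h3 : ‖rot θ (x, y) - rot θ (x', y)‖ ≤ ‖x - x'‖ := by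
    rw [norm_rot_sub_left, norm_smul]
    exact mul_le_of_le_one_left (norm_nonneg _) (Real.abs_cos_le_one θ)
  calc _ ≤ C * (((1 + ‖x‖) * (1 + ‖y‖)) * ((1 + ‖x'‖) * (1 + ‖y‖))) ^ m * ‖x - x'‖ := by gcongr
    _ = _ := by
      rw [show ((1 + ‖x‖) * (1 + ‖y‖)) * ((1 + ‖x'‖) * (1 + ‖y‖))
        = ((1 + ‖x‖) * (1 + ‖x'‖)) * (1 + ‖y‖) ^ 2 by ring, mul_pow _ (_ ^ 2), ← pow_mul]
      ring

lemma PolyLip.mehler {f : E → F} (hf : PolyLip f) (θ : ℝ) : PolyLip (mehler θ f) := by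
  obtain ⟨C, m, hC, h⟩ := hf.exists_rot_left_bound
  have h0 : 0 ≤ ∫ y : E, (1 + ‖y‖) ^ (2 * m) ∂(stdGaussian E) :=
    integral_nonneg fun y => by positivity
  refine ⟨C * ∫ y : E, (1 + ‖y‖) ^ (2 * m) ∂(stdGaussian E), m, by positivity, fun x x' => ?_⟩
  unfold GaussianCalculus.mehler
  rw [← integral_sub (hf.comp_rot_right θ x).integrable (hf.comp_rot_right θ x').integrable,
    mul_right_comm C, ← integral_const_mul, ← integral_mul_const]
  exact norm_integral_le_of_norm_le (((integrable_weight _ _).const_mul _).mul_const _)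
    (Eventually.of_forall fun y => h θ x x' y)

lemma PolyLip.ae_ae_differentiableAt_rot [FiniteDimensional ℝ F] {f : E → F} (hf : PolyLip f) (θ : ℝ) :
    ∀ᵐ x ∂(stdGaussian E), ∀ᵐ y ∂(stdGaussian E), DifferentiableAt ℝ f (rot θ (x, y)) :=
  Measure.ae_ae_of_ae_prod ((measurePreserving_rot θ).quasiMeasurePreserving.ae
    hf.ae_differentiableAt_stdGaussian)

/-- Differentiation under the integral is licit for those `x` such that `f` is differentiable at
`rot θ (x, y)` for almost all `y`; almost every `x` qualifies because `rot θ` sends the product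
measure to the Gaussian measure. -/
lemma PolyLip.ae_hasDerivAt_mehler {f : E → ℝ} (hf : PolyLip f) (θ : ℝ) :
    ∀ᵐ x ∂(stdGaussian E), HasDerivAt (fun t => GaussianCalculus.mehler t f x)
      (∫ y, ⟪gradient f (rot θ (x, y)), rot' θ (x, y)⟫ ∂(stdGaussian E)) θ := by
  filter_upwards [hf.ae_ae_differentiableAt_rot θ] with x hx
  obtain ⟨C, m, hC, h⟩ := hf.exists_rot_bound
  refine (hasDerivAt_integral_of_norm_sub_le (s := Set.univ) univ_mem
    (fun t _ => (hf.comp_rot_right t x).continuous.aestronglyMeasurable)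
    (hf.comp_rot_right θ x).integrable ?_ ?_ (integrable_const_mul_weight C m x) ?_).2
  · exact (((measurable_gradient f).comp (by fun_prop)).inner (by fun_prop)).aestronglyMeasurable
  · exact Eventually.of_forall fun y t _ => h t θ (x, y)
  · filter_upwards [hx] with y hy
    rw [inner_gradient_left_eq]
    exact hy.hasFDerivAt.comp_hasDerivAt θ (hasDerivAt_rot θ (x, y))

/-- The commutation `∇ M_θ f = cos θ M_θ ∇f`, valid at the same almost every `x` as for the
derivative in the angle. -/
lemma PolyLip.ae_hasFDerivAt_mehler {f : E → ℝ} (hf : PolyLip f) (θ : ℝ) :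
    ∀ᵐ x ∂(stdGaussian E), HasFDerivAt (GaussianCalculus.mehler θ f)
      (Real.cos θ • innerSL ℝ (GaussianCalculus.mehler θ (gradient f) x)) x := by
  filter_upwards [hf.ae_ae_differentiableAt_rot θ] with x hx
  obtain ⟨C, m, hC, h⟩ := hf.exists_rot_left_bound
  have hi : Integrable (fun y => gradient f (rot θ (x, y))) (stdGaussian E) :=
    hf.polyGrowth_gradient.integrable_rot (measurable_gradient f).stronglyMeasurable θ x
  have e : Real.cos θ • innerSL ℝ (GaussianCalculus.mehler θ (gradient f) x)
      = ∫ y, Real.cos θ • innerSL ℝ (gradient f (rot θ (x, y))) ∂(stdGaussian E) := by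
    rw [integral_smul, GaussianCalculus.mehler, ContinuousLinearMap.integral_comp_comm _ hi]
  rw [e]
  refine (hasFDerivAt_integral_of_dominated_loc_of_lip' (s := Metric.ball x 1)
    (bound := fun y => C * ((2 + ‖x‖) * (1 + ‖x‖)) ^ m * (1 + ‖y‖) ^ (2 * m))
    (Metric.ball_mem_nhds x one_pos)
    (fun x' _ => (hf.comp_rot_right θ x').continuous.aestronglyMeasurable)
    (hf.comp_rot_right θ x).integrable ?_ ?_ ((integrable_weight _ _).const_mul _) ?_).2
  · exact ((innerSL ℝ (E := E)).continuous.comp_aestronglyMeasurable hi.1).const_smul (Real.cos θ)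
  · refine Eventually.of_forall fun y x' hx' => (h θ x' x y).trans ?_
    have : 1 + ‖x'‖ ≤ 2 + ‖x‖ := by
      rw [mem_ball_iff_norm] at hx'
      linarith [norm_sub_norm_le x' x]
    gcongr
  · filter_upwards [hx] with y hy
    have hr : HasFDerivAt (fun x' : E => rot θ (x', y)) (Real.cos θ • ContinuousLinearMap.id ℝ E) x :=
      ((hasFDerivAt_id x).const_smul (Real.cos θ)).add_const (Real.sin θ • y)
    refine (hy.hasFDerivAt.comp x hr).congr_fderiv ?_
    ext v
    simp

end GaussianCalculus

/-! ### Entropies along the Mehler operators. -/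

namespace GaussianCalculus

open Filter Topology

/-- A function `ψ` on a closed convex set `I` of reals, with first derivative `ψ₁` and bounded
second derivative `ψ₂`. -/
structure IsBoundedC2On (ψ ψ₁ ψ₂ : ℝ → ℝ) (I : Set ℝ) (K : ℝ) : Prop where
  convex : Convex ℝ I
  closed : IsClosed I
  deriv : ∀ u ∈ I, HasDerivAt ψ (ψ₁ u) u
  deriv₂ : ∀ u ∈ I, HasDerivAt ψ₁ (ψ₂ u) u
  bound : ∀ u ∈ I, |ψ₂ u| ≤ K
  measurable : Measurable ψ₂

namespace IsBoundedC2On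

variable {ψ ψ₁ ψ₂ : ℝ → ℝ} {I : Set ℝ} {K : ℝ} (H : IsBoundedC2On ψ ψ₁ ψ₂ I K)

include H

lemma abs_deriv_sub_le {a b : ℝ} (ha : a ∈ I) (hb : b ∈ I) : |ψ₁ a - ψ₁ b| ≤ K * |a - b| :=
  H.convex.norm_image_sub_le_of_norm_hasDerivWithin_le
    (fun u hu => (H.deriv₂ u hu).hasDerivWithinAt) H.bound hb ha

/-- The mean value inequality on the part of `I` within distance `|a - b|` of `b`: there `ψ₁` is
controlled by its value at `b`, so that `ψ₁` itself need not be bounded. -/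
lemma abs_sub_le {a b : ℝ} (ha : a ∈ I) (hb : b ∈ I) :
    |ψ a - ψ b| ≤ (|ψ₁ b| + K * |a - b|) * |a - b| := by
  have hK : 0 ≤ K := (abs_nonneg _).trans (H.bound a ha)
  refine (H.convex.inter (convex_closedBall b |a - b|)).norm_image_sub_le_of_norm_hasDerivWithin_le
    (f' := ψ₁) (fun u hu => (H.deriv u hu.1).hasDerivWithinAt) (fun u hu => ?_)
    ⟨hb, by simp⟩ ⟨ha, by simp [Real.dist_eq]⟩
  have h1 := H.abs_deriv_sub_le hu.1 hb
  have h2 : |u - b| ≤ |a - b| := by simpa [Real.dist_eq] using hu.2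
  have h3 : K * |u - b| ≤ K * |a - b| := by gcongr
  have h4 := abs_sub_abs_le_abs_sub (ψ₁ u) (ψ₁ b)
  rw [Real.norm_eq_abs]
  linarith

lemma polyLip_comp_deriv {V : Type*} [NormedAddCommGroup V] {u : V → ℝ} (hu : PolyLip u)
    (hI : ∀ x, u x ∈ I) : PolyLip fun x => ψ₁ (u x) := by
  have hK : 0 ≤ K := (abs_nonneg _).trans (H.bound _ (hI 0))
  refine ((polyLip_const K).mul hu).of_norm_le fun x y => (H.abs_deriv_sub_le (hI x) (hI y)).trans_eq ?_
  rw [← mul_sub, norm_mul, Real.norm_eq_abs, Real.norm_eq_abs, abs_of_nonneg hK]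

lemma polyLip_comp {V : Type*} [NormedAddCommGroup V] {u : V → ℝ} (hu : PolyLip u)
    (hI : ∀ x, u x ∈ I) : PolyLip fun x => ψ (u x) := by
  have hK : 0 ≤ K := (abs_nonneg _).trans (H.bound _ (hI 0))
  obtain ⟨C, m, hC, h1⟩ := (H.polyLip_comp_deriv hu hI).polyGrowth
  obtain ⟨A, a, hA, h3⟩ := hu.polyGrowth
  obtain ⟨D, l, hD, h2⟩ := hu
  refine ⟨(C + K * D * 2) * D, (m + 2 * l + 1) + l, by positivity, fun x y => ?_⟩
  have e1 := h2 x y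
  have e2 : ‖ψ₁ (u y)‖ ≤ C * ((1 + ‖x‖) * (1 + ‖y‖)) ^ m := (h1 y).trans (by
    gcongr; exact one_add_norm_le_weight' x y)
  have hw := one_le_weight x y
  have e4 : ‖x - y‖ ≤ 2 * ((1 + ‖x‖) * (1 + ‖y‖)) := (norm_sub_le x y).trans (by
    nlinarith [norm_nonneg x, norm_nonneg y, mul_nonneg (norm_nonneg x) (norm_nonneg y)])
  refine (H.abs_sub_le (hI x) (hI y)).trans ?_
  rw [Real.norm_eq_abs] at e1 e2
  set w := (1 + ‖x‖) * (1 + ‖y‖)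
  have g1 : w ^ m ≤ w ^ (m + 2 * l + 1) := pow_le_pow_right₀ hw (by omega)
  have g2 : w ^ (l + 1) ≤ w ^ (m + 2 * l + 1) := pow_le_pow_right₀ hw (by omega)
  calc (|ψ₁ (u y)| + K * |u x - u y|) * |u x - u y|
      ≤ (C * w ^ m + K * (D * w ^ l * (2 * w))) * (D * w ^ l * ‖x - y‖) := by
        gcongr
        exact e1.trans (by gcongr)
    _ = (C * w ^ m + K * D * 2 * w ^ (l + 1)) * (D * w ^ l * ‖x - y‖) := by ring
    _ ≤ (C * w ^ (m + 2 * l + 1) + K * D * 2 * w ^ (m + 2 * l + 1)) * (D * w ^ l * ‖x - y‖) := by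
        gcongr
    _ = _ := by rw [pow_add _ (m + 2 * l + 1) l]; ring

variable {E : Type*} [NormedAddCommGroup E] [InnerProductSpace ℝ E] [FiniteDimensional ℝ E]
  [MeasurableSpace E] [BorelSpace E]

lemma mehler_mem {f : E → ℝ} (hf : PolyLip f) (hI : ∀ x, f x ∈ I) (θ : ℝ) (x : E) :
    mehler θ f x ∈ I :=
  H.convex.integral_mem H.closed (Eventually.of_forall fun _ => hI _)
    (hf.comp_rot_right θ x).integrable

/-- In the rotated variables `U = rot θ (x, y)` and `V = rot' θ (x, y)` the gradient of `f` depends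
on `U` only, while `x = rot (-θ) (U, V)`. Stein's lemma in `V`, with `U` fixed, therefore
differentiates only `ψ₁ ∘ mehler θ f`, and second derivatives of `f`, which need not exist, never
appear. Rotating back, the average of the gradient over `y` rebuilds `mehler θ (gradient f) x`. -/
lemma integral_deriv_mul_inner {f : E → ℝ} (hf : PolyLip f) (hI : ∀ x, f x ∈ I) (θ : ℝ) :
    ∫ x, ψ₁ (mehler θ f x) *
        (∫ y, ⟪gradient f (rot θ (x, y)), rot' θ (x, y)⟫ ∂(stdGaussian E)) ∂(stdGaussian E)
      = -(Real.sin θ * Real.cos θ) * ∫ x, ψ₂ (mehler θ f x) * ‖mehler θ (gradient f) x‖ ^ 2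
        ∂(stdGaussian E) := by
  set γ := stdGaussian E
  set u := mehler θ f
  set q := mehler θ (gradient f)
  have hK : 0 ≤ K := (abs_nonneg _).trans (H.bound _ (hI 0))
  have huI : ∀ x, u x ∈ I := H.mehler_mem hf hI θ
  have hu : PolyLip u := hf.mehler θ
  set κ : E → ℝ := fun x => ψ₁ (u x)
  have hκ : PolyLip κ := H.polyLip_comp_deriv hu huI
  have hgm := measurable_gradient f
  have hgg := hf.polyGrowth_gradient
  have hq : PolyGrowth q := hgg.mehler θ
  have hqm : Measurable q := (stronglyMeasurable_mehler hgm.stronglyMeasurable θ).measurable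
  have h2m : Measurable fun x => ψ₂ (u x) := H.measurable.comp hu.continuous.measurable
  have h2g : PolyGrowth fun x => ψ₂ (u x) := (polyGrowth_const K).of_norm_le fun x => by
    rw [Real.norm_eq_abs, Real.norm_eq_abs, abs_of_nonneg hK]; exact H.bound _ (huI x)
  have hκm := hκ.continuous.measurable
  have i1 : Integrable (fun z : E × E => κ z.1 * ⟪gradient f (rot θ z), rot' θ z⟫) (γ.prod γ) :=
    ((hκ.polyGrowth.comp polyGrowth_fst).mul
      ((hgg.comp (polyGrowth_rot θ)).inner (polyGrowth_rot' θ))).integrable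
      ((hκm.comp measurable_fst).mul
        ((hgm.comp (measurable_rot θ)).inner (measurable_rot' θ))).aestronglyMeasurable
  have m2 : Measurable fun z : E × E => κ (rot (-θ) z) * ⟪gradient f z.1, z.2⟫ :=
    (hκm.comp (measurable_rot _)).mul ((hgm.comp measurable_fst).inner measurable_snd)
  have i2 : Integrable (fun z : E × E => κ (rot (-θ) z) * ⟪gradient f z.1, z.2⟫) (γ.prod γ) :=
    ((hκ.polyGrowth.comp (polyGrowth_rot _)).mul
      ((hgg.comp polyGrowth_fst).inner polyGrowth_snd)).integrable m2.aestronglyMeasurable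
  have m3 : Measurable fun z : E × E =>
      ψ₂ (u (rot (-θ) z)) * ⟪q (rot (-θ) z), gradient f z.1⟫ :=
    (h2m.comp (measurable_rot _)).mul
      ((hqm.comp (measurable_rot _)).inner (hgm.comp measurable_fst))
  have i3 : Integrable (fun z : E × E =>
      ψ₂ (u (rot (-θ) z)) * ⟪q (rot (-θ) z), gradient f z.1⟫) (γ.prod γ) :=
    ((h2g.comp (polyGrowth_rot _)).mul
      ((hq.comp (polyGrowth_rot _)).inner (hgg.comp polyGrowth_fst))).integrable
      m3.aestronglyMeasurable
  have i4 : Integrable (fun z : E × E => ψ₂ (u z.1) * ⟪q z.1, gradient f (rot θ z)⟫) (γ.prod γ) :=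
    ((h2g.comp polyGrowth_fst).mul
      ((hq.comp polyGrowth_fst).inner (hgg.comp (polyGrowth_rot θ)))).integrable
      ((h2m.comp measurable_fst).mul
        ((hqm.comp measurable_fst).inner (hgm.comp (measurable_rot θ)))).aestronglyMeasurable
  have hinv : ∀ z : E × E, rot (-θ) (rot θ z, rot' θ z) = z.1 := fun z => by
    rw [← rot_rotation θ z]
    simp only [rot, Real.cos_neg, Real.sin_neg]
    module
  have hdiff : ∀ᵐ U ∂γ, ∀ᵐ V ∂γ, HasFDerivAt u (Real.cos θ • innerSL ℝ (q (rot (-θ) (U, V))))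
      (rot (-θ) (U, V)) :=
    Measure.ae_ae_of_ae_prod ((measurePreserving_rot (-θ)).quasiMeasurePreserving.ae
      (hf.ae_hasFDerivAt_mehler θ))
  -- The factor `sin (-θ)` is the derivative of `rot (-θ) (U, V)` in `V`; the factor `cos θ` comes
  -- from the gradient of the Mehler average.
  have step : ∀ᵐ U ∂γ, ∫ V, κ (rot (-θ) (U, V)) * ⟪gradient f U, V⟫ ∂γ
      = ∫ V, -(Real.sin θ * Real.cos θ) *
        (ψ₂ (u (rot (-θ) (U, V))) * ⟪q (rot (-θ) (U, V)), gradient f U⟫) ∂γ := by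
    filter_upwards [hdiff] with U hU
    rw [stein_lemma (hκ.comp_rot_right (-θ) U) (gradient f U)]
    refine integral_congr_ae ?_
    filter_upwards [hU] with V hV
    have hr : HasFDerivAt (fun V : E => rot (-θ) (U, V))
        (Real.sin (-θ) • ContinuousLinearMap.id ℝ E) V :=
      ((hasFDerivAt_id V).const_smul (Real.sin (-θ))).const_add (Real.cos (-θ) • U)
    have hk := (((H.deriv₂ _ (huI _)).comp_hasFDerivAt _ hV).comp V hr).fderiv
    have hk' : fderiv ℝ (fun V : E => κ (rot (-θ) (U, V))) V = _ := hk
    rw [hk']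
    simp
    ring
  calc _ = ∫ x, ∫ y, κ x * ⟪gradient f (rot θ (x, y)), rot' θ (x, y)⟫ ∂γ ∂γ := by
        simp_rw [integral_const_mul]; rfl
    _ = ∫ z, κ z.1 * ⟪gradient f (rot θ z), rot' θ z⟫ ∂(γ.prod γ) := (integral_prod _ i1).symm
    _ = ∫ z, κ (rot (-θ) z) * ⟪gradient f z.1, z.2⟫ ∂(γ.prod γ) := by
        rw [← integral_comp_rotation θ m2.aestronglyMeasurable]
        simp_rw [hinv]
        rfl
    _ = ∫ U, ∫ V, κ (rot (-θ) (U, V)) * ⟪gradient f U, V⟫ ∂γ ∂γ := integral_prod _ i2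
    _ = ∫ U, ∫ V, -(Real.sin θ * Real.cos θ) *
        (ψ₂ (u (rot (-θ) (U, V))) * ⟪q (rot (-θ) (U, V)), gradient f U⟫) ∂γ ∂γ :=
        integral_congr_ae step
    _ = -(Real.sin θ * Real.cos θ) * ∫ U, ∫ V,
        ψ₂ (u (rot (-θ) (U, V))) * ⟪q (rot (-θ) (U, V)), gradient f U⟫ ∂γ ∂γ := by
        simp_rw [integral_const_mul]
    _ = -(Real.sin θ * Real.cos θ) * ∫ z,
        ψ₂ (u (rot (-θ) z)) * ⟪q (rot (-θ) z), gradient f z.1⟫ ∂(γ.prod γ) := by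
        rw [integral_prod _ i3]
    _ = -(Real.sin θ * Real.cos θ) * ∫ z, ψ₂ (u z.1) * ⟪q z.1, gradient f (rot θ z)⟫ ∂(γ.prod γ) := by
        rw [← integral_comp_rotation θ m3.aestronglyMeasurable]
        simp_rw [hinv]
        rfl
    _ = _ := by
        rw [integral_prod _ i4]
        congr 2
        funext x
        simp only
        rw [integral_const_mul, ← real_inner_self_eq_norm_sq]
        congr 1
        exact integral_inner (𝕜 := ℝ)
          (hgg.integrable_rot hgm.stronglyMeasurable θ x) (q x)

/-- The derivative of the `ψ`-entropy along the Mehler operators. -/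
theorem hasDerivAt_integral_comp_mehler {f : E → ℝ} (hf : PolyLip f) (hI : ∀ x, f x ∈ I) (θ : ℝ) :
    HasDerivAt (fun t => ∫ x, ψ (mehler t f x) ∂(stdGaussian E))
      (-(Real.sin θ * Real.cos θ) * ∫ x, ψ₂ (mehler θ f x) * ‖mehler θ (gradient f) x‖ ^ 2
        ∂(stdGaussian E)) θ := by
  rw [← H.integral_deriv_mul_inner hf hI]
  set γ := stdGaussian E
  have hK : 0 ≤ K := (abs_nonneg _).trans (H.bound _ (hI 0))
  have huI : ∀ t x, mehler t f x ∈ I := H.mehler_mem hf hI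
  have hκ := H.polyLip_comp_deriv (hf.mehler θ) (huI θ)
  have hψ := fun t => H.polyLip_comp (hf.mehler t) (huI t)
  obtain ⟨C, m, hC, h⟩ := hf.exists_mehler_bound (E := E)
  refine (hasDerivAt_integral_of_norm_sub_le (s := Metric.ball θ 1)
    (bound := fun x => (|ψ₁ (mehler θ f x)| + K * (C * (1 + ‖x‖) ^ m)) * (C * (1 + ‖x‖) ^ m))
    (Metric.ball_mem_nhds θ one_pos)
    (fun t _ => (hψ t).continuous.aestronglyMeasurable) (hψ θ).integrable ?_ ?_ ?_ ?_).2
  · refine (hκ.continuous.measurable.mul ?_).aestronglyMeasurable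
    exact (StronglyMeasurable.integral_prod_right' (f := fun z : E × E =>
      ⟪gradient f (rot θ z), rot' θ z⟫) (((measurable_gradient f).comp (measurable_rot θ)).inner
        (measurable_rot' θ)).stronglyMeasurable).measurable
  · refine Eventually.of_forall fun x t ht => (H.abs_sub_le (huI t x) (huI θ x)).trans ?_
    have e1 := h t θ x
    have e2 : |t - θ| ≤ 1 := by rw [Metric.mem_ball, Real.dist_eq] at ht; exact ht.le
    rw [Real.norm_eq_abs] at e1
    have e3 : |mehler t f x - mehler θ f x| ≤ C * (1 + ‖x‖) ^ m :=
      e1.trans (mul_le_of_le_one_right (by positivity) e2)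
    rw [Real.norm_eq_abs, mul_assoc]
    gcongr
  · exact ((hκ.polyGrowth.norm.add ((polyGrowth_const K).mul (polyGrowth_weight C m))).mul
      (polyGrowth_weight C m)).integrable
      (((continuous_abs.comp hκ.continuous).add (by fun_prop)).mul
        (by fun_prop)).aestronglyMeasurable
  · filter_upwards [hf.ae_hasDerivAt_mehler θ] with x hx
    exact (H.deriv _ (huI θ x)).comp θ hx

end IsBoundedC2On

end GaussianCalculus

/-! ### Poincaré, logarithmic Sobolev and Faber–Krahn inequalities in Gauss space. -/

namespace GaussianCalculus

open Filter Topology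

/-- Jensen's inequality for the jointly convex function `(r, v) ↦ ‖v‖² / r`. It is obtained by
integrating `‖v - (r / s) A‖² / r ≥ 0`, where `A` and `s` are the integrals of `v` and `r`. -/
lemma norm_integral_sq_le_mul {α H : Type*} [MeasurableSpace α] {μ : Measure α}
    [NormedAddCommGroup H] [InnerProductSpace ℝ H] [CompleteSpace H] {v : α → H} {r : α → ℝ}
    (hv : Integrable v μ) (hr : Integrable r μ) (hvr : Integrable (fun x => (r x)⁻¹ * ‖v x‖ ^ 2) μ)
    (hpos : ∀ x, 0 < r x) (hs : 0 < ∫ x, r x ∂μ) :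
    (∫ x, r x ∂μ)⁻¹ * ‖∫ x, v x ∂μ‖ ^ 2 ≤ ∫ x, (r x)⁻¹ * ‖v x‖ ^ 2 ∂μ := by
  set A := ∫ x, v x ∂μ
  set s := ∫ x, r x ∂μ
  have h0 : ∀ x, 0 ≤ (r x)⁻¹ * ‖v x‖ ^ 2 - 2 * s⁻¹ * ⟪A, v x⟫ + s⁻¹ ^ 2 * ‖A‖ ^ 2 * r x := fun x => by
    have e : (r x)⁻¹ * ‖v x‖ ^ 2 - 2 * s⁻¹ * ⟪A, v x⟫ + s⁻¹ ^ 2 * ‖A‖ ^ 2 * r x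
        = (r x)⁻¹ * ‖v x - (r x * s⁻¹) • A‖ ^ 2 := by
      have := (hpos x).ne'
      rw [norm_sub_sq_real, inner_smul_right, norm_smul, mul_pow, Real.norm_eq_abs, sq_abs,
        real_inner_comm]
      field_simp
    rw [e]
    have := hpos x
    positivity
  have i2 : Integrable (fun x => 2 * s⁻¹ * ⟪A, v x⟫) μ := (hv.const_inner A).const_mul _
  have i3 : Integrable (fun x => s⁻¹ ^ 2 * ‖A‖ ^ 2 * r x) μ := hr.const_mul _
  have h1 : 0 ≤ ∫ x, ((r x)⁻¹ * ‖v x‖ ^ 2 - 2 * s⁻¹ * ⟪A, v x⟫ + s⁻¹ ^ 2 * ‖A‖ ^ 2 * r x) ∂μ :=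
    integral_nonneg h0
  have i12 : Integrable (fun x => (r x)⁻¹ * ‖v x‖ ^ 2 - 2 * s⁻¹ * ⟪A, v x⟫) μ := hvr.sub i2
  rw [integral_add i12 i3, integral_sub hvr i2, integral_const_mul, integral_const_mul,
    integral_inner hv, real_inner_self_eq_norm_sq] at h1
  have e : s⁻¹ ^ 2 * ‖A‖ ^ 2 * s = s⁻¹ * ‖A‖ ^ 2 := by field_simp
  have e' : s⁻¹ ^ 2 * ‖A‖ ^ 2 * ∫ x, r x ∂μ = s⁻¹ * ‖A‖ ^ 2 := e
  rw [e'] at h1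
  linarith

variable {E : Type*} [NormedAddCommGroup E] [InnerProductSpace ℝ E] [FiniteDimensional ℝ E]
  [MeasurableSpace E] [BorelSpace E]

/-- The Mehler operators join `f`, at angle `0`, to its mean, at angle `π / 2`. The constant `1 / 2`
is the integral of `sin θ cos θ` between these angles. -/
lemma IsBoundedC2On.entropy_le {ψ ψ₁ ψ₂ : ℝ → ℝ} {I : Set ℝ} {K : ℝ}
    (H : IsBoundedC2On ψ ψ₁ ψ₂ I K) {f : E → ℝ} (hf : PolyLip f) (hI : ∀ x, f x ∈ I) (D : ℝ)
    (hD : ∀ θ, ∫ x, ψ₂ (mehler θ f x) * ‖mehler θ (gradient f) x‖ ^ 2 ∂(stdGaussian E) ≤ D) :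
    ∫ x, ψ (f x) ∂(stdGaussian E) - ψ (∫ x, f x ∂(stdGaussian E)) ≤ D / 2 := by
  set J := fun θ => ∫ x, ψ₂ (mehler θ f x) * ‖mehler θ (gradient f) x‖ ^ 2 ∂(stdGaussian E)
  -- The added term makes `M` monotone: its derivative is `sin θ cos θ (D - J θ)`.
  set M := fun θ => ∫ x, ψ (mehler θ f x) ∂(stdGaussian E) + D / 2 * Real.sin θ ^ 2
  have hM : ∀ θ, HasDerivAt M (Real.sin θ * Real.cos θ * (D - J θ)) θ := fun θ => by
    refine ((H.hasDerivAt_integral_comp_mehler hf hI θ).add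
      (((Real.hasDerivAt_sin θ).pow 2).const_mul (D / 2))).congr_deriv ?_
    simp only [J]
    push_cast
    ring
  have hmono : MonotoneOn M (Set.Icc 0 (Real.pi / 2)) := by
    refine monotoneOn_of_deriv_nonneg (convex_Icc _ _)
      (fun θ _ => (hM θ).continuousAt.continuousWithinAt)
      (fun θ _ => (hM θ).differentiableAt.differentiableWithinAt) fun θ hθ => ?_
    rw [interior_Icc] at hθ
    rw [(hM θ).deriv]
    have h1 := Real.sin_nonneg_of_nonneg_of_le_pi hθ.1.le (by linarith [hθ.2, Real.pi_pos])
    have h2 := Real.cos_nonneg_of_neg_pi_div_two_le_of_le (by linarith [hθ.1, Real.pi_pos]) hθ.2.le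
    have h3 := hD θ
    exact mul_nonneg (mul_nonneg h1 h2) (by simp only [J]; linarith)
  have h0 := hmono (Set.left_mem_Icc.2 (by positivity)) (Set.right_mem_Icc.2 (by positivity))
    (by positivity)
  simp [M, mehler, rot] at h0
  linarith

/-- The **Gaussian Poincaré inequality** for locally Lipschitz functions. -/
theorem gaussian_poincare {f : E → ℝ} (hf : PolyLip f) :
    ∫ x, f x ^ 2 ∂(stdGaussian E) - (∫ x, f x ∂(stdGaussian E)) ^ 2
      ≤ ∫ x, ‖gradient f x‖ ^ 2 ∂(stdGaussian E) := by
  have H : IsBoundedC2On (fun x => x ^ 2) (fun x => 2 * x) (fun _ => 2) Set.univ 2 :=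
    { convex := convex_univ
      closed := isClosed_univ
      deriv := fun u _ => by simpa using hasDerivAt_pow 2 u
      deriv₂ := fun u _ => by simpa using (hasDerivAt_id u).const_mul 2
      bound := fun u _ => by norm_num
      measurable := measurable_const }
  have hgm := measurable_gradient f
  have hgg := hf.polyGrowth_gradient
  have h := H.entropy_le hf (fun _ => trivial)
    (2 * ∫ x, ‖gradient f x‖ ^ 2 ∂(stdGaussian E)) fun θ => ?_
  · linarith
  · rw [integral_const_mul]
    gcongr 2 * ?_
    have hg2 : PolyGrowth fun x => ‖gradient f x‖ ^ 2 := hgg.norm.pow 2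
    have hg2m : StronglyMeasurable fun x => ‖gradient f x‖ ^ 2 := (hgm.norm.pow_const 2).stronglyMeasurable
    rw [← integral_mehler hg2 hg2m θ]
    refine integral_mono ?_ ?_ fun x => ?_
    · exact ((hgg.mehler θ).norm.pow 2).integrable
        ((stronglyMeasurable_mehler hgm.stronglyMeasurable θ).norm.pow 2).aestronglyMeasurable
    · exact (hg2.mehler θ).integrable (stronglyMeasurable_mehler hg2m θ).aestronglyMeasurable
    · have := norm_integral_sq_le_mul (μ := stdGaussian E) (r := fun _ => 1)
        (hgg.integrable_rot hgm.stronglyMeasurable θ x) (integrable_const 1)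
        (by simpa using hg2.integrable_rot hg2m θ x) (fun _ => one_pos) (by simp)
      simpa [mehler] using this

/-- The **Gaussian logarithmic Sobolev inequality** for locally Lipschitz functions that are
bounded below by a positive constant. -/
theorem gaussian_log_sobolev {f : E → ℝ} (hf : PolyLip f) {δ : ℝ} (hδ : 0 < δ)
    (hfδ : ∀ x, δ ≤ f x) :
    ∫ x, f x * Real.log (f x) ∂(stdGaussian E)
        - (∫ x, f x ∂(stdGaussian E)) * Real.log (∫ x, f x ∂(stdGaussian E))
      ≤ (∫ x, (f x)⁻¹ * ‖gradient f x‖ ^ 2 ∂(stdGaussian E)) / 2 := by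
  have H : IsBoundedC2On (fun x => x * Real.log x) (fun x => Real.log x + 1) (fun x => x⁻¹)
      (Set.Ici δ) δ⁻¹ :=
    { convex := convex_Ici δ
      closed := isClosed_Ici
      deriv := fun u hu => Real.hasDerivAt_mul_log (hδ.trans_le hu).ne'
      deriv₂ := fun u hu => (Real.hasDerivAt_log (hδ.trans_le hu).ne').add_const 1
      bound := fun u hu => by
        have hu' : δ ≤ u := hu
        rw [abs_of_pos (inv_pos.2 (hδ.trans_le hu'))]
        gcongr
      measurable := measurable_inv }
  have hgm := measurable_gradient f
  have hgg := hf.polyGrowth_gradient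
  refine H.entropy_le hf hfδ _ fun θ => ?_
  have hmem : ∀ x, δ ≤ mehler θ f x := H.mehler_mem hf hfδ θ
  have hinv : ∀ k : E → ℝ, (∀ x, δ ≤ k x) → PolyGrowth fun x => (k x)⁻¹ := fun k hk =>
    (polyGrowth_const δ⁻¹).of_norm_le fun x => by
      rw [norm_inv, norm_inv, Real.norm_of_nonneg hδ.le, Real.norm_of_nonneg (hδ.le.trans (hk x))]
      gcongr
      exact hk x
  have hg2 : PolyGrowth fun x => (f x)⁻¹ * ‖gradient f x‖ ^ 2 :=
    (hinv f hfδ).mul (hgg.norm.pow 2)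
  have hg2m : StronglyMeasurable fun x => (f x)⁻¹ * ‖gradient f x‖ ^ 2 :=
    (hf.continuous.measurable.inv.mul (hgm.norm.pow_const 2)).stronglyMeasurable
  rw [← integral_mehler hg2 hg2m θ]
  refine integral_mono ?_ ?_ fun x => ?_
  · exact ((hinv _ hmem).mul ((hgg.mehler θ).norm.pow 2)).integrable
      ((hf.mehler θ).continuous.measurable.inv.mul
        ((stronglyMeasurable_mehler hgm.stronglyMeasurable θ).measurable.norm.pow_const
          2)).aestronglyMeasurable
  · exact (hg2.mehler θ).integrable (stronglyMeasurable_mehler hg2m θ).aestronglyMeasurable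
  · exact norm_integral_sq_le_mul (μ := stdGaussian E)
      (hgg.integrable_rot hgm.stronglyMeasurable θ x) (hf.comp_rot_right θ x).integrable
      (hg2.integrable_rot hg2m θ x) (fun _ => hδ.trans_le (hfδ _)) (hδ.trans_le (hmem x))

/-- A **Faber–Krahn inequality** in Gauss space: a function that vanishes off a set `A` satisfies
a Poincaré inequality with a constant that improves as the measure of `A` decreases. -/
theorem gaussian_faber_krahn {g : E → ℝ} (hg : PolyLip g) {A : Set E} (hA : MeasurableSet A)
    (hgA : ∀ x ∉ A, g x = 0) (hpos : 0 < (stdGaussian E).real A) :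
    (∫ x, g x ^ 2 ∂(stdGaussian E)) * Real.log ((stdGaussian E).real A)⁻¹
      ≤ 2 * ∫ x, ‖gradient g x‖ ^ 2 ∂(stdGaussian E) := by
  set γ := stdGaussian E
  set q := γ.real A
  set v := ∫ x, g x ^ 2 ∂γ
  set G := ∫ x, ‖gradient g x‖ ^ 2 ∂γ
  have hg2 : PolyLip fun x => g x ^ 2 := by simpa [pow_two] using hg.mul hg
  have hv0 : 0 ≤ v := integral_nonneg fun x => sq_nonneg _
  have hvA : ∫ x in A, g x ^ 2 ∂γ = v :=
    setIntegral_eq_integral_of_forall_compl_eq_zero fun x hx => by simp [hgA x hx]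
  -- The logarithmic Sobolev inequality for `g² + δ`, with the entropy bounded below by separating
  -- `A`, where Jensen applies, from its complement, where the function is the constant `δ`.
  have key : ∀ δ : ℝ, 0 < δ → q * (((v + q * δ) / q) * Real.log ((v + q * δ) / q))
      + (1 - q) * (δ * Real.log δ) - (v + δ) * Real.log (v + δ) ≤ 2 * G := fun δ hδ => by
    have hf : PolyLip fun x => g x ^ 2 + δ := hg2.add (polyLip_const δ)
    have hfδ : ∀ x, δ ≤ g x ^ 2 + δ := fun x => by nlinarith [sq_nonneg (g x)]
    have hLS := gaussian_log_sobolev hf hδ hfδ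
    have hfint : ∫ x, (g x ^ 2 + δ) ∂γ = v + δ := by
      rw [integral_add hg2.integrable (integrable_const δ)]; simp [v]
    have hflog : Integrable (fun x => (g x ^ 2 + δ) * Real.log (g x ^ 2 + δ)) γ := by
      have hg' : PolyGrowth fun x => Real.log (g x ^ 2 + δ) := by
        refine PolyGrowth.of_norm_le ((hf.polyGrowth).add (polyGrowth_const δ⁻¹)) fun x => ?_
        have h1 := hδ.trans_le (hfδ x)
        have h2 := Real.log_le_sub_one_of_pos h1
        have h3 := Real.one_sub_inv_le_log_of_pos h1
        have h4 : (g x ^ 2 + δ)⁻¹ ≤ δ⁻¹ := by gcongr; exact hfδ x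
        have h5 : 0 < δ⁻¹ := by positivity
        rw [Real.norm_eq_abs, Real.norm_eq_abs, abs_of_pos (a := _ + δ⁻¹) (by positivity), abs_le]
        constructor <;> linarith
      exact (hf.polyGrowth.mul hg').integrable
        (hf.continuous.mul (hf.continuous.log fun x => (hδ.trans_le (hfδ x)).ne')).aestronglyMeasurable
    -- The squared gradient is `4 g² ‖∇g‖²`, and `g² / (g² + δ) ≤ 1`.
    have hgrad : ∫ x, (g x ^ 2 + δ)⁻¹ * ‖gradient (fun x => g x ^ 2 + δ) x‖ ^ 2 ∂γ ≤ 4 * G := by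
      rw [← integral_const_mul]
      refine integral_mono_of_nonneg (Eventually.of_forall fun x => ?_)
        (((hg.polyGrowth_gradient.norm.pow 2).integrable
          ((measurable_gradient g).norm.pow_const 2).aestronglyMeasurable).const_mul 4) ?_
      · have := hδ.trans_le (hfδ x)
        positivity
      · filter_upwards [hg.ae_differentiableAt_stdGaussian] with x hx
        have h1 := hδ.trans_le (hfδ x)
        have hd : fderiv ℝ (fun x => g x ^ 2 + δ) x = (2 * g x) • fderiv ℝ g x := by
          have := (hx.hasFDerivAt.pow 2).add_const δ
          simpa using this.fderiv
        rw [norm_gradient, norm_gradient, hd, norm_smul, mul_pow, Real.norm_eq_abs, sq_abs,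
          inv_mul_le_iff₀ h1]
        nlinarith [mul_nonneg hδ.le (sq_nonneg ‖fderiv ℝ g x‖)]
    have hc : 0 < (v + q * δ) / q := by positivity
    -- Jensen for `x log x` on `A`, written with the tangent line at the mean `c` of `g² + δ` over
    -- `A`.
    have hA1 : (v + q * δ) * Real.log ((v + q * δ) / q)
        ≤ ∫ x in A, (g x ^ 2 + δ) * Real.log (g x ^ 2 + δ) ∂γ := by
      have hAf : ∫ x in A, (g x ^ 2 + δ) ∂γ = v + q * δ := by
        rw [integral_add hg2.integrable.integrableOn (integrable_const δ), hvA]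
        simp [q]
      set c := (v + q * δ) / q with hcdef
      have hcq : q * c = v + q * δ := by rw [hcdef]; field_simp
      have : ∫ x in A, ((g x ^ 2 + δ) * (Real.log c + 1) - c) ∂γ
          = (v + q * δ) * Real.log c := by
        rw [integral_sub (hf.integrable.integrableOn.mul_const _) (integrable_const c),
          integral_mul_const, hAf]
        simp only [integral_const, MeasurableSet.univ, measureReal_restrict_apply, Set.univ_inter,
          smul_eq_mul]
        change _ - q * c = _
        rw [hcq]; ring
      rw [← this]
      refine integral_mono ((hf.integrable.integrableOn.mul_const _).sub (integrable_const c))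
        hflog.integrableOn fun x => ?_
      have h1 := hδ.trans_le (hfδ x)
      have h2 := Real.log_le_sub_one_of_pos (div_pos hc h1)
      rw [Real.log_div hc.ne' h1.ne'] at h2
      have h3 := mul_le_mul_of_nonneg_left h2 h1.le
      have h4 : (g x ^ 2 + δ) * (c / (g x ^ 2 + δ) - 1) = c - (g x ^ 2 + δ) := by
        field_simp
      rw [h4] at h3
      simp only
      linarith
    have hA2 : ∫ x in Aᶜ, (g x ^ 2 + δ) * Real.log (g x ^ 2 + δ) ∂γ
        = (1 - q) * (δ * Real.log δ) := by
      rw [setIntegral_congr_fun hA.compl (g := fun _ => δ * Real.log δ) fun x hx => by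
        simp [hgA x hx]]
      simp [probReal_compl_eq_one_sub hA, q]
    have hsum := integral_add_compl hA hflog
    rw [hfint] at hLS
    have e : q * (((v + q * δ) / q) * Real.log ((v + q * δ) / q))
        = (v + q * δ) * Real.log ((v + q * δ) / q) := by
      rw [← mul_assoc, mul_div_cancel₀ _ hpos.ne']
    rw [e]
    have hLS' : ∫ x, (g x ^ 2 + δ) * Real.log (g x ^ 2 + δ) ∂γ - (v + δ) * Real.log (v + δ)
      ≤ (∫ x, (g x ^ 2 + δ)⁻¹ * ‖gradient (fun x => g x ^ 2 + δ) x‖ ^ 2 ∂γ) / 2 := hLS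
    linarith
  -- Since `x log x` is continuous at `0`, one may let `δ` tend to `0`; the contribution of the
  -- complement of `A` disappears.
  have hcont : Continuous fun δ : ℝ => q * (((v + q * δ) / q) * Real.log ((v + q * δ) / q))
      + (1 - q) * (δ * Real.log δ) - (v + δ) * Real.log (v + δ) := by
    have h := Real.continuous_mul_log
    exact ((continuous_const.mul (h.comp (f := fun δ => (v + q * δ) / q) (by fun_prop))).add
      (continuous_const.mul h)).sub (h.comp (f := fun δ => v + δ) (by fun_prop))
  have hlim := le_of_tendsto (hcont.continuousWithinAt (s := Set.Ioi 0) (x := 0)).tendsto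
    (eventually_mem_nhdsWithin.mono key)
  rcases hv0.eq_or_lt with h0 | h0
  · rw [← h0, zero_mul]
    exact mul_nonneg zero_le_two (integral_nonneg fun x => sq_nonneg _)
  · refine le_trans (le_of_eq ?_) hlim
    rw [mul_zero, add_zero, zero_mul, mul_zero, add_zero,
      Real.log_div h0.ne' hpos.ne', Real.log_inv]
    field_simp
    ring

end GaussianCalculus

/-! ### Existence, uniqueness and continuity of the Lasso. -/

namespace LassoSize

open Filter Topology

variable {n p : ℕ}

/-- The linear map `b ↦ X b`. -/
def fitL (X : Matrix (Fin n) (Fin p) ℝ) :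
    EuclideanSpace ℝ (Fin p) →L[ℝ] EuclideanSpace ℝ (Fin n) :=
  LinearMap.toContinuousLinearMap
    { toFun := fit X
      map_add' := fun a b => by ext i; simp [fit, Matrix.mulVec_add]
      map_smul' := fun c b => by ext i; simp [fit, Matrix.mulVec_smul] }

lemma fit_add (X : Matrix (Fin n) (Fin p) ℝ) (a b) : fit X (a + b) = fit X a + fit X b :=
  map_add (fitL X) a b

lemma fit_sub (X : Matrix (Fin n) (Fin p) ℝ) (a b) : fit X (a - b) = fit X a - fit X b :=
  map_sub (fitL X) a b

lemma fit_smul (X : Matrix (Fin n) (Fin p) ℝ) (c : ℝ) (b) : fit X (c • b) = c • fit X b :=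
  map_smul (fitL X) c b

lemma fit_zero (X : Matrix (Fin n) (Fin p) ℝ) : fit X 0 = 0 := map_zero (fitL X)

lemma continuous_fit (X : Matrix (Fin n) (Fin p) ℝ) : Continuous (fit X) := (fitL X).continuous

lemma fit_eq_sum (X : Matrix (Fin n) (Fin p) ℝ) (b : EuclideanSpace ℝ (Fin p)) :
    fit X b = ∑ j, b j • column X j := by
  ext i
  simp [fit, column, Matrix.mulVec, dotProduct, mul_comm]

lemma fit_single (X : Matrix (Fin n) (Fin p) ℝ) (j : Fin p) :
    fit X (EuclideanSpace.single j 1) = column X j := by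
  rw [fit_eq_sum, Finset.sum_eq_single j] <;> simp +contextual

lemma inner_fit (X : Matrix (Fin n) (Fin p) ℝ) (b : EuclideanSpace ℝ (Fin p)) (r) :
    ⟪fit X b, r⟫ = ∑ j, b j * ⟪column X j, r⟫ := by
  rw [fit_eq_sum, sum_inner]
  simp_rw [real_inner_smul_left]

lemma norm_le_sum_abs (b : EuclideanSpace ℝ (Fin p)) : ‖b‖ ≤ ∑ j, |b j| := by
  have h : b = ∑ j, b j • EuclideanSpace.single j (1 : ℝ) := by
    ext i
    simp [Finset.sum_apply, Pi.single_apply]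
  calc ‖b‖ = ‖∑ j, b j • EuclideanSpace.single j (1 : ℝ)‖ := by rw [← h]
    _ ≤ ∑ j, ‖b j • EuclideanSpace.single j (1 : ℝ)‖ := norm_sum_le _ _
    _ = _ := by simp [norm_smul]

section Design

variable {X : Matrix (Fin n) (Fin p) ℝ}

lemma RankCondition.eq_zero_of_card_le (hX : RankCondition X) {δ : Fin p → ℝ}
    (hδ : ∀ j, δ j = -1 ∨ δ j = 1) {T : Finset (Fin p)} (hT : T.card ≤ min (n + 1) p)
    {d : EuclideanSpace ℝ (Fin p)} (hd : ∀ j ∉ T, d j = 0) (hfit : fit X d = 0)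
    (hsum : ∑ j, d j * δ j = 0) : d = 0 := by
  -- The rank condition speaks of exactly `min (n + 1) p` columns, so `T` is enlarged to that size;
  -- `d` vanishes on the added indices.
  obtain ⟨T', hTT', hcard⟩ := Finset.exists_superset_card_eq hT (by simp)
  set e := T'.orderEmbOfFin hcard
  have hrank := hX δ hδ e
  have hker : LinearMap.ker (signedColumns X δ e).mulVecLin = ⊥ := by
    have h := (signedColumns X δ e).mulVecLin.finrank_range_add_finrank_ker
    rw [← Matrix.rank, hrank, Module.finrank_fin_fun] at h
    exact Submodule.finrank_eq_zero.1 (by omega)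
  have hsupp : ∀ f : Fin p → ℝ, ∑ i, d (e i) * f (e i) = ∑ j, d j * f j := fun f => by
    have h1 : ∑ j ∈ T', d j * f j = ∑ j, d j * f j :=
      Finset.sum_subset (Finset.subset_univ _) fun j _ hj => by
        rw [hd j fun h => hj (hTT' h), zero_mul]
    have h2 : Finset.univ.map e.toEmbedding = T' := by
      simp [e]
    rw [← h1, ← h2, Finset.sum_map]
    rfl
  have hz : (fun i => d (e i)) = 0 := by
    rw [← Submodule.mem_bot ℝ, ← hker, LinearMap.mem_ker, Matrix.mulVecLin_apply]
    funext s
    rcases s with i | u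
    · have h1 := congrArg (fun v : EuclideanSpace ℝ (Fin n) => v i) hfit
      simp only [fit, Matrix.mulVec, dotProduct, PiLp.zero_apply] at h1
      simp only [signedColumns, Matrix.mulVec, dotProduct, Matrix.fromRows_apply_inl,
        Matrix.submatrix_apply, id, Pi.zero_apply]
      rw [← h1]
      simp_rw [mul_comm (X i _)]
      exact hsupp fun j => X i j
    · simp only [signedColumns, Matrix.mulVec, dotProduct, Matrix.fromRows_apply_inr,
        Matrix.of_apply, Pi.zero_apply]
      rw [← hsum]
      simp_rw [mul_comm (δ _)]
      exact hsupp δ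
  ext j
  by_cases hj : j ∈ T'
  · have : j ∈ Set.range e := by
      rw [Finset.range_orderEmbOfFin]; exact hj
    obtain ⟨i, rfl⟩ := this
    exact congrFun hz i
  · exact hd j fun h => hj (hTT' h)

/-- Columns that have the same nonzero correlation with a vector, up to sign, are linearly
independent. -/
lemma RankCondition.eq_zero (hX : RankCondition X) {T : Finset (Fin p)}
    {r : EuclideanSpace ℝ (Fin n)} {c : ℝ} (hc : c ≠ 0)
    (hr : ∀ j ∈ T, ⟪column X j, r⟫ = -c ∨ ⟪column X j, r⟫ = c)
    {d : EuclideanSpace ℝ (Fin p)} (hd : ∀ j ∉ T, d j = 0) (hfit : fit X d = 0) : d = 0 := by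
  classical
  set δ : Fin p → ℝ := fun j => if ⟪column X j, r⟫ = -c then -1 else 1
  have hδ : ∀ j, δ j = -1 ∨ δ j = 1 := fun j => by
    simp only [δ]; split_ifs <;> simp
  have hδr : ∀ j ∈ T, ⟪column X j, r⟫ = c * δ j := fun j hj => by
    simp only [δ]
    split_ifs with h
    · rw [h]; ring
    · rw [(hr j hj).resolve_left h]; ring
  -- Pairing a relation `X d = 0` with `r` shows that `d` also annihilates the row of signs, so a
  -- relation among the columns is a relation among the signed columns.
  have hsum : ∀ d : EuclideanSpace ℝ (Fin p), (∀ j ∉ T, d j = 0) → fit X d = 0 →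
      ∑ j, d j * δ j = 0 := fun d hd hfit => by
    have h1 := inner_fit X d r
    rw [hfit, inner_zero_left] at h1
    have h2 : ∑ j, d j * ⟪column X j, r⟫ = c * ∑ j, d j * δ j := by
      rw [Finset.mul_sum]
      refine Finset.sum_congr rfl fun j _ => ?_
      by_cases hj : j ∈ T
      · rw [hδr j hj]; ring
      · rw [hd j hj]; ring
    rw [h2] at h1
    exact (mul_eq_zero.1 h1.symm).resolve_left hc
  by_cases hT : T.card ≤ min (n + 1) p
  · exact hX.eq_zero_of_card_le hδ hT hd hfit (hsum d hd hfit)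
  -- A larger `T` cannot occur: `n + 1` of its columns would be linearly independent in `ℝⁿ`.
  · exfalso
    have hTp : T.card ≤ p := by simpa using Finset.card_le_univ T
    have hnT : n + 1 ≤ T.card := by omega
    obtain ⟨T', hT'T, hT'⟩ := Finset.exists_subset_card_eq hnT
    have hli : LinearIndependent ℝ fun j : T' => column X j := by
      rw [Fintype.linearIndependent_iff]
      intro a ha j
      set d' : EuclideanSpace ℝ (Fin p) :=
        WithLp.toLp 2 fun j => if h : j ∈ T' then a ⟨j, h⟩ else 0
      have hd'0 : ∀ j ∉ T', d' j = 0 := fun j hj => by simp [d', hj]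
      have hfit' : fit X d' = 0 := by
        rw [fit_eq_sum, ← ha, ← Finset.sum_subset (Finset.subset_univ T') fun j _ hj => by
          rw [hd'0 j hj, zero_smul], ← Finset.sum_coe_sort T']
        refine Finset.sum_congr rfl fun i _ => ?_
        simp [d']
      have := hX.eq_zero_of_card_le hδ (T := T') (by omega) hd'0 hfit'
        (hsum d' (fun j hj => hd'0 j fun h => hj (hT'T h)) hfit')
      have h3 := congrArg (fun v : EuclideanSpace ℝ (Fin p) => v j) this
      simpa [d'] using h3
    have := hli.fintype_card_le_finrank
    simp [hT'] at this

end Design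

section Existence

variable {X : Matrix (Fin n) (Fin p) ℝ} {lam : ℝ} {y : EuclideanSpace ℝ (Fin n)}
  {b b' : EuclideanSpace ℝ (Fin p)}

lemma continuous_lassoObjective (X : Matrix (Fin n) (Fin p) ℝ) (lam : ℝ) :
    Continuous fun z : EuclideanSpace ℝ (Fin n) × EuclideanSpace ℝ (Fin p) =>
      lassoObjective X lam z.1 z.2 := by
  unfold lassoObjective
  have := continuous_fit X
  fun_prop

lemma isLassoSolution_iff : IsLassoSolution X lam y b ↔
    ∀ b', lassoObjective X lam y b ≤ lassoObjective X lam y b' := by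
  simp [IsLassoSolution, IsMinOn, IsMinFilter]

lemma mul_norm_le_lassoObjective (hlam : 0 < lam) : lam * ‖b‖ ≤ lassoObjective X lam y b := by
  have h1 := mul_le_mul_of_nonneg_left (norm_le_sum_abs b) hlam.le
  have h2 : 0 ≤ ‖fit X b - y‖ ^ 2 / (2 * (n : ℝ)) := by positivity
  unfold lassoObjective
  linarith

lemma exists_isLassoSolution (X : Matrix (Fin n) (Fin p) ℝ) (hlam : 0 < lam) (y) :
    ∃ b, IsLassoSolution X lam y b := by
  have hc : Continuous fun b => lassoObjective X lam y b := by
    have := continuous_lassoObjective X lam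
    fun_prop
  have hnorm : Tendsto (fun b : EuclideanSpace ℝ (Fin p) => ‖b‖)
      (cocompact (EuclideanSpace ℝ (Fin p))) atTop := tendsto_norm_cocompact_atTop
  have ht : Tendsto (fun b => lassoObjective X lam y b) (cocompact (EuclideanSpace ℝ (Fin p))) atTop :=
    tendsto_atTop_mono (fun b => mul_norm_le_lassoObjective hlam) (hnorm.const_mul_atTop hlam)
  obtain ⟨b, hb⟩ := hc.exists_forall_le ht
  exact ⟨b, isLassoSolution_iff.2 hb⟩

/-- The squared norm is strictly convex in the fit: by the parallelogram identity, the midpoint of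
two solutions with different fits would have a smaller objective. -/
lemma IsLassoSolution.fit_eq (hn : 0 < n) (hlam : 0 < lam) (hb : IsLassoSolution X lam y b)
    (hb' : IsLassoSolution X lam y b') : fit X b = fit X b' := by
  have hn' : (0 : ℝ) < n := by exact_mod_cast hn
  rw [isLassoSolution_iff] at hb hb'
  have h1 := hb ((1 / 2 : ℝ) • (b + b'))
  have h2 := hb' b
  have h3 := hb b'
  have hs : ∑ j, |((1 / 2 : ℝ) • (b + b')) j| ≤ (∑ j, |b j| + ∑ j, |b' j|) / 2 := by
    rw [← Finset.sum_add_distrib, Finset.sum_div]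
    refine Finset.sum_le_sum fun j _ => ?_
    simp only [PiLp.smul_apply, PiLp.add_apply, smul_eq_mul, abs_mul]
    rw [abs_of_pos (by norm_num : (0 : ℝ) < 1 / 2)]
    linarith [abs_add_le (b j) (b' j)]
  have hq : ‖fit X ((1 / 2 : ℝ) • (b + b')) - y‖ ^ 2
      = (‖fit X b - y‖ ^ 2 + ‖fit X b' - y‖ ^ 2) / 2 - ‖fit X b - fit X b'‖ ^ 2 / 4 := by
    have e1 : fit X ((1 / 2 : ℝ) • (b + b')) - y
        = (1 / 2 : ℝ) • ((fit X b - y) + (fit X b' - y)) := by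
      rw [fit_smul, fit_add]; module
    have e2 : fit X b - fit X b' = (fit X b - y) - (fit X b' - y) := by abel
    rw [e1, e2]
    generalize fit X b - y = u
    generalize fit X b' - y = w
    rw [norm_smul, mul_pow, norm_add_sq_real, norm_sub_sq_real]
    norm_num
    ring
  unfold lassoObjective at h1 h2 h3
  rw [hq] at h1
  have h4 : lam * ∑ j, |((1 / 2 : ℝ) • (b + b')) j| ≤ lam * ((∑ j, |b j| + ∑ j, |b' j|) / 2) := by
    gcongr
  have h5 : ((‖fit X b - y‖ ^ 2 + ‖fit X b' - y‖ ^ 2) / 2 - ‖fit X b - fit X b'‖ ^ 2 / 4)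
      / (2 * (n : ℝ)) = (‖fit X b - y‖ ^ 2 / (2 * n) + ‖fit X b' - y‖ ^ 2 / (2 * n)) / 2
        - ‖fit X b - fit X b'‖ ^ 2 / (8 * n) := by
    field_simp
    ring
  rw [h5] at h1
  have h6 : ‖fit X b - fit X b'‖ ^ 2 / (8 * n) ≤ 0 := by linarith
  have h7 : ‖fit X b - fit X b'‖ ^ 2 ≤ 0 := by
    rw [div_le_iff₀ (by positivity)] at h6; linarith
  have h8 : ‖fit X b - fit X b'‖ = 0 := by nlinarith [norm_nonneg (fit X b - fit X b')]
  exact sub_eq_zero.1 (norm_eq_zero.1 h8)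

/-- The stationarity condition of the Lasso on its support. -/
lemma IsLassoSolution.inner_column (hn : 0 < n) (hb : IsLassoSolution X lam y b) {j : Fin p}
    (hj : b j ≠ 0) : ⟪column X j, y - fit X b⟫ = n * lam * (SignType.sign (b j) : ℝ) := by
  classical
  have hn' : (0 : ℝ) < n := by exact_mod_cast hn
  rw [isLassoSolution_iff] at hb
  -- Only coordinate `j` moves along this line, and `|b j + t|` is differentiable at `t = 0` because
  -- `b j ≠ 0`.
  set φ : ℝ → ℝ := fun t => lassoObjective X lam y (b + t • EuclideanSpace.single j 1)
  have hmin : IsLocalMin φ 0 := Eventually.of_forall fun t => by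
    simp only [φ, zero_smul, add_zero]; exact hb _
  have hφ : HasDerivAt φ ((2 * ⟪fit X b - y, column X j⟫) / (2 * n)
      + lam * ∑ i, if i = j then (SignType.sign (b j) : ℝ) else 0) 0 := by
    have e : φ = fun t => ‖(fit X b - y) + t • column X j‖ ^ 2 / (2 * (n : ℝ))
        + lam * ∑ i, |b i + t * (if i = j then 1 else 0)| := by
      funext t
      simp only [φ, lassoObjective, fit_add, fit_smul, fit_single]
      congr 3
      · congr 1; abel
      · funext i
        simp
    rw [e]
    refine HasDerivAt.add (HasDerivAt.div_const ?_ _) (HasDerivAt.const_mul _ ?_)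
    · have h1 : HasDerivAt (fun t : ℝ => (fit X b - y) + t • column X j) (column X j) 0 := by
        simpa using ((hasDerivAt_id (0 : ℝ)).smul_const (column X j)).const_add (fit X b - y)
      simpa using h1.norm_sq
    · refine HasDerivAt.fun_sum fun i _ => ?_
      split_ifs with h
      · subst h
        have h1 : HasDerivAt (fun t : ℝ => b i + t * 1) 1 0 := by
          simpa using (hasDerivAt_id (0 : ℝ)).const_add (b i)
        have h2 := (hasDerivAt_abs (x := b i + 0 * 1) (by simpa using hj)).comp (0 : ℝ) h1
        simpa [Function.comp_def] using h2
      · simpa using hasDerivAt_const (0 : ℝ) |b i|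
  have h0 := hmin.hasDerivAt_eq_zero hφ
  rw [Finset.sum_ite_eq' Finset.univ j, if_pos (Finset.mem_univ j)] at h0
  have h1 : ⟪column X j, y - fit X b⟫ = -⟪fit X b - y, column X j⟫ := by
    rw [real_inner_comm, ← inner_neg_left, neg_sub]
  rw [h1]
  field_simp at h0
  linarith

lemma IsLassoSolution.inner_column_eq_or (hn : 0 < n) (hb : IsLassoSolution X lam y b) {j : Fin p}
    (hj : b j ≠ 0) : ⟪column X j, y - fit X b⟫ = -(n * lam) ∨
      ⟪column X j, y - fit X b⟫ = n * lam := by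
  rw [hb.inner_column hn hj]
  rcases lt_or_gt_of_ne hj with h | h
  · left; simp [h]
  · right; simp [h]

/-- Two solutions share their fit, hence their residual. Every column in the union of their supports
has correlation `± n lam` with this residual, so these columns are independent and the difference of
the solutions is zero. -/
lemma IsLassoSolution.unique (hn : 0 < n) (hX : RankCondition X) (hlam : 0 < lam)
    (hb : IsLassoSolution X lam y b) (hb' : IsLassoSolution X lam y b') : b = b' := by
  classical
  have hn' : (0 : ℝ) < n := by exact_mod_cast hn
  have hf := hb.fit_eq hn hlam hb'
  refine sub_eq_zero.1 (hX.eq_zero (T := {j | b j ≠ 0 ∨ b' j ≠ 0}) (r := y - fit X b)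
    (c := n * lam) (by positivity) (fun j hj => ?_) (fun j hj => ?_) (by rw [fit_sub, hf, sub_self]))
  · rw [Finset.mem_filter_univ] at hj
    rcases hj with hj | hj
    · exact hb.inner_column_eq_or hn hj
    · rw [hf]; exact hb'.inner_column_eq_or hn hj
  · simp only [Finset.mem_filter_univ, not_or, not_not] at hj
    simp [hj.1, hj.2]

lemma lasso_spec (X : Matrix (Fin n) (Fin p) ℝ) (hlam : 0 < lam) (y) :
    IsLassoSolution X lam y (lasso X lam y) :=
  Classical.epsilon_spec (exists_isLassoSolution X hlam y)

lemma existsUnique_isLassoSolution (hn : 0 < n) (hX : RankCondition X) (hlam : 0 < lam) (y) :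
    ∃! b, IsLassoSolution X lam y b :=
  ⟨lasso X lam y, lasso_spec X hlam y, fun _ hb => hb.unique hn hX hlam (lasso_spec X hlam y)⟩

lemma mem_selected {j : Fin p} : j ∈ selected X lam y ↔ lasso X lam y j ≠ 0 := by
  simp [selected]

lemma eq_zero_of_selected (hn : 0 < n) (hX : RankCondition X) (hlam : 0 < lam)
    {d : EuclideanSpace ℝ (Fin p)} (hd : ∀ j ∉ selected X lam y, d j = 0) (hfit : fit X d = 0) :
    d = 0 := by
  have hn' : (0 : ℝ) < n := by exact_mod_cast hn
  exact hX.eq_zero (r := y - fit X (lasso X lam y)) (c := n * lam) (by positivity)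
    (fun j hj => (lasso_spec X hlam y).inner_column_eq_or hn (mem_selected.1 hj)) hd hfit

lemma linearIndependent_selected (hn : 0 < n) (hX : RankCondition X) (hlam : 0 < lam)
    (y : EuclideanSpace ℝ (Fin n)) :
    LinearIndependent ℝ fun j : selected X lam y => column X j := by
  classical
  rw [Fintype.linearIndependent_iff]
  intro a ha j
  set d' : EuclideanSpace ℝ (Fin p) :=
    WithLp.toLp 2 fun j => if h : j ∈ selected X lam y then a ⟨j, h⟩ else 0
  have hd'0 : ∀ j ∉ selected X lam y, d' j = 0 := fun j hj => by simp [d', hj]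
  have hfit' : fit X d' = 0 := by
    rw [fit_eq_sum, ← ha, ← Finset.sum_subset (Finset.subset_univ (selected X lam y))
      fun j _ hj => by rw [hd'0 j hj, zero_smul], ← Finset.sum_coe_sort (selected X lam y)]
    refine Finset.sum_congr rfl fun i _ => ?_
    simp [d']
  have h3 := congrArg (fun v : EuclideanSpace ℝ (Fin p) => v j)
    (eq_zero_of_selected hn hX hlam hd'0 hfit')
  simpa [d'] using h3

lemma finrank_span_selected (hn : 0 < n) (hX : RankCondition X) (hlam : 0 < lam)
    (y : EuclideanSpace ℝ (Fin n)) :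
    Module.finrank ℝ (Submodule.span ℝ (column X '' (selected X lam y : Set (Fin p))))
      = (selected X lam y).card := by
  have h := finrank_span_eq_card (linearIndependent_selected hn hX hlam y)
  have e : Set.range (fun j : selected X lam y => column X j)
      = column X '' (selected X lam y : Set (Fin p)) := by
    ext v; simp
  rw [e] at h
  simpa using h

lemma card_selected_le (hn : 0 < n) (hX : RankCondition X) (hlam : 0 < lam)
    (y : EuclideanSpace ℝ (Fin n)) : (selected X lam y).card ≤ n := by
  have := (linearIndependent_selected hn hX hlam y).fintype_card_le_finrank
  simpa using this

/-- Compactness and uniqueness: near `y` the solutions stay in a fixed ball, because the objective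
at `0` bounds their norms, and passing to the limit in the minimality inequality shows that each
cluster point is the solution at `y`. -/
lemma continuous_lasso (hn : 0 < n) (hX : RankCondition X) (hlam : 0 < lam) :
    Continuous (lasso X lam) := by
  rw [continuous_iff_continuousAt]
  intro y
  refine (isCompact_closedBall (0 : EuclideanSpace ℝ (Fin p))
    ((lassoObjective X lam y 0 + 1) / lam)).tendsto_nhds_of_unique_mapClusterPt ?_ fun b _ hb => ?_
  · have hc : Continuous fun y' => lassoObjective X lam y' 0 := by
      have := continuous_lassoObjective X lam
      fun_prop
    have hev := (hc.tendsto y).eventually_lt_const (lt_add_one (lassoObjective X lam y 0))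
    filter_upwards [hev] with y' hy'
    rw [mem_closedBall_zero_iff, le_div_iff₀ hlam, mul_comm]
    exact (mul_norm_le_lassoObjective hlam).trans
      ((isLassoSolution_iff.1 (lasso_spec X hlam y') 0).trans hy'.le)
  · obtain ⟨U, hU, hUb⟩ := mapClusterPt_iff_ultrafilter.1 hb
    refine IsLassoSolution.unique hn hX hlam (isLassoSolution_iff.2 fun b' => ?_)
      (lasso_spec X hlam y)
    have hUy : Tendsto (fun y' : EuclideanSpace ℝ (Fin n) => y') U (𝓝 y) := hU
    have hO := continuous_lassoObjective X lam
    have t1 := (hO.tendsto (y, b)).comp (hUy.prodMk_nhds hUb)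
    have t2 := (hO.tendsto (y, b')).comp (hUy.prodMk_nhds (tendsto_const_nhds (x := b')))
    exact le_of_tendsto_of_tendsto t1 t2 (Eventually.of_forall fun y' => isLassoSolution_iff.1 (lasso_spec X hlam y') b')

end Existence

end LassoSize

/-! ### Continuous piecewise affine functions. -/

namespace GaussianCalculus

open Filter Topology

/-- A continuous function that is Lipschitz on each piece of a finite closed cover is Lipschitz. -/
lemma norm_sub_le_of_finite_closed_cover {V F ι : Type*} [NormedAddCommGroup V] [NormedSpace ℝ V]
    [NormedAddCommGroup F] [Finite ι] {f : V → F} (hf : Continuous f) {D : ι → Set V}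
    (hD : ∀ i, IsClosed (D i)) (hcov : ∀ x, ∃ i, x ∈ D i) {K : ℝ}
    (hK : ∀ i, ∀ x ∈ D i, ∀ y ∈ D i, ‖f x - f y‖ ≤ K * ‖x - y‖) (x y : V) :
    ‖f x - f y‖ ≤ K * ‖x - y‖ := by
  set c : ℝ → V := fun t => x + t • (y - x)
  have hc : Continuous c := by fun_prop
  set s : Set ℝ := {t | ‖f (c t) - f x‖ ≤ K * (t * ‖y - x‖)}
  have hs : IsClosed s := isClosed_le (by fun_prop) (by fun_prop)
  have h1 : (1 : ℝ) ∈ s := by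
    -- Continuous induction along the segment: the set of good times is closed, and each good time
    -- before `1` has a later one.
    refine (hs.inter isClosed_Icc).mem_of_ge_of_forall_exists_gt (a := 0) (by simp [s, c])
      zero_le_one fun t ht => ?_
    -- Finitely many pieces cover the points just after `t`, so one piece recurs arbitrarily close
    -- to `t` and, being closed, contains `c t` too.
    obtain ⟨i, hi⟩ : ∃ i, ∃ᶠ t' in 𝓝[>] t, c t' ∈ D i := by
      by_contra! h
      have h' : ∀ᶠ t' in 𝓝[>] t, ∀ i, c t' ∉ D i :=
        eventually_all.2 h
      obtain ⟨t', ht'⟩ := h'.exists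
      obtain ⟨i, hi⟩ := hcov (c t')
      exact ht' i hi
    have hti : c t ∈ D i :=
      (hD i).mem_of_frequently_of_tendsto hi (hc.continuousWithinAt (s := Set.Ioi t)).tendsto
    obtain ⟨t', ht'i, ht'⟩ := (hi.and_eventually (Ioc_mem_nhdsGT ht.2.2)).exists
    refine ⟨t', ?_, ht'⟩
    have e1 := hK i _ ht'i _ hti
    have e2 : c t' - c t = (t' - t) • (y - x) := by simp only [c]; module
    rw [e2, norm_smul, Real.norm_of_nonneg (by linarith [ht'.1])] at e1
    have e3 : ‖f (c t) - f x‖ ≤ K * (t * ‖y - x‖) := ht.1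
    have e4 := norm_sub_le_norm_sub_add_norm_sub (f (c t')) (f (c t)) (f x)
    change ‖f (c t') - f x‖ ≤ K * (t' * ‖y - x‖)
    nlinarith
  have h2 : ‖f (c 1) - f x‖ ≤ K * (1 * ‖y - x‖) := h1
  have e : c 1 = y := by simp [c]
  rw [e, one_mul] at h2
  rwa [norm_sub_rev, norm_sub_rev x y]

/-- If a function has affine increments on a closed set, its derivative is the linear part at
almost every point of the set where it is differentiable. -/
lemma ae_fderiv_eq_of_affine_on {V : Type*} [NormedAddCommGroup V] [NormedSpace ℝ V]
    [FiniteDimensional ℝ V] [Nontrivial V] [MeasurableSpace V] [BorelSpace V] {μ : Measure V}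
    [μ.IsAddHaarMeasure] {h : V → ℝ} {A : V →L[ℝ] ℝ} {D : Set V} (hD : MeasurableSet D)
    (hA : ∀ x ∈ D, ∀ y ∈ D, h x - h y = A (x - y)) :
    ∀ᵐ x ∂μ, x ∈ D → DifferentiableAt ℝ h x → fderiv ℝ h x = A := by
  -- Multiplying by a nonzero vector makes `h` a map from `V` to itself, to which the
  -- almost-everywhere derivative bound for `ApproximatesLinearOn` applies, here with error `0`.
  obtain ⟨e, he⟩ := exists_ne (0 : V)
  set s := D ∩ {x | DifferentiableAt ℝ h x}
  have hs : MeasurableSet s := hD.inter (measurableSet_of_differentiableAt ℝ h)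
  have happ : ApproximatesLinearOn (fun x => h x • e) (A.smulRight e) s 0 := by
    intro x hx y hy
    have : h x • e - h y • e - (A.smulRight e) (x - y) = 0 := by
      rw [ContinuousLinearMap.smulRight_apply, ← hA x hx.1 y hy.1]; module
    change ‖h x • e - h y • e - (A.smulRight e) (x - y)‖ ≤ _
    rw [this]
    simp
  have h1 := happ.norm_fderiv_sub_le μ hs (fun x => (fderiv ℝ h x).smulRight e)
    fun x hx => ((DifferentiableAt.hasFDerivAt hx.2).smul_const e).hasFDerivWithinAt
  rw [ae_restrict_iff' hs] at h1
  filter_upwards [h1] with x hx hxD hxd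
  have h2 := hx ⟨hxD, hxd⟩
  rw [nonpos_iff_eq_zero, nnnorm_eq_zero, sub_eq_zero] at h2
  ext v
  have h3 := congrArg (fun L : V →L[ℝ] V => L v) h2
  simp only [ContinuousLinearMap.smulRight_apply] at h3
  exact smul_left_injective ℝ he h3

end GaussianCalculus

/-! ### The Lasso is piecewise affine. -/

namespace LassoSize

open Filter Topology GaussianCalculus

variable {n p : ℕ} {X : Matrix (Fin n) (Fin p) ℝ} {lam : ℝ}

/-- The Lasso has affine increments on each set of data where the signs are constant. -/
lemma exists_lasso_sub_eq (hn : 0 < n) (hX : RankCondition X) (hlam : 0 < lam)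
    (y₀ : EuclideanSpace ℝ (Fin n)) :
    ∃ A : EuclideanSpace ℝ (Fin n) →L[ℝ] EuclideanSpace ℝ (Fin p),
      (∀ v, fit X (A v) = proj X (selected X lam y₀) v) ∧
      (∀ b : EuclideanSpace ℝ (Fin p), (∀ j ∉ selected X lam y₀, b j = 0) → A (fit X b) = b) ∧
      ∀ y y', (∀ j, SignType.sign (lasso X lam y j) = SignType.sign (lasso X lam y₀ j)) →
        (∀ j, SignType.sign (lasso X lam y' j) = SignType.sign (lasso X lam y₀ j)) →
        lasso X lam y - lasso X lam y' = A (y - y') := by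
  set S := selected X lam y₀
  set W : Submodule ℝ (EuclideanSpace ℝ (Fin p)) :=
    { carrier := {b | ∀ j ∉ S, b j = 0}
      add_mem' := fun ha hb j hj => by simp [ha j hj, hb j hj]
      zero_mem' := fun j _ => rfl
      smul_mem' := fun c b hb j hj => by simp [hb j hj] }
  set f : W →ₗ[ℝ] EuclideanSpace ℝ (Fin n) := (fitL X : _ →ₗ[ℝ] _).comp W.subtype
  have hf : LinearMap.ker f = ⊥ := by
    rw [LinearMap.ker_eq_bot']
    intro b hb
    exact Subtype.ext (eq_zero_of_selected hn hX hlam b.2 hb)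
  obtain ⟨g, hg⟩ := f.exists_leftInverse_of_injective hf
  have hgf : ∀ w : W, g (fit X w) = w := fun w => LinearMap.congr_fun hg w
  have hcol : ∀ b : EuclideanSpace ℝ (Fin p), (∀ j ∉ S, b j = 0) →
      fit X b ∈ Submodule.span ℝ (column X '' (S : Set (Fin p))) := fun b hb => by
    rw [fit_eq_sum]
    refine Submodule.sum_mem _ fun j _ => ?_
    by_cases hj : j ∈ S
    · exact Submodule.smul_mem _ _ (Submodule.subset_span ⟨j, hj, rfl⟩)
    · rw [hb j hj, zero_smul]; exact Submodule.zero_mem _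
  have hspan : ∀ v ∈ Submodule.span ℝ (column X '' (S : Set (Fin p))), ∃ w : W, fit X w = v := by
    intro v hv
    have : Submodule.span ℝ (column X '' (S : Set (Fin p))) ≤ LinearMap.range f := by
      rw [Submodule.span_le]
      rintro _ ⟨j, hj, rfl⟩
      refine ⟨⟨EuclideanSpace.single j 1, fun i hi => ?_⟩, fit_single X j⟩
      have : i ≠ j := fun h => hi (h ▸ hj)
      simp [this]
    exact this hv
  -- The least squares map on `S`: project onto the span of the selected columns, then invert `X` on
  -- vectors supported in `S`.
  set A₀ : EuclideanSpace ℝ (Fin n) →ₗ[ℝ] EuclideanSpace ℝ (Fin p) :=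
    W.subtype.comp (g.comp (proj X S : _ →ₗ[ℝ] _))
  have hA₀ : ∀ v, A₀ v = g (proj X S v) := fun v => rfl
  have hAfit : ∀ b : EuclideanSpace ℝ (Fin p), (∀ j ∉ S, b j = 0) → A₀ (fit X b) = b :=
    fun b hb => by
      rw [hA₀, proj, Submodule.starProjection_eq_self_iff.2 (hcol b hb)]
      exact congrArg Subtype.val (hgf ⟨b, hb⟩)
  have hAorth : ∀ v, (∀ j ∈ S, ⟪column X j, v⟫ = 0) → A₀ v = 0 := fun v hv => by
    have : proj X S v = 0 := by
      rw [proj, Submodule.starProjection_apply_eq_zero_iff, Submodule.mem_orthogonal]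
      intro u hu
      induction hu using Submodule.span_induction with
      | mem u hu => obtain ⟨j, hj, rfl⟩ := hu; exact hv j hj
      | zero => exact inner_zero_left _
      | add a b _ _ ha hb => rw [inner_add_left, ha, hb, add_zero]
      | smul c a _ ha => rw [real_inner_smul_left, ha, mul_zero]
    rw [hA₀, this, map_zero]; rfl
  refine ⟨LinearMap.toContinuousLinearMap A₀, fun v => ?_, hAfit, fun y y' hy hy' => ?_⟩
  · obtain ⟨w, hw⟩ := hspan (proj X S v) (Submodule.starProjection_apply_mem _ v)
    change fit X (g (proj X S v)) = _
    rw [← hw, hgf, hw]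
  · change _ = A₀ (y - y')
    have hsupp : ∀ z, (∀ j, SignType.sign (lasso X lam z j) = SignType.sign (lasso X lam y₀ j)) →
        ∀ j, lasso X lam z j = 0 ↔ j ∉ S := fun z hz j => by
      rw [← sign_eq_zero_iff, hz, sign_eq_zero_iff, mem_selected, not_not]
    -- With equal signs, the stationarity conditions of `y` and `y'` have the same right-hand side,
    -- so the difference of the residuals is orthogonal to the selected columns.
    have h0 : A₀ ((y - fit X (lasso X lam y)) - (y' - fit X (lasso X lam y'))) = 0 := by
      refine hAorth _ fun j hj => ?_
      rw [inner_sub_right, (lasso_spec X hlam y).inner_column hn fun h => (hsupp y hy j).1 h hj,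
        (lasso_spec X hlam y').inner_column hn fun h => (hsupp y' hy' j).1 h hj, hy, hy', sub_self]
    rw [map_sub, map_sub, map_sub, hAfit _ fun j hj => (hsupp y hy j).2 hj,
      hAfit _ fun j hj => (hsupp y' hy' j).2 hj] at h0
    rw [map_sub, ← sub_eq_zero, ← neg_eq_zero, ← h0]
    abel

/-- The signs of the Lasso. -/
def lassoSign (X : Matrix (Fin n) (Fin p) ℝ) (lam : ℝ) (y : EuclideanSpace ℝ (Fin n)) :
    Fin p → SignType := fun j => SignType.sign (lasso X lam y j)

lemma selected_eq_of_lassoSign_eq {y y' : EuclideanSpace ℝ (Fin n)}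
    (h : lassoSign X lam y = lassoSign X lam y') : selected X lam y = selected X lam y' := by
  ext j
  have := congrFun h j
  unfold lassoSign at this
  rw [mem_selected, mem_selected, ← sign_ne_zero, this, sign_ne_zero]

/-- The data space is covered by finitely many closed sets on which the Lasso has affine
increments. -/
lemma exists_lasso_cover (hn : 0 < n) (hX : RankCondition X) (hlam : 0 < lam) :
    ∃ (A : Set.range (lassoSign X lam) → EuclideanSpace ℝ (Fin n) →L[ℝ] EuclideanSpace ℝ (Fin p))
      (D : Set.range (lassoSign X lam) → Set (EuclideanSpace ℝ (Fin n))),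
      (∀ s, IsClosed (D s)) ∧
      (∀ y, y ∈ D ⟨lassoSign X lam y, y, rfl⟩) ∧
      (∀ s, ∀ y ∈ D s, ∀ y' ∈ D s, lasso X lam y - lasso X lam y' = A s (y - y')) ∧
      (∀ y v, fit X (A ⟨lassoSign X lam y, y, rfl⟩ v) = proj X (selected X lam y) v) ∧
      ∀ y, A ⟨lassoSign X lam y, y, rfl⟩ (fit X (lasso X lam y)) = lasso X lam y := by
  have hy : ∀ s : Set.range (lassoSign X lam), ∃ y, lassoSign X lam y = s := fun s => s.2
  choose y₀ hy₀ using hy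
  choose A h1 h2 h3 using fun s => exists_lasso_sub_eq hn hX hlam (y₀ s)
  -- The piece is defined by the affine formula and not by the signs: it contains the whole sign
  -- class and, by continuity of the Lasso, it is closed.
  refine ⟨A, fun s => {y | lasso X lam y - lasso X lam (y₀ s) = A s (y - y₀ s)}, fun s => ?_,
    fun y => ?_, fun s y hys y' hys' => ?_, fun y v => ?_, fun y => ?_⟩
  · have := continuous_lasso hn hX hlam
    exact isClosed_eq (by fun_prop) (by fun_prop)
  · exact h3 _ y (y₀ _) (fun j => congrFun (hy₀ ⟨lassoSign X lam y, y, rfl⟩).symm j) fun _ => rfl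
  · have e1 : lasso X lam y - lasso X lam (y₀ s) = A s (y - y₀ s) := hys
    have e2 : lasso X lam y' - lasso X lam (y₀ s) = A s (y' - y₀ s) := hys'
    rw [← sub_sub_sub_cancel_right y y' (y₀ s), map_sub, ← e1, ← e2, sub_sub_sub_cancel_right]
  · rw [h1, selected_eq_of_lassoSign_eq (hy₀ ⟨lassoSign X lam y, y, rfl⟩)]
  · refine h2 _ _ fun j hj => ?_
    rw [selected_eq_of_lassoSign_eq (hy₀ ⟨lassoSign X lam y, y, rfl⟩), mem_selected, not_not] at hj
    exact hj

lemma exists_lipschitz_lasso (hn : 0 < n) (hX : RankCondition X) (hlam : 0 < lam) :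
    ∃ K, ∀ y y', ‖lasso X lam y - lasso X lam y'‖ ≤ K * ‖y - y'‖ := by
  obtain ⟨A, D, hD, hmem, hA, -, -⟩ := exists_lasso_cover hn hX hlam
  have := Fintype.ofFinite (Set.range (lassoSign X lam))
  refine ⟨∑ s, ‖A s‖, norm_sub_le_of_finite_closed_cover (continuous_lasso hn hX hlam) hD
    (fun y => ⟨_, hmem y⟩) fun s y hy y' hy' => ?_⟩
  rw [hA s y hy y' hy']
  refine ((A s).le_opNorm _).trans ?_
  gcongr
  exact Finset.single_le_sum (f := fun s => ‖A s‖) (fun _ _ => norm_nonneg _) (Finset.mem_univ s)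

lemma polyLip_lasso (hn : 0 < n) (hX : RankCondition X) (hlam : 0 < lam) :
    PolyLip (lasso X lam) := by
  obtain ⟨K, hK⟩ := exists_lipschitz_lasso hn hX hlam
  exact polyLip_of_lipschitz K hK

/-- At almost every data point the Lasso is differentiable, and its derivative is that of the
least squares estimator on the selected support. -/
lemma ae_fderiv_lasso (hn : 0 < n) (hX : RankCondition X) (hlam : 0 < lam) :
    ∀ᵐ y ∂(volume : Measure (EuclideanSpace ℝ (Fin n))), DifferentiableAt ℝ (lasso X lam) y ∧
      (∀ v, fit X (fderiv ℝ (lasso X lam) y v) = proj X (selected X lam y) v) ∧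
      fderiv ℝ (lasso X lam) y (fit X (lasso X lam y)) = lasso X lam y := by
  have : NeZero n := ⟨hn.ne'⟩
  obtain ⟨A, D, hD, hmem, hA, hproj, hfit⟩ := exists_lasso_cover hn hX hlam
  have hae : ∀ᵐ y ∂(volume : Measure (EuclideanSpace ℝ (Fin n))), ∀ s, ∀ j,
      y ∈ D s → DifferentiableAt ℝ (fun y => lasso X lam y j) y →
      fderiv ℝ (fun y => lasso X lam y j) y = (EuclideanSpace.proj j).comp (A s) := by
    refine ae_all_iff.2 fun s => ae_all_iff.2 fun j =>
      ae_fderiv_eq_of_affine_on (hD s).measurableSet fun y hy y' hy' => ?_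
    have := congrArg (fun b : EuclideanSpace ℝ (Fin p) => b j) (hA s y hy y' hy')
    simpa using this
  filter_upwards [hae, (polyLip_lasso hn hX hlam).ae_differentiableAt volume] with y hy hd
  -- The point lies in the piece of its own signs, and almost every point of a piece has the
  -- derivative of that piece; the argument is made coordinate by coordinate.
  have hder : fderiv ℝ (lasso X lam) y = A ⟨lassoSign X lam y, y, rfl⟩ := by
    ext v j
    have hj : HasFDerivAt (fun y => lasso X lam y j)
        ((EuclideanSpace.proj j).comp (fderiv ℝ (lasso X lam) y)) y :=
      (EuclideanSpace.proj (𝕜 := ℝ) j).hasFDerivAt.comp y hd.hasFDerivAt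
    have h1 := hy _ j (hmem y) hj.differentiableAt
    rw [hj.fderiv] at h1
    exact congrArg (fun L : EuclideanSpace ℝ (Fin n) →L[ℝ] ℝ => L v) h1
  rw [hder]
  exact ⟨hd, hproj y, hfit y⟩

end LassoSize

/-! ### Stein identities for the size of the support. -/

namespace LassoSize

open Filter Topology GaussianCalculus

variable {n p : ℕ}

lemma inner_proj_comm (X : Matrix (Fin n) (Fin p) ℝ) (S : Finset (Fin p)) (u v) :
    ⟪u, proj X S v⟫ = ⟪proj X S u, v⟫ :=
  (Submodule.inner_starProjection_left_eq_right _ u v).symm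

lemma norm_proj_le (X : Matrix (Fin n) (Fin p) ℝ) (S : Finset (Fin p)) (v) :
    ‖proj X S v‖ ≤ ‖v‖ :=
  Submodule.norm_starProjection_apply_le _ v

/-- The trace of a projection is its rank. -/
lemma sum_proj_single (X : Matrix (Fin n) (Fin p) ℝ) (S : Finset (Fin p)) :
    ∑ i, (proj X S (EuclideanSpace.single i 1)) i
      = Module.finrank ℝ (Submodule.span ℝ (column X '' (S : Set (Fin p)))) := by
  set U := Submodule.span ℝ (column X '' (S : Set (Fin p)))
  have hproj : LinearMap.IsProj U (U.starProjection : _ →ₗ[ℝ] EuclideanSpace ℝ (Fin n)) :=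
    ⟨fun v => Submodule.starProjection_apply_mem U v,
      fun v hv => Submodule.starProjection_eq_self_iff.2 hv⟩
  rw [← hproj.trace, LinearMap.trace_eq_sum_inner _ (EuclideanSpace.basisFun (Fin n) ℝ)]
  refine Finset.sum_congr rfl fun i _ => ?_
  rw [EuclideanSpace.basisFun_apply, EuclideanSpace.inner_single_left, map_one, one_mul]
  rfl

/-- Stein's lemma for each coordinate of `V`, summed over the coordinates. -/
lemma integral_inner_eq_integral_divergence
    {V : EuclideanSpace ℝ (Fin n) → EuclideanSpace ℝ (Fin n)} (hV : PolyLip V) :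
    ∫ z, ⟪z, V z⟫ ∂(stdGaussian (EuclideanSpace ℝ (Fin n)))
      = ∫ z, ∑ i, (fderiv ℝ V z (EuclideanSpace.single i 1)) i
        ∂(stdGaussian (EuclideanSpace ℝ (Fin n))) := by
  set γ := stdGaussian (EuclideanSpace ℝ (Fin n))
  have hVi : ∀ i, PolyLip fun z => V z i := fun i => hV.of_norm_le fun x y => by
    rw [← PiLp.sub_apply]; exact PiLp.norm_apply_le _ i
  have hd : ∀ᵐ z ∂γ, ∀ i, fderiv ℝ (fun z => V z i) z =
      (EuclideanSpace.proj i).comp (fderiv ℝ V z) := by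
    filter_upwards [hV.ae_differentiableAt_stdGaussian] with z hz i
    exact ((EuclideanSpace.proj (𝕜 := ℝ) i).hasFDerivAt.comp z hz.hasFDerivAt).fderiv
  have e : ∀ z, ⟪z, V z⟫ = ∑ i, V z i * ⟪EuclideanSpace.single i (1 : ℝ), z⟫ := fun z => by
    simp [PiLp.inner_apply]
  simp_rw [e]
  rw [integral_finsetSum _ fun i _ => ((hVi i).mul ((polyLip_const _).inner polyLip_id)).integrable]
  rw [Finset.sum_congr rfl fun i _ => stein_lemma (hVi i) (EuclideanSpace.single i 1)]
  rw [← integral_finsetSum]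
  · refine integral_congr_ae ?_
    filter_upwards [hd] with z hz
    simp [hz]
  · intro i _
    have h := (hVi i).polyGrowth_gradient.inner
      (polyGrowth_const (EuclideanSpace.single i (1 : ℝ)))
    simp_rw [inner_gradient_left_eq] at h
    exact h.integrable (measurable_fderiv_apply_const ℝ _ _).aestronglyMeasurable

/-- Smooth approximations `κ m` of the indicator of `b ≠ 0`, with `b κ'(b)` bounded and tending to
zero. -/
lemma exists_smooth_indicator : ∃ κ ρ : ℕ → ℝ → ℝ, (∀ m b, 0 ≤ κ m b) ∧ (∀ m b, κ m b ≤ 1) ∧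
    (∀ m b, 0 ≤ ρ m b) ∧ (∀ m b, ρ m b ≤ 1) ∧
    (∀ m b, ∃ d, HasDerivAt (κ m) d b ∧ d * b = ρ m b) ∧
    (∀ m a b, ‖κ m a - κ m b‖ ≤ ‖(m : ℝ) * (a * a) - m * (b * b)‖) ∧
    (∀ m, Continuous (ρ m)) ∧
    (∀ b, Tendsto (fun m => κ m b) atTop (𝓝 (if b ≠ 0 then 1 else 0))) ∧
    (∀ b, Tendsto (fun m => ρ m b) atTop (𝓝 0)) := by
  have hpos : ∀ (m : ℕ) (b : ℝ), 0 < 1 + m * b ^ 2 := fun m b => by positivity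
  have hinf : ∀ b : ℝ, b ≠ 0 → Tendsto (fun m : ℕ => 1 + (m : ℝ) * b ^ 2) atTop atTop := fun b hb =>
    tendsto_atTop_add_const_left _ _
      (tendsto_natCast_atTop_atTop.atTop_mul_const (by positivity))
  have hκlim : ∀ b : ℝ, Tendsto (fun m : ℕ => m * b ^ 2 / (1 + m * b ^ 2)) atTop
      (𝓝 (if b ≠ 0 then 1 else 0)) := fun b => by
    by_cases hb : b = 0
    · simp [hb]
    · rw [if_pos hb]
      have := (hinf b hb).inv_tendsto_atTop.const_sub 1
      rw [sub_zero] at this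
      refine this.congr fun m => ?_
      have := (hpos m b).ne'
      simp only [Pi.inv_apply]
      field_simp
      ring
  -- With `t = m b²` these are `t / (1 + t)` and `2t / (1 + t)²`; the latter is at most `1` and
  -- tends to `0` both for `t = 0` and for `t → ∞`.
  refine ⟨fun m b => m * b ^ 2 / (1 + m * b ^ 2),
    fun m b => 2 * (m * b ^ 2) / (1 + m * b ^ 2) ^ 2, fun m b => by positivity,
    fun m b => (div_le_one (hpos m b)).2 (by linarith), fun m b => by positivity,
    fun m b => (div_le_one (by positivity)).2 (by nlinarith [sq_nonneg ((m : ℝ) * b ^ 2)]),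
    fun m b => ⟨2 * m * b / (1 + m * b ^ 2) ^ 2, ?_, by ring⟩, fun m a b => ?_, fun m => ?_,
    hκlim, fun b => ?_⟩
  · have h1 : HasDerivAt (fun b : ℝ => (m : ℝ) * b ^ 2) (2 * m * b) b := by
      refine ((hasDerivAt_pow 2 b).const_mul (m : ℝ)).congr_deriv ?_
      push_cast; ring
    refine (h1.div (h1.const_add 1) (hpos m b).ne').congr_deriv ?_
    have := (hpos m b).ne'
    field_simp
    ring
  · have h1 := hpos m a
    have h2 := hpos m b
    have e : (m : ℝ) * a ^ 2 / (1 + m * a ^ 2) - m * b ^ 2 / (1 + m * b ^ 2)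
        = (m * (a * a) - m * (b * b)) * ((1 + m * a ^ 2) * (1 + m * b ^ 2))⁻¹ := by
      field_simp; ring
    rw [e, norm_mul]
    refine mul_le_of_le_one_right (norm_nonneg _) ?_
    rw [Real.norm_of_nonneg (by positivity)]
    refine inv_le_one_of_one_le₀ (one_le_mul_of_one_le_of_one_le ?_ ?_) <;>
      exact le_add_of_nonneg_right (by positivity)
  · exact Continuous.div (by fun_prop) (by fun_prop) fun z => by positivity
  · by_cases hb : b = 0
    · simp [hb]
    · have h1 := (hinf b hb).inv_tendsto_atTop
      have h2 := (h1.const_mul 2).mul (hκlim b)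
      rw [mul_zero, zero_mul] at h2
      refine h2.congr fun m => ?_
      have := (hpos m b).ne'
      simp only [Pi.inv_apply]
      field_simp

/-- A locally Lipschitz function `B` with support `S`, such that `X B` has the derivative of a least
squares fit on the columns in `S`. -/
structure IsSparseFit (X : Matrix (Fin n) (Fin p) ℝ)
    (B : EuclideanSpace ℝ (Fin n) → EuclideanSpace ℝ (Fin p))
    (S : EuclideanSpace ℝ (Fin n) → Finset (Fin p)) : Prop where
  polyLip : PolyLip B
  mem_iff : ∀ z j, j ∈ S z ↔ B z j ≠ 0
  finrank_eq : ∀ z,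
    Module.finrank ℝ (Submodule.span ℝ (column X '' (S z : Set (Fin p)))) = (S z).card
  ae_differentiableAt : ∀ᵐ z ∂(stdGaussian (EuclideanSpace ℝ (Fin n))), DifferentiableAt ℝ B z
  ae_fit_fderiv : ∀ᵐ z ∂(stdGaussian (EuclideanSpace ℝ (Fin n))),
    ∀ v, fit X (fderiv ℝ B z v) = proj X (S z) v
  ae_fderiv_fit : ∀ᵐ z ∂(stdGaussian (EuclideanSpace ℝ (Fin n))), fderiv ℝ B z (fit X (B z)) = B z

namespace IsSparseFit

variable {X : Matrix (Fin n) (Fin p) ℝ} {B : EuclideanSpace ℝ (Fin n) → EuclideanSpace ℝ (Fin p)}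
  {S : EuclideanSpace ℝ (Fin n) → Finset (Fin p)} (H : IsSparseFit X B S)

include H

lemma polyLip_fit : PolyLip fun z => fit X (B z) := by
  refine (((polyLip_const ‖fitL X‖).smul H.polyLip)).of_norm_le fun x y => ?_
  rw [← fit_sub, ← smul_sub, norm_smul, norm_norm]
  exact (fitL X).le_opNorm _

lemma polyLip_apply (j : Fin p) : PolyLip fun z => B z j := H.polyLip.of_norm_le fun x y => by
  rw [← PiLp.sub_apply]; exact PiLp.norm_apply_le _ j

lemma polyLip_inner_fit : PolyLip fun z => ⟪z, fit X (B z)⟫ := polyLip_id.inner H.polyLip_fit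

lemma proj_fit (z) : proj X (S z) (fit X (B z)) = fit X (B z) := by
  rw [proj, Submodule.starProjection_eq_self_iff, fit_eq_sum]
  refine Submodule.sum_mem _ fun j _ => ?_
  by_cases hj : j ∈ S z
  · exact Submodule.smul_mem _ _ (Submodule.subset_span ⟨j, hj, rfl⟩)
  · rw [H.mem_iff, not_not] at hj
    rw [hj, zero_smul]; exact Submodule.zero_mem _

lemma card_eq_sum (z) : ((S z).card : ℝ) = ∑ j, if B z j ≠ 0 then 1 else 0 := by
  have : S z = Finset.univ.filter fun j => B z j ≠ 0 := by ext j; simp [H.mem_iff]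
  rw [this, Finset.sum_boole]

lemma measurableSet_apply_ne (j : Fin p) : MeasurableSet {z | B z j ≠ 0} :=
  (measurableSet_eq_fun (H.polyLip_apply j).continuous.measurable measurable_const).compl

lemma measurable_card : Measurable fun z => ((S z).card : ℝ) := by
  simp_rw [H.card_eq_sum]
  exact Finset.measurable_sum _ fun j _ =>
    Measurable.ite (H.measurableSet_apply_ne j) measurable_const measurable_const

omit H in
lemma polyGrowth_card (S : EuclideanSpace ℝ (Fin n) → Finset (Fin p)) :
    PolyGrowth fun z => ((S z).card : ℝ) :=
  (polyGrowth_const (p : ℝ)).of_norm_le fun z => by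
    simp only [Real.norm_natCast, Nat.cast_le]
    simpa using Finset.card_le_univ (S z)

omit H in
lemma polyGrowth_proj (X : Matrix (Fin n) (Fin p) ℝ)
    (S : EuclideanSpace ℝ (Fin n) → Finset (Fin p)) :
    PolyGrowth fun z => proj X (S z) z :=
  polyGrowth_id.of_norm_le fun z => norm_proj_le X (S z) z

lemma aestronglyMeasurable_proj :
    AEStronglyMeasurable (fun z => proj X (S z) z) (stdGaussian (EuclideanSpace ℝ (Fin n))) := by
  have h : Measurable fun z => fit X (fderiv ℝ B z z) :=
    (continuous_fit X).measurable.comp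
      (isBoundedBilinearMap_apply.continuous.measurable.comp
        ((measurable_fderiv ℝ B).prodMk measurable_id))
  refine h.aestronglyMeasurable.congr ?_
  filter_upwards [H.ae_fit_fderiv] with z hz using hz z

lemma ae_hasFDerivAt_fit : ∀ᵐ z ∂(stdGaussian (EuclideanSpace ℝ (Fin n))),
    HasFDerivAt (fun z => fit X (B z)) (proj X (S z)) z := by
  filter_upwards [H.ae_fit_fderiv, H.ae_differentiableAt] with z hz hd
  have := (fitL X).hasFDerivAt.comp z hd.hasFDerivAt
  refine this.congr_fderiv ?_
  ext1 v
  exact hz v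

lemma ae_hasFDerivAt_inner_fit : ∀ᵐ z ∂(stdGaussian (EuclideanSpace ℝ (Fin n))),
    HasFDerivAt (fun z => ⟪z, fit X (B z)⟫) (innerSL ℝ (fit X (B z) + proj X (S z) z)) z := by
  filter_upwards [H.ae_hasFDerivAt_fit] with z hz
  refine ((hasFDerivAt_id z).inner ℝ hz).congr_fderiv ?_
  ext v
  simp only [ContinuousLinearMap.comp_apply, ContinuousLinearMap.prod_apply, fderivInnerCLM_apply,
    innerSL_apply_apply, ContinuousLinearMap.id_apply, id, inner_add_left]
  rw [inner_proj_comm, real_inner_comm v (fit X (B z)), add_comm]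

/-- Stein's formula for a scalar multiple of the fit. -/
lemma integral_mul_inner_fit {k : EuclideanSpace ℝ (Fin n) → ℝ} (hk : PolyLip k) :
    ∫ z, k z * ⟪z, fit X (B z)⟫ ∂(stdGaussian (EuclideanSpace ℝ (Fin n)))
      = ∫ z, (k z * (S z).card + fderiv ℝ k z (fit X (B z)))
        ∂(stdGaussian (EuclideanSpace ℝ (Fin n))) := by
  have h := integral_inner_eq_integral_divergence (hk.smul H.polyLip_fit)
  simp_rw [real_inner_smul_right] at h
  rw [h]
  refine integral_congr_ae ?_
  filter_upwards [H.ae_hasFDerivAt_fit, hk.ae_differentiableAt_stdGaussian] with z hz hkz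
  have hs : HasFDerivAt (fun x => k x • fit X (B x)) _ z := hkz.hasFDerivAt.smul hz
  rw [hs.fderiv]
  simp only [_root_.add_apply, _root_.smul_apply,
    ContinuousLinearMap.smulRight_apply, PiLp.add_apply, PiLp.smul_apply, smul_eq_mul,
    Finset.sum_add_distrib, ← Finset.mul_sum]
  rw [sum_proj_single, H.finrank_eq]
  congr 1
  have : fit X (B z) = ∑ i, fit X (B z) i • EuclideanSpace.single i (1 : ℝ) := by
    ext i; simp [Pi.single_apply]
  conv_rhs => rw [this, map_sum]
  simp [mul_comm]

lemma integral_inner_fit : ∫ z, ⟪z, fit X (B z)⟫ ∂(stdGaussian (EuclideanSpace ℝ (Fin n)))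
    = ∫ z, ((S z).card : ℝ) ∂(stdGaussian (EuclideanSpace ℝ (Fin n))) := by
  simpa using H.integral_mul_inner_fit (polyLip_const (1 : ℝ))

/-- The size of the support has jumps, so Stein's formula is applied to `∑ κ m (B_j)`, which tends
to it. The derivative of this sum along the fit is `∑ B_j κ'(B_j)`, because `DB(X B) = B`; it is
bounded and tends to zero, so nothing is left of the jumps. -/
lemma integral_card_mul_inner_fit :
    ∫ z, (S z).card * ⟪z, fit X (B z)⟫ ∂(stdGaussian (EuclideanSpace ℝ (Fin n)))
      = ∫ z, ((S z).card : ℝ) ^ 2 ∂(stdGaussian (EuclideanSpace ℝ (Fin n))) := by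
  set γ := stdGaussian (EuclideanSpace ℝ (Fin n))
  obtain ⟨κ, ρ, hκ0, hκ1, hρ0, hρ1, hκd, hκl, hρc', hκlim, hρlim⟩ := exists_smooth_indicator
  have hκL : ∀ (m : ℕ) j, PolyLip fun z => κ m (B z j) := fun m j =>
    ((polyLip_const (m : ℝ)).mul ((H.polyLip_apply j).mul (H.polyLip_apply j))).of_norm_le
      fun x y => hκl m _ _
  have hKL : ∀ m, PolyLip fun z => ∑ j, κ m (B z j) := fun m => PolyLip.sum _ (hκL m)
  have hKd : ∀ m, ∀ᵐ z ∂γ, fderiv ℝ (fun z => ∑ j, κ m (B z j)) z (fit X (B z))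
      = ∑ j, ρ m (B z j) := fun m => by
    filter_upwards [H.ae_fderiv_fit, H.ae_differentiableAt] with z hz hd
    choose d hd1 hd2 using hκd
    have h0 : ∀ j, HasFDerivAt (fun z => B z j) ((EuclideanSpace.proj j).comp (fderiv ℝ B z)) z :=
      fun j => (EuclideanSpace.proj (𝕜 := ℝ) j).hasFDerivAt.comp z hd.hasFDerivAt
    have h1 : ∀ j, HasFDerivAt (fun z => κ m (B z j))
        (d m (B z j) • (EuclideanSpace.proj j).comp (fderiv ℝ B z)) z := fun j =>
      (hd1 m (B z j)).comp_hasFDerivAt z (h0 j)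
    rw [(HasFDerivAt.fun_sum (u := Finset.univ) fun j _ => h1 j).fderiv,
      _root_.sum_apply]
    refine Finset.sum_congr rfl fun j _ => ?_
    rw [_root_.smul_apply, ContinuousLinearMap.comp_apply, hz, smul_eq_mul]
    exact hd2 m (B z j)
  have hstein : ∀ m : ℕ, ∫ z, (∑ j, κ m (B z j)) * ⟪z, fit X (B z)⟫ ∂γ
      = ∫ z, ((∑ j, κ m (B z j)) * (S z).card + ∑ j, ρ m (B z j)) ∂γ := fun m => by
    rw [H.integral_mul_inner_fit (hKL m)]
    refine integral_congr_ae ?_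
    filter_upwards [hKd m] with z hz
    rw [hz]
  have hKlim : ∀ z, Tendsto (fun m => ∑ j, κ m (B z j)) atTop (𝓝 ((S z).card : ℝ)) := fun z => by
    rw [H.card_eq_sum]
    exact tendsto_finsetSum _ fun j _ => hκlim _
  have hK1 : ∀ m z, ‖∑ j, κ m (B z j)‖ ≤ p := fun m z => by
    rw [Real.norm_of_nonneg (Finset.sum_nonneg fun j _ => hκ0 _ _)]
    exact (Finset.sum_le_sum fun j _ => hκ1 m (B z j)).trans (by simp)
  have hR1 : ∀ m z, ‖∑ j, ρ m (B z j)‖ ≤ p := fun m z => by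
    rw [Real.norm_of_nonneg (Finset.sum_nonneg fun j _ => hρ0 _ _)]
    exact (Finset.sum_le_sum fun j _ => hρ1 m (B z j)).trans (by simp)
  have hN1 : ∀ z, ‖((S z).card : ℝ)‖ ≤ p := fun z => by
    rw [Real.norm_natCast]; exact_mod_cast (by simpa using Finset.card_le_univ (S z))
  have hρc : ∀ m j, Continuous fun z => ρ m (B z j) := fun m j =>
    (hρc' m).comp (H.polyLip_apply j).continuous
  have hNm := H.measurable_card
  have hl : Tendsto (fun m => ∫ z, (∑ j, κ m (B z j)) * ⟪z, fit X (B z)⟫ ∂γ) atTop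
      (𝓝 (∫ z, (S z).card * ⟪z, fit X (B z)⟫ ∂γ)) := by
    refine tendsto_integral_of_dominated_convergence (fun z => p * ‖⟪z, fit X (B z)⟫‖)
      (fun m => ((hKL m).mul H.polyLip_inner_fit).continuous.aestronglyMeasurable)
      (H.polyLip_inner_fit.integrable.norm.const_mul _) (fun m => Eventually.of_forall fun z => ?_)
      (Eventually.of_forall fun z => (hKlim z).mul_const _)
    rw [norm_mul]
    gcongr
    exact hK1 m z
  have hr : Tendsto (fun m => ∫ z, ((∑ j, κ m (B z j)) * (S z).card + ∑ j, ρ m (B z j)) ∂γ) atTop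
      (𝓝 (∫ z, ((S z).card : ℝ) ^ 2 ∂γ)) := by
    refine tendsto_integral_of_dominated_convergence (fun z => (p : ℝ) * p + p)
      (fun m => (((hKL m).continuous.measurable.mul hNm).add
        (continuous_finsetSum _ fun j _ => hρc m j).measurable).aestronglyMeasurable)
      (integrable_const _) (fun m => Eventually.of_forall fun z => ?_)
      (Eventually.of_forall fun z => ?_)
    · refine (norm_add_le _ _).trans (add_le_add ?_ (hR1 m z))
      rw [norm_mul]
      exact mul_le_mul (hK1 m z) (hN1 z) (norm_nonneg _) (Nat.cast_nonneg _)
    · have h1 := ((hKlim z).mul_const ((S z).card : ℝ)).add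
        (tendsto_finsetSum Finset.univ fun j _ => hρlim (B z j))
      simpa [pow_two] using h1
  simp_rw [hstein] at hl
  exact tendsto_nhds_unique hl hr

/-- Stein's formula with `k = ⟪z, X B⟫`. Its gradient is `X B + P_S z` and `P_S X B = X B`, so its
derivative along `X B` is `‖X B‖² + ⟪z, X B⟫`. -/
lemma integral_inner_fit_sq :
    ∫ z, ⟪z, fit X (B z)⟫ ^ 2 ∂(stdGaussian (EuclideanSpace ℝ (Fin n)))
      = ∫ z, ((S z).card : ℝ) ^ 2 ∂(stdGaussian (EuclideanSpace ℝ (Fin n)))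
        + ∫ z, ‖fit X (B z)‖ ^ 2 ∂(stdGaussian (EuclideanSpace ℝ (Fin n)))
        + ∫ z, ((S z).card : ℝ) ∂(stdGaussian (EuclideanSpace ℝ (Fin n))) := by
  set γ := stdGaussian (EuclideanSpace ℝ (Fin n))
  have hF := H.polyLip_fit
  have hG := H.polyLip_inner_fit
  have h := H.integral_mul_inner_fit hG
  have i1 : Integrable (fun z => ⟪z, fit X (B z)⟫ * ((S z).card : ℝ)) γ :=
    (hG.polyGrowth.mul (polyGrowth_card S)).integrable
      (hG.continuous.measurable.mul H.measurable_card).aestronglyMeasurable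
  have i2 : Integrable (fun z => ‖fit X (B z)‖ ^ 2) γ :=
    (hF.polyGrowth.norm.pow 2).integrable (hF.continuous.norm.pow 2).aestronglyMeasurable
  have e : ∫ z, (⟪z, fit X (B z)⟫ * (S z).card
      + fderiv ℝ (fun z => ⟪z, fit X (B z)⟫) z (fit X (B z))) ∂γ
      = ∫ z, (⟪z, fit X (B z)⟫ * (S z).card + ‖fit X (B z)‖ ^ 2 + ⟪z, fit X (B z)⟫) ∂γ := by
    refine integral_congr_ae ?_
    filter_upwards [H.ae_hasFDerivAt_inner_fit] with z hz
    rw [hz.fderiv, innerSL_apply_apply, inner_add_left, ← inner_proj_comm, H.proj_fit,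
      real_inner_self_eq_norm_sq, add_assoc]
  have i12 : Integrable (fun z => ⟪z, fit X (B z)⟫ * ((S z).card : ℝ) + ‖fit X (B z)‖ ^ 2) γ :=
    i1.add i2
  rw [e, integral_add i12 hG.integrable, integral_add i1 i2, H.integral_inner_fit] at h
  simp_rw [pow_two ⟪_, _⟫]
  rw [h, ← H.integral_card_mul_inner_fit, integral_congr_ae (Eventually.of_forall fun z => mul_comm _ _)]

lemma integral_inner_fit_mul_inner (c : EuclideanSpace ℝ (Fin n)) :
    ∫ z, ⟪z, fit X (B z)⟫ * ⟪c, z⟫ ∂(stdGaussian (EuclideanSpace ℝ (Fin n)))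
      = ∫ z, ⟪c, fit X (B z)⟫ ∂(stdGaussian (EuclideanSpace ℝ (Fin n)))
        + ∫ z, ⟪c, proj X (S z) z⟫ ∂(stdGaussian (EuclideanSpace ℝ (Fin n))) := by
  rw [stein_lemma H.polyLip_inner_fit c, ← integral_add]
  · refine integral_congr_ae ?_
    filter_upwards [H.ae_hasFDerivAt_inner_fit] with z hz
    rw [hz.fderiv, innerSL_apply_apply, inner_add_left, real_inner_comm c, real_inner_comm c]
  · exact ((polyLip_const c).inner H.polyLip_fit).integrable
  · exact ((polyGrowth_const c).inner (polyGrowth_proj X S)).integrable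
      (aestronglyMeasurable_const.inner H.aestronglyMeasurable_proj)

lemma integral_norm_gradient_sq (c : EuclideanSpace ℝ (Fin n)) :
    ∫ z, ‖gradient (fun z => ⟪z, fit X (B z) - c⟫) z‖ ^ 2 ∂(stdGaussian (EuclideanSpace ℝ (Fin n)))
      = ∫ z, ‖fit X (B z)‖ ^ 2 ∂(stdGaussian (EuclideanSpace ℝ (Fin n))) + ‖c‖ ^ 2
        + ∫ z, ‖proj X (S z) z‖ ^ 2 ∂(stdGaussian (EuclideanSpace ℝ (Fin n)))
        - 2 * ∫ z, ⟪c, fit X (B z)⟫ ∂(stdGaussian (EuclideanSpace ℝ (Fin n)))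
        + 2 * ∫ z, ((S z).card : ℝ) ∂(stdGaussian (EuclideanSpace ℝ (Fin n)))
        - 2 * ∫ z, ⟪c, proj X (S z) z⟫ ∂(stdGaussian (EuclideanSpace ℝ (Fin n))) := by
  set γ := stdGaussian (EuclideanSpace ℝ (Fin n))
  have hF := H.polyLip_fit
  have hG := H.polyLip_inner_fit
  have iF : Integrable (fun z => ‖fit X (B z)‖ ^ 2) γ :=
    (hF.polyGrowth.norm.pow 2).integrable (hF.continuous.norm.pow 2).aestronglyMeasurable
  have iW : Integrable (fun z => ‖proj X (S z) z‖ ^ 2) γ :=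
    ((polyGrowth_proj X S).norm.pow 2).integrable (H.aestronglyMeasurable_proj.norm.pow 2)
  have icF : Integrable (fun z => ⟪c, fit X (B z)⟫) γ := ((polyLip_const c).inner hF).integrable
  have icP : Integrable (fun z => ⟪c, proj X (S z) z⟫) γ :=
    ((polyGrowth_const c).inner (polyGrowth_proj X S)).integrable
      (aestronglyMeasurable_const.inner H.aestronglyMeasurable_proj)
  have : ∀ᵐ z ∂γ, ‖gradient (fun z => ⟪z, fit X (B z) - c⟫) z‖ ^ 2
      = ‖fit X (B z)‖ ^ 2 + ‖c‖ ^ 2 + ‖proj X (S z) z‖ ^ 2 - 2 * ⟪c, fit X (B z)⟫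
        + 2 * ⟪z, fit X (B z)⟫ - 2 * ⟪c, proj X (S z) z⟫ := by
    filter_upwards [H.ae_hasFDerivAt_inner_fit] with z hz
    have hd : HasFDerivAt (fun z => ⟪z, fit X (B z) - c⟫)
        (innerSL ℝ (fit X (B z) + proj X (S z) z - c)) z := by
      have : (fun z => ⟪z, fit X (B z) - c⟫) = fun z => ⟪z, fit X (B z)⟫ - innerSL ℝ c z := by
        funext z
        rw [inner_sub_right, innerSL_apply_apply, real_inner_comm z c]
      rw [this, map_sub]
      exact hz.sub (innerSL ℝ c).hasFDerivAt
    have h1 : ⟪fit X (B z), proj X (S z) z⟫ = ⟪z, fit X (B z)⟫ := by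
      rw [inner_proj_comm, H.proj_fit, real_inner_comm]
    rw [norm_gradient, hd.fderiv, innerSL_apply_norm, norm_sub_sq_real, norm_add_sq_real, h1,
      inner_add_left, real_inner_comm c (fit X (B z)), real_inner_comm c (proj X (S z) z)]
    ring
  rw [integral_congr_ae this]
  have i3 := (iF.add (integrable_const (‖c‖ ^ 2))).add iW
  have i4 := i3.sub (icF.const_mul 2)
  have i5 := i4.add (hG.integrable.const_mul 2)
  have h5 := integral_sub i5 (icP.const_mul 2)
  have h4 := integral_add i4 (hG.integrable (μ := γ).const_mul 2)
  have h3 := integral_sub i3 (icF.const_mul 2)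
  have h2 := integral_add (iF.add (integrable_const (‖c‖ ^ 2))) iW
  have h1 := integral_add iF (integrable_const (μ := γ) (‖c‖ ^ 2))
  simp only [Pi.add_apply, Pi.sub_apply, integral_const_mul, integral_const, probReal_univ,
    one_smul] at h1 h2 h3 h4 h5
  rw [h5, h4, h3, h2, h1, H.integral_inner_fit]

/-- The Poincaré deficit of `z ↦ ⟪z, X B z - c⟫`. -/
theorem variance_sub_integral_gradient (c : EuclideanSpace ℝ (Fin n)) :
    ∫ z, ⟪z, fit X (B z) - c⟫ ^ 2 ∂(stdGaussian (EuclideanSpace ℝ (Fin n)))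
        - (∫ z, ⟪z, fit X (B z) - c⟫ ∂(stdGaussian (EuclideanSpace ℝ (Fin n)))) ^ 2
        - ∫ z, ‖gradient (fun z => ⟪z, fit X (B z) - c⟫) z‖ ^ 2
          ∂(stdGaussian (EuclideanSpace ℝ (Fin n)))
      = ∫ z, ((S z).card : ℝ) ^ 2 ∂(stdGaussian (EuclideanSpace ℝ (Fin n)))
        - (∫ z, ((S z).card : ℝ) ∂(stdGaussian (EuclideanSpace ℝ (Fin n)))) ^ 2
        - ∫ z, ((S z).card : ℝ) ∂(stdGaussian (EuclideanSpace ℝ (Fin n)))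
        - ∫ z, ‖proj X (S z) z‖ ^ 2 ∂(stdGaussian (EuclideanSpace ℝ (Fin n))) := by
  set γ := stdGaussian (EuclideanSpace ℝ (Fin n))
  have hF := H.polyLip_fit
  have hG := H.polyLip_inner_fit
  have hc : PolyLip fun z : EuclideanSpace ℝ (Fin n) => ⟪c, z⟫ := (polyLip_const c).inner polyLip_id
  have iGc : Integrable (fun z => ⟪z, fit X (B z)⟫ * ⟪c, z⟫) γ := (hG.mul hc).integrable
  have iG2 : Integrable (fun z => ⟪z, fit X (B z)⟫ ^ 2) γ :=
    (hG.polyGrowth.pow 2).integrable (hG.continuous.pow 2).aestronglyMeasurable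
  have icc : Integrable (fun z : EuclideanSpace ℝ (Fin n) => ⟪c, z⟫ * ⟪c, z⟫) γ :=
    (hc.mul hc).integrable
  have e1 : ∫ z, ⟪z, fit X (B z) - c⟫ ∂γ = ∫ z, ((S z).card : ℝ) ∂γ := by
    have : ∀ z, ⟪z, fit X (B z) - c⟫ = ⟪z, fit X (B z)⟫ - ⟪c, z⟫ := fun z => by
      rw [inner_sub_right, real_inner_comm z c]
    simp_rw [this]
    rw [integral_sub hG.integrable hc.integrable, H.integral_inner_fit]
    have : ∫ z, ⟪c, z⟫ ∂γ = 0 := integral_strongDual_stdGaussian (innerSL ℝ c)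
    rw [this, sub_zero]
  have e2 : ∫ z, ⟪z, fit X (B z) - c⟫ ^ 2 ∂γ = ∫ z, ⟪z, fit X (B z)⟫ ^ 2 ∂γ
      - 2 * ∫ z, ⟪z, fit X (B z)⟫ * ⟪c, z⟫ ∂γ + ‖c‖ ^ 2 := by
    have : ∀ z, ⟪z, fit X (B z) - c⟫ ^ 2
        = ⟪z, fit X (B z)⟫ ^ 2 - 2 * (⟪z, fit X (B z)⟫ * ⟪c, z⟫) + ⟪c, z⟫ * ⟪c, z⟫ := fun z => by
      rw [inner_sub_right, real_inner_comm z c]; ring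
    simp_rw [this]
    rw [integral_add (f := fun z => ⟪z, fit X (B z)⟫ ^ 2 - 2 * (⟪z, fit X (B z)⟫ * ⟪c, z⟫))
      (iG2.sub (iGc.const_mul 2)) icc, integral_sub iG2 (iGc.const_mul 2), integral_const_mul,
      integral_inner_mul_inner_stdGaussian, real_inner_self_eq_norm_sq]
  -- The terms containing `c` cancel: by Stein, `E[⟪z, X B⟫ ⟪c, z⟫] = E⟪c, X B⟫ + E⟪c, P_S z⟫`,
  -- which is exactly the cross term of the squared gradient.
  rw [e1, e2, H.integral_norm_gradient_sq c, H.integral_inner_fit_sq, H.integral_inner_fit_mul_inner c]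
  ring

end IsSparseFit

end LassoSize

/-! ### Exponential moments of projections of a Gaussian vector. -/

namespace GaussianCalculus

open Filter Topology

/-- The value is `(1 - 2s)^(-1/2)` at `s = 4/9`, a choice of exponent that makes it an integer. -/
lemma integral_exp_sq_gaussianReal :
    ∫ x, Real.exp (4 / 9 * x ^ 2) ∂(gaussianReal 0 1) = 3 := by
  rw [integral_gaussianReal_eq_integral_smul one_ne_zero]
  have e : ∀ x : ℝ, gaussianPDFReal 0 1 x • Real.exp (4 / 9 * x ^ 2)
      = (√(2 * Real.pi))⁻¹ * Real.exp (-(1 / 18) * x ^ 2) := fun x => by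
    rw [gaussianPDFReal, smul_eq_mul, mul_assoc, ← Real.exp_add]
    congr 2
    · simp
    · push_cast; ring
  simp_rw [e]
  rw [integral_const_mul, integral_gaussian, ← Real.sqrt_inv, ← Real.sqrt_mul (by positivity)]
  have : (2 * Real.pi)⁻¹ * (Real.pi / (1 / 18)) = 3 ^ 2 := by
    have := Real.pi_pos.ne'
    field_simp
    norm_num
  rw [this, Real.sqrt_sq (by norm_num)]

variable {E : Type*} [NormedAddCommGroup E] [InnerProductSpace ℝ E] [FiniteDimensional ℝ E]
  [MeasurableSpace E] [BorelSpace E]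

lemma integral_exp_norm_sq_stdGaussian :
    ∫ x, Real.exp (4 / 9 * ‖x‖ ^ 2) ∂(stdGaussian E) = 3 ^ Module.finrank ℝ E := by
  rw [stdGaussian, integral_map (Measurable.aemeasurable (by fun_prop)) (by fun_prop)]
  have e : ∀ x : Fin (Module.finrank ℝ E) → ℝ,
      Real.exp (4 / 9 * ‖∑ i, x i • stdOrthonormalBasis ℝ E i‖ ^ 2)
        = ∏ i, Real.exp (4 / 9 * x i ^ 2) := fun x => by
    rw [← Real.exp_sum, ← Finset.mul_sum, ← real_inner_self_eq_norm_sq,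
      (stdOrthonormalBasis ℝ E).orthonormal.inner_sum]
    simp [pow_two]
  simp_rw [e]
  rw [integral_fintype_prod_eq_pow (fun x : ℝ => Real.exp (4 / 9 * x ^ 2)),
    integral_exp_sq_gaussianReal, Fintype.card_fin]

/-- The projection is the adjoint of the inclusion of `U`, so the characteristic functions agree. -/
lemma stdGaussian_map_orthogonalProjection (U : Submodule ℝ E) :
    (stdGaussian E).map U.orthogonalProjectionOnto = stdGaussian U := by
  refine Measure.ext_of_charFun ?_
  funext t
  rw [charFun_stdGaussian, charFun_apply, integral_map (by fun_prop) (by fun_prop)]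
  have e : ∀ x : E, ⟪U.orthogonalProjectionOnto x, t⟫ = ⟪x, (t : E)⟫ := fun x =>
    Submodule.inner_orthogonalProjectionOnto_eq_of_mem_right t x
  simp_rw [e]
  rw [← charFun_apply, charFun_stdGaussian]
  simp

lemma integral_exp_norm_starProjection_sq (U : Submodule ℝ E) :
    ∫ x, Real.exp (4 / 9 * ‖U.starProjection x‖ ^ 2) ∂(stdGaussian E)
      = 3 ^ Module.finrank ℝ U := by
  rw [← integral_exp_norm_sq_stdGaussian, ← stdGaussian_map_orthogonalProjection,
    integral_map (by fun_prop) (by fun_prop)]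
  simp

/-- The integral of a non-integrable function is `0` by convention, whereas this one is a power of
`3`. -/
lemma integrable_exp_norm_starProjection_sq (U : Submodule ℝ E) :
    Integrable (fun x => Real.exp (4 / 9 * ‖U.starProjection x‖ ^ 2)) (stdGaussian E) := by
  by_contra h
  have := integral_exp_norm_starProjection_sq U
  rw [integral_undef h] at this
  exact absurd this (by positivity)

end GaussianCalculus

/-! ### Numerical estimates for the union bound over supports. -/

namespace LassoSize

open Filter Topology GaussianCalculus

/-- This is `e (k / e)^k ≤ k!`. It follows from Stirling's lower bound as soon as `√(2πk) ≥ e`,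
which holds for `k ≥ 2`; at `k = 1` it is an equality. -/
lemma exp_one_sub_mul_pow_le_factorial {k : ℕ} (hk : 1 ≤ k) :
    Real.exp (1 - k + k * Real.log k) ≤ k.factorial := by
  have hk0 : (0 : ℝ) < k := by exact_mod_cast hk
  rcases hk.eq_or_lt with rfl | hk
  · simp
  have h := Stirling.le_factorial_stirling k
  refine le_trans ?_ h
  have e : Real.exp (1 - k + k * Real.log k) = Real.exp 1 * (k / Real.exp 1) ^ k := by
    rw [div_pow, ← Real.exp_nat_mul, mul_one, ← Real.rpow_natCast, Real.rpow_def_of_pos hk0,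
      ← Real.exp_sub, ← Real.exp_add]
    ring_nf
  rw [e]
  refine mul_le_mul_of_nonneg_right (Real.le_sqrt_of_sq_le ?_) (by positivity)
  have h2 : (2 : ℝ) ≤ k := by exact_mod_cast hk
  have := Real.exp_one_lt_d9
  have := Real.exp_pos 1
  have := Real.pi_gt_three
  nlinarith

/-- For `k ≤ 8`, `log (8 / k)` lies above the chord of the logarithm between `1` and `4`, whose
slope `(log 4) / 3` exceeds `0.462`. For `k ≥ 8` the left side is not positive. -/
lemma le_mul_log_div {p k : ℕ} (hp : 8 ≤ p) (hk : 2 ≤ k) (hkp : k ≤ p) :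
    0.462 * (8 - k : ℝ) ≤ k * (Real.log p - Real.log k) := by
  have hk0 : (0 : ℝ) < k := by exact_mod_cast (by omega : 0 < k)
  have hk2 : (2 : ℝ) ≤ k := by exact_mod_cast hk
  have hp8 : (8 : ℝ) ≤ p := by exact_mod_cast hp
  have hkp' : Real.log k ≤ Real.log p := Real.log_le_log hk0 (by exact_mod_cast hkp)
  rcases le_total k 8 with h8 | h8
  · have h8' : (k : ℝ) ≤ 8 := by exact_mod_cast h8
    have hlog : Real.log 8 ≤ Real.log p := Real.log_le_log (by norm_num) hp8
    have ha : 0 ≤ 1 - (8 - (k : ℝ)) / (3 * k) := by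
      rw [sub_nonneg, div_le_one (by positivity)]; linarith
    have hb : 0 ≤ (8 - (k : ℝ)) / (3 * k) := div_nonneg (by linarith) (by positivity)
    have h := strictConcaveOn_log_Ioi.concaveOn.2 (Set.mem_Ioi.2 one_pos)
      (Set.mem_Ioi.2 (by norm_num : (0 : ℝ) < 4)) ha hb (by ring)
    have e : (1 - (8 - (k : ℝ)) / (3 * k)) • (1 : ℝ) + ((8 - (k : ℝ)) / (3 * k)) • (4 : ℝ)
        = 8 / k := by
      simp only [smul_eq_mul]; field_simp; ring
    rw [e, Real.log_one, smul_zero, zero_add, smul_eq_mul, Real.log_div (by norm_num) hk0.ne',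
      div_mul_eq_mul_div, div_le_iff₀ (by positivity)] at h
    have h4 : 1.386 ≤ Real.log 4 := by
      rw [Real.log_four_eq]
      linarith [Real.log_two_gt_d9]
    nlinarith
  · have h8' : (8 : ℝ) ≤ k := by exact_mod_cast h8
    nlinarith

/-- The inputs are `binom(p, k) ≤ p^k / k!`, the factorial bound above and `log 3 ≤ 1.1`; the rest
is collecting exponents. -/
lemma choose_mul_exp_le {p k : ℕ} (hk : 1 ≤ k) (hkp : k ≤ p) :
    (p.choose k : ℝ) * (3 ^ k * Real.exp (2 - 4 / 9 * (2 * k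
        + 4 * (k * Real.log (Real.exp 1 * p / max 1 (k : ℝ))))))
      ≤ Real.exp (1 + k * (1.1 - 5 / 3) - 7 / 9 * (k * (Real.log p - Real.log k))) := by
  have hk0 : (0 : ℝ) < k := by exact_mod_cast hk
  have hp0 : (0 : ℝ) < p := by exact_mod_cast (by omega : 0 < p)
  have hk1 : (1 : ℝ) ≤ k := by exact_mod_cast hk
  have e3 : (3 : ℝ) ^ k ≤ Real.exp (k * 1.1) := by
    rw [Real.exp_nat_mul]
    gcongr
    exact (Real.log_le_iff_le_exp (by norm_num)).1 (Real.log_three_lt_d9.le.trans (by norm_num))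
  have ec : (p.choose k : ℝ) ≤ Real.exp (k * Real.log p - (1 - k + k * Real.log k)) := by
    refine (Nat.choose_le_pow_div k p).trans ?_
    rw [Real.exp_sub, ← Real.log_pow, Real.exp_log (by positivity)]
    gcongr
    exact exp_one_sub_mul_pow_le_factorial hk
  rw [max_eq_right hk1, Real.log_div (by positivity) hk0.ne',
    Real.log_mul (Real.exp_pos 1).ne' hp0.ne', Real.log_exp]
  calc _ ≤ Real.exp (k * Real.log p - (1 - k + k * Real.log k)) * (Real.exp (k * 1.1)
        * Real.exp (2 - 4 / 9 * (2 * k + 4 * (k * (1 + Real.log p - Real.log k))))) := by gcongr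
    _ = _ := by
      rw [← Real.exp_add, ← Real.exp_add]
      ring_nf

lemma exp_neg_le_inv {x a : ℝ} (hx : 0 ≤ x)
    (ha : a ≤ 1 + x + x ^ 2 / 2 + x ^ 3 / 6 + x ^ 4 / 24) (ha0 : 0 < a) :
    Real.exp (-x) ≤ a⁻¹ := by
  rw [Real.exp_neg]
  refine inv_anti₀ ha0 (ha.trans (le_trans (le_of_eq ?_) (Real.sum_le_exp_of_nonneg hx 5)))
  simp [Finset.sum_range_succ, Nat.factorial]

/-- The union bound over supports. -/
lemma sum_choose_mul_exp_le {p : ℕ} (hp : 8 ≤ p) :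
    ∑ k ∈ Finset.Ico 1 (p + 1), (p.choose k : ℝ) * (3 ^ k * Real.exp (2 - 4 / 9 * (2 * k
        + 4 * (k * Real.log (Real.exp 1 * p / max 1 (k : ℝ)))))) ≤ 1 := by
  -- The term `k = 1` is bounded with `log p ≥ log 8`; from `k = 2` on the terms are dominated by a
  -- geometric series.
  rw [Finset.sum_eq_sum_Ico_succ_bot (by omega)]
  have h1 : (p.choose 1 : ℝ) * (3 ^ 1 * Real.exp (2 - 4 / 9 * (2 * (1 : ℕ)
        + 4 * ((1 : ℕ) * Real.log (Real.exp 1 * p / max 1 ((1 : ℕ) : ℝ)))))) ≤ 2.8⁻¹ := by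
    refine (choose_mul_exp_le le_rfl (by omega)).trans
      (le_trans (Real.exp_le_exp.2 ?_) (exp_neg_le_inv (x := 1.18) (by norm_num)
        (by norm_num) (by norm_num)))
    have h8 : Real.log 8 ≤ Real.log p := Real.log_le_log (by norm_num) (by exact_mod_cast hp)
    rw [(by norm_num : (8 : ℝ) = 2 ^ 3), Real.log_pow] at h8
    have := Real.log_two_gt_d9
    push_cast at h8 ⊢
    rw [Real.log_one]
    linarith
  set r := Real.exp (-0.207)
  have hr : r ≤ 1.2299⁻¹ := exp_neg_le_inv (by norm_num) (by norm_num) (by norm_num)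
  have hr0 : 0 < r := Real.exp_pos _
  have h2 : ∑ k ∈ Finset.Ico (1 + 1) (p + 1), (p.choose k : ℝ) * (3 ^ k * Real.exp (2 - 4 / 9
      * (2 * k + 4 * (k * Real.log (Real.exp 1 * p / max 1 (k : ℝ)))))) ≤ 6.2⁻¹ * (r ^ 2 / (1 - r)) := by
    have hb : ∀ k ∈ Finset.Ico (1 + 1) (p + 1), (p.choose k : ℝ) * (3 ^ k * Real.exp (2 - 4 / 9
      * (2 * k + 4 * (k * Real.log (Real.exp 1 * p / max 1 (k : ℝ)))))) ≤ 6.2⁻¹ * r ^ k := by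
      intro k hk
      rw [Finset.mem_Ico] at hk
      refine (choose_mul_exp_le (by omega) (by omega)).trans ?_
      have h := le_mul_log_div hp (by omega : 2 ≤ k) (by omega : k ≤ p)
      -- Inserting the lower bound for `k (log p - log k)` makes the exponent affine in `k`: the
      -- intercept `1 - (7/9) · 0.462 · 8` is below `-1.87` and the slope `1.1 - 5/3 + (7/9) ·
      -- 0.462` is below `-0.207`.
      calc _ ≤ Real.exp (-1.87 + k * (-0.207)) := Real.exp_le_exp.2 (by
            have : (0 : ℝ) ≤ k := Nat.cast_nonneg k
            linarith)
        _ = Real.exp (-1.87) * r ^ k := by rw [Real.exp_add, Real.exp_nat_mul]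
        _ ≤ _ := by
          gcongr
          exact exp_neg_le_inv (by norm_num) (by norm_num) (by norm_num)
    refine (Finset.sum_le_sum hb).trans ?_
    rw [← Finset.mul_sum]
    gcongr
    exact geom_sum_Ico_le_of_lt_one hr0.le (by linarith [(by norm_num : (1.2299 : ℝ)⁻¹ < 1)])
  have h3 : r ^ 2 / (1 - r) ≤ 0.6612 / 0.1869 := by
    have : (1.2299 : ℝ)⁻¹ ≤ 0.8131 := by norm_num
    gcongr
    · nlinarith
    · linarith
  calc _ ≤ (2.8 : ℝ)⁻¹ + 6.2⁻¹ * (0.6612 / 0.1869) := by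
        refine add_le_add h1 (h2.trans (by gcongr))
    _ ≤ 1 := by norm_num

end LassoSize

/-! ### Bounds for the variance of the size of the support. -/

namespace LassoSize

open Filter Topology GaussianCalculus

variable {n p : ℕ}

/-- `log (e p / max 1 x)`. -/
def logRatio (p : ℕ) (x : ℝ) : ℝ := Real.log (Real.exp 1 * p / max 1 x)

lemma one_le_logRatio (hp : 0 < p) {x : ℝ} (hx : x ≤ p) : 1 ≤ logRatio p x := by
  have hp1 : (1 : ℝ) ≤ p := by exact_mod_cast hp
  rw [logRatio, Real.le_log_iff_exp_le (by positivity), le_div_iff₀ (by positivity)]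
  gcongr
  exact max_le hp1 hx

lemma logRatio_le (hp : 0 < p) (x : ℝ) : logRatio p x ≤ Real.log (Real.exp 1 * p) := by
  have hp1 : (0 : ℝ) < p := by exact_mod_cast hp
  exact Real.log_le_log (by positivity) (div_le_self (by positivity) (le_max_left _ _))

lemma measurable_logRatio (p : ℕ) : Measurable (logRatio p) :=
  Real.measurable_log.comp (measurable_const.div (measurable_const.max measurable_id))

/-- A supporting line, at the point `m`, of the concave function `x ↦ x log (e p / max 1 x)`. Its
kink at `1` is the reason for the two cases. The correction has mean zero when `m` is the mean of
`x`, which gives Jensen's inequality. -/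
lemma mul_logRatio_le (hp : 0 < p) {x m : ℝ} (hx : 0 ≤ x) :
    x * logRatio p x ≤ x * logRatio p m + (if 1 < m then m - x else 0) := by
  have hp1 : (0 : ℝ) < p := by exact_mod_cast hp
  have hX : 0 < max 1 x := by positivity
  have hM : 0 < max 1 m := by positivity
  have e : logRatio p x = logRatio p m + Real.log (max 1 m / max 1 x) := by
    rw [logRatio, logRatio, ← Real.log_mul (by positivity) (by positivity)]
    congr 1
    field_simp
  have h := Real.log_le_sub_one_of_pos (div_pos hM hX)
  have h1 : x / max 1 x ≤ 1 := (div_le_one hX).2 (le_max_right _ _)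
  have h2 : x / max 1 x ≤ x := div_le_self hx (le_max_left _ _)
  have h3 : x * Real.log (max 1 m / max 1 x) ≤ max 1 m * (x / max 1 x) - x := by
    calc _ ≤ x * (max 1 m / max 1 x - 1) := by gcongr
      _ = _ := by ring
  rw [e, mul_add]
  gcongr
  refine h3.trans ?_
  split_ifs with hm
  · rw [max_eq_right hm.le]
    nlinarith
  · rw [max_eq_left (not_lt.1 hm)]
    linarith

lemma finrank_span_column_le (X : Matrix (Fin n) (Fin p) ℝ) (T : Finset (Fin p)) :
    Module.finrank ℝ (Submodule.span ℝ (column X '' (T : Set (Fin p)))) ≤ T.card := by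
  classical
  have h := finrank_span_finset_le_card (R := ℝ) (T.image (column X))
  rw [Finset.coe_image] at h
  exact h.trans Finset.card_image_le

/-- One function dominates the exponential for every nonempty support at once, so a support
depending on `z` may be inserted. It is the sum over all supports, and its integral is the union
bound. -/
lemma exists_integrable_exp_norm_proj_le (X : Matrix (Fin n) (Fin p) ℝ) (hp : 8 ≤ p) :
    ∃ Φ : EuclideanSpace ℝ (Fin n) → ℝ, Integrable Φ (stdGaussian (EuclideanSpace ℝ (Fin n))) ∧
      ∫ z, Φ z ∂(stdGaussian (EuclideanSpace ℝ (Fin n))) ≤ 1 ∧ (∀ z, 0 ≤ Φ z) ∧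
      ∀ T : Finset (Fin p), T ≠ ∅ → ∀ z, Real.exp (4 / 9 * ‖proj X T z‖ ^ 2
        + (2 - 4 / 9 * (2 * T.card + 4 * (T.card * logRatio p T.card)))) ≤ Φ z := by
  -- The empty support gets weight zero. The constant `2` in the exponent becomes the threshold at
  -- which the Faber–Krahn inequality takes over from Poincaré.
  set w : ℕ → ℝ := fun k => if k = 0 then 0 else
    Real.exp (2 - 4 / 9 * (2 * k + 4 * (k * logRatio p k)))
  have hw : ∀ k, 0 ≤ w k := fun k => by
    simp only [w]; split_ifs <;> positivity
  have hi : ∀ T : Finset (Fin p), Integrable (fun z => w T.card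
      * Real.exp (4 / 9 * ‖proj X T z‖ ^ 2)) (stdGaussian (EuclideanSpace ℝ (Fin n))) := fun T =>
    (integrable_exp_norm_starProjection_sq _).const_mul _
  have h0 : ∀ (T : Finset (Fin p)) z, 0 ≤ w T.card * Real.exp (4 / 9 * ‖proj X T z‖ ^ 2) :=
    fun T z => mul_nonneg (hw _) (Real.exp_pos _).le
  refine ⟨fun z => ∑ T ∈ (Finset.univ : Finset (Fin p)).powerset,
    w T.card * Real.exp (4 / 9 * ‖proj X T z‖ ^ 2), integrable_finsetSum _ fun T _ => hi T, ?_,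
    fun z => Finset.sum_nonneg fun T _ => h0 T z, fun T hT z => ?_⟩
  · rw [integral_finsetSum _ fun T _ => hi T]
    calc _ ≤ ∑ T ∈ (Finset.univ : Finset (Fin p)).powerset, w T.card * 3 ^ T.card := by
          refine Finset.sum_le_sum fun T _ => ?_
          rw [integral_const_mul]
          refine mul_le_mul_of_nonneg_left ?_ (hw _)
          refine (integral_exp_norm_starProjection_sq _).le.trans ?_
          exact pow_le_pow_right₀ (by norm_num) (finrank_span_column_le X T)
      _ = ∑ k ∈ Finset.range (p + 1), p.choose k • (w k * 3 ^ k) := by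
          rw [Finset.sum_powerset_apply_card (fun k => w k * 3 ^ k), Finset.card_univ,
            Fintype.card_fin]
      _ = ∑ k ∈ Finset.Ico 1 (p + 1), p.choose k • (w k * 3 ^ k) := by
          rw [Finset.range_eq_Ico, Finset.sum_eq_sum_Ico_succ_bot (by omega)]
          simp [w]
      _ ≤ 1 := by
          refine le_trans (le_of_eq (Finset.sum_congr rfl fun k hk => ?_))
            (sum_choose_mul_exp_le hp)
          have hk0 : k ≠ 0 := by rw [Finset.mem_Ico] at hk; omega
          simp only [w, if_neg hk0, nsmul_eq_mul, logRatio]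
          ring
  · refine le_trans (le_of_eq ?_) (Finset.single_le_sum (fun T _ => h0 T z)
      (Finset.mem_powerset.2 (Finset.subset_univ T)))
    have : T.card ≠ 0 := by rwa [Ne, Finset.card_eq_zero]
    simp only [w, if_neg this]
    rw [Real.exp_add, mul_comm]

namespace IsSparseFit

variable {X : Matrix (Fin n) (Fin p) ℝ} {B : EuclideanSpace ℝ (Fin n) → EuclideanSpace ℝ (Fin p)}
  {S : EuclideanSpace ℝ (Fin n) → Finset (Fin p)} (H : IsSparseFit X B S)

include H

omit H in
lemma card_le_dim (S : EuclideanSpace ℝ (Fin n) → Finset (Fin p)) (z) : ((S z).card : ℝ) ≤ p := by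
  exact_mod_cast (by simpa using Finset.card_le_univ (S z))

lemma integrable_card :
    Integrable (fun z => ((S z).card : ℝ)) (stdGaussian (EuclideanSpace ℝ (Fin n))) :=
  (polyGrowth_card S).integrable H.measurable_card.aestronglyMeasurable

lemma integrable_card_sq :
    Integrable (fun z => ((S z).card : ℝ) ^ 2) (stdGaussian (EuclideanSpace ℝ (Fin n))) :=
  ((polyGrowth_card S).pow 2).integrable (H.measurable_card.pow_const 2).aestronglyMeasurable

lemma integrable_norm_proj_sq :
    Integrable (fun z => ‖proj X (S z) z‖ ^ 2) (stdGaussian (EuclideanSpace ℝ (Fin n))) :=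
  ((polyGrowth_proj X S).norm.pow 2).integrable (H.aestronglyMeasurable_proj.norm.pow 2)

lemma measurable_card_mul_logRatio : Measurable fun z => (S z).card * logRatio p (S z).card :=
  H.measurable_card.mul ((measurable_logRatio p).comp H.measurable_card)

lemma integrable_card_mul_logRatio (hp : 0 < p) :
    Integrable (fun z => (S z).card * logRatio p (S z).card)
      (stdGaussian (EuclideanSpace ℝ (Fin n))) := by
  refine (H.integrable_card.mul_const (Real.log (Real.exp 1 * p))).mono'
    H.measurable_card_mul_logRatio.aestronglyMeasurable (Eventually.of_forall fun z => ?_)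
  have h := one_le_logRatio hp (card_le_dim S z)
  rw [Real.norm_of_nonneg (by positivity)]
  gcongr
  exact logRatio_le hp _

lemma measurableSet_ne_empty : MeasurableSet {z | S z ≠ ∅} := by
  have : {z | S z ≠ ∅} = {z | ((S z).card : ℝ) ≠ 0} := by ext z; simp
  rw [this]
  exact (measurableSet_eq_fun H.measurable_card measurable_const).compl

/-- The Gibbs variational bound for the projection onto the selected columns. -/
lemma integral_norm_proj_sq_le (hp : 8 ≤ p)
    (hq : 0 < (stdGaussian (EuclideanSpace ℝ (Fin n))).real {z | S z ≠ ∅}) :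
    4 / 9 * ∫ z, ‖proj X (S z) z‖ ^ 2 ∂(stdGaussian (EuclideanSpace ℝ (Fin n)))
      ≤ 4 / 9 * (2 * ∫ z, ((S z).card : ℝ) ∂(stdGaussian (EuclideanSpace ℝ (Fin n)))
          + 4 * ∫ z, (S z).card * logRatio p (S z).card ∂(stdGaussian (EuclideanSpace ℝ (Fin n))))
        + (stdGaussian (EuclideanSpace ℝ (Fin n))).real {z | S z ≠ ∅}
          * (Real.log ((stdGaussian (EuclideanSpace ℝ (Fin n))).real {z | S z ≠ ∅})⁻¹ - 2) := by
  set γ := stdGaussian (EuclideanSpace ℝ (Fin n))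
  set A := {z | S z ≠ ∅}
  set q := γ.real A
  obtain ⟨Φ, hΦi, hΦ1, hΦ0, hΦ⟩ := exists_integrable_exp_norm_proj_le X hp
  have hA := H.measurableSet_ne_empty
  have iN := H.integrable_card
  have iL := H.integrable_card_mul_logRatio (by omega)
  have iA : Integrable (A.indicator fun _ => Real.log q⁻¹ - 3) γ :=
    (integrable_const _).indicator hA
  -- On `A` this is `u ≤ exp (u - log q⁻¹) + log q⁻¹ - 1`. The `3` is this `1` plus the shift `2`
  -- contained in `u`; integrating `q Φ` costs at most `q`, which leaves the `2` of the conclusion.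
  have hpt : ∀ z, 4 / 9 * ‖proj X (S z) z‖ ^ 2 ≤ 4 / 9 * (2 * ((S z).card : ℝ)
      + 4 * ((S z).card * logRatio p (S z).card)) + A.indicator (fun _ => Real.log q⁻¹ - 3) z
      + q * Φ z := fun z => by
    by_cases hz : S z = ∅
    · have hz' : z ∉ A := fun h => h hz
      rw [Set.indicator_of_notMem hz', hz]
      have : proj X ∅ z = 0 := by simp [proj]
      rw [this]
      simpa using mul_nonneg hq.le (hΦ0 z)
    · have hz' : z ∈ A := hz
      rw [Set.indicator_of_mem hz']
      have h1 := hΦ (S z) hz z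
      set u := 4 / 9 * ‖proj X (S z) z‖ ^ 2
        + (2 - 4 / 9 * (2 * (S z).card + 4 * ((S z).card * logRatio p (S z).card))) with hu
      have h2 := Real.add_one_le_exp (u - Real.log q⁻¹)
      have h3 : Real.exp (u - Real.log q⁻¹) ≤ q * Φ z := by
        rw [Real.log_inv, sub_neg_eq_add, Real.exp_add, Real.exp_log hq, mul_comm]
        gcongr
      linarith
  have h := integral_mono (μ := γ) (H.integrable_norm_proj_sq.const_mul (4 / 9))
    (((((iN.const_mul 2).add (iL.const_mul 4)).const_mul (4 / 9)).add iA).add (hΦi.const_mul q)) hpt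
  have e3 := integral_add ((((iN.const_mul 2).add (iL.const_mul 4)).const_mul (4 / 9)).add iA)
    (hΦi.const_mul q)
  have e2 := integral_add (((iN.const_mul 2).add (iL.const_mul 4)).const_mul (4 / 9)) iA
  have e1 := integral_add (iN.const_mul 2) (iL.const_mul 4)
  simp only [Pi.add_apply, integral_const_mul] at h e1 e2 e3
  rw [e3, e2, e1, integral_indicator_const _ hA, smul_eq_mul] at h
  have : q * ∫ z, Φ z ∂γ ≤ q * 1 := by gcongr
  change _ ≤ _ + q * (Real.log q⁻¹ - 2)
  change _ ≤ _ + q * (Real.log q⁻¹ - 3) + _ at h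
  linarith

lemma gaussian_poincare_card :
    ∫ z, ((S z).card : ℝ) ^ 2 ∂(stdGaussian (EuclideanSpace ℝ (Fin n)))
        - (∫ z, ((S z).card : ℝ) ∂(stdGaussian (EuclideanSpace ℝ (Fin n)))) ^ 2
      ≤ ∫ z, ((S z).card : ℝ) ∂(stdGaussian (EuclideanSpace ℝ (Fin n)))
        + ∫ z, ‖proj X (S z) z‖ ^ 2 ∂(stdGaussian (EuclideanSpace ℝ (Fin n))) := by
  have h := H.variance_sub_integral_gradient 0
  have h1 := gaussian_poincare (H.polyLip_inner_fit)
  simp only [sub_zero] at h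
  linarith

lemma integral_card_le_integral_card_mul_logRatio (hp : 0 < p) :
    ∫ z, ((S z).card : ℝ) ∂(stdGaussian (EuclideanSpace ℝ (Fin n)))
      ≤ ∫ z, (S z).card * logRatio p (S z).card ∂(stdGaussian (EuclideanSpace ℝ (Fin n))) :=
  integral_mono H.integrable_card (H.integrable_card_mul_logRatio hp) fun z =>
    le_mul_of_one_le_right (Nat.cast_nonneg _) (one_le_logRatio hp (card_le_dim S z))

/-- For `p ≥ 8` the variational bound has an excess `q (log q⁻¹ - 2)`, positive only if a nonempty
selection is rare. In that case the Poincaré inequality of `⟪z, X B⟫`, a function supported on the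
rare event, improves by the factor `log q⁻¹ / 2`, which pays for the excess. -/
theorem variance_card_le (hp : 0 < p) :
    ∫ z, ((S z).card : ℝ) ^ 2 ∂(stdGaussian (EuclideanSpace ℝ (Fin n)))
        - (∫ z, ((S z).card : ℝ) ∂(stdGaussian (EuclideanSpace ℝ (Fin n)))) ^ 2
      ≤ 3 * ∫ z, ((S z).card : ℝ) ∂(stdGaussian (EuclideanSpace ℝ (Fin n)))
        + 4 * ∫ z, (S z).card * logRatio p (S z).card
          ∂(stdGaussian (EuclideanSpace ℝ (Fin n))) := by
  set γ := stdGaussian (EuclideanSpace ℝ (Fin n))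
  set N1 := ∫ z, ((S z).card : ℝ) ∂γ
  set N2 := ∫ z, ((S z).card : ℝ) ^ 2 ∂γ
  set Λ := ∫ z, (S z).card * logRatio p (S z).card ∂γ
  have hN1 : 0 ≤ N1 := integral_nonneg fun z => Nat.cast_nonneg _
  have hΛ : N1 ≤ Λ := H.integral_card_le_integral_card_mul_logRatio hp
  rcases le_or_gt 8 p with hp8 | hp8
  swap
  -- The size is at most `7 = 3 + 4`, and `N1 ≤ Λ`, so the second moment already satisfies the
  -- bound.
  · have h : N2 ≤ 7 * N1 := by
      rw [← integral_const_mul]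
      refine integral_mono H.integrable_card_sq (H.integrable_card.const_mul 7) fun z => ?_
      have h1 := card_le_dim S z
      have h2 : (p : ℝ) ≤ 7 := by exact_mod_cast Nat.le_of_lt_succ hp8
      have h3 : (0 : ℝ) ≤ (S z).card := Nat.cast_nonneg _
      simp only
      nlinarith
    nlinarith
  set q := γ.real {z | S z ≠ ∅} with hqdef
  rcases (measureReal_nonneg : 0 ≤ q).eq_or_lt with hq | hq
  · have h0 : ∀ᵐ z ∂γ, S z = ∅ := by
      rw [eq_comm, measureReal_eq_zero_iff] at hq
      exact hq
    have : N2 = 0 := by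
      refine integral_eq_zero_of_ae ?_
      filter_upwards [h0] with z hz
      simp [hz]
    nlinarith
  have hq1 : q ≤ N1 := by
    rw [hqdef, ← integral_indicator_one H.measurableSet_ne_empty]
    refine integral_mono ((integrable_const 1).indicator H.measurableSet_ne_empty)
      H.integrable_card fun z => ?_
    by_cases hz : S z = ∅
    · rw [Set.indicator_of_notMem (by simpa using hz)]
      exact Nat.cast_nonneg _
    · rw [Set.indicator_of_mem (by simpa using hz)]
      change (1 : ℝ) ≤ _
      exact_mod_cast Finset.card_pos.2 (Finset.nonempty_iff_ne_empty.2 hz)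
  have hW := H.integral_norm_proj_sq_le hp8 hq
  have hP := H.gaussian_poincare_card
  -- An empty support means `B z = 0`, so `⟪z, X B⟫` vanishes off the event `S ≠ ∅`.
  have hF : (∫ z, ⟪z, fit X (B z)⟫ ^ 2 ∂γ) * Real.log q⁻¹
      ≤ 2 * ∫ z, ‖gradient (fun z => ⟪z, fit X (B z)⟫) z‖ ^ 2 ∂γ := by
    refine gaussian_faber_krahn H.polyLip_inner_fit H.measurableSet_ne_empty (fun z hz => ?_) hq
    have hz' : S z = ∅ := not_not.1 hz
    have hB : B z = 0 := by
      ext j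
      have := H.mem_iff z j
      rw [hz'] at this
      simpa using this
    rw [hB, fit_zero, inner_zero_right]
  have hG := H.integral_norm_gradient_sq 0
  simp only [sub_zero, inner_zero_left, norm_zero, integral_zero] at hG
  rw [H.integral_inner_fit_sq, hG] at hF
  have hF2 : 0 ≤ ∫ z, ‖fit X (B z)‖ ^ 2 ∂γ := integral_nonneg fun z => by positivity
  change 4 / 9 * _ ≤ 4 / 9 * (2 * N1 + 4 * Λ) + q * (Real.log q⁻¹ - 2) at hW
  change N2 - N1 ^ 2 ≤ _ at hP
  set W := ∫ z, ‖proj X (S z) z‖ ^ 2 ∂γ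
  set F2 := ∫ z, ‖fit X (B z)‖ ^ 2 ∂γ
  set L := Real.log q⁻¹
  change (N2 + F2 + N1) * L ≤ 2 * (F2 + 0 ^ 2 + W - 2 * 0 + 2 * N1 - 2 * 0) at hF
  change N2 - N1 ^ 2 ≤ N1 + W at hP
  rcases le_total L 2 with hL | hL
  · have := mul_nonneg hq.le (sub_nonneg.2 hL)
    linarith
  -- Since `L ≥ 2`, the term `F2` drops out of the Faber–Krahn inequality; since `q ≤ N1 ≤ Λ`, the
  -- excess `4.5 q (L - 2)` is absorbed by `(4 N1 + 4 Λ) (L - 2)`. The bound obtained is on the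
  -- second moment `N2` itself.
  · have h1 := mul_nonneg hF2 (sub_nonneg.2 hL)
    have h2 : 0 ≤ (L - 2) * (4 * N1 + 4 * Λ - 4.5 * q) :=
      mul_nonneg (sub_nonneg.2 hL) (by linarith)
    have h3 : N2 * L ≤ (3 * N1 + 4 * Λ) * L := by linarith
    have h4 := le_of_mul_le_mul_right h3 (by linarith)
    linarith [sq_nonneg N1]

lemma integral_card_mul_logRatio_le (hp : 0 < p) :
    ∫ z, (S z).card * logRatio p (S z).card ∂(stdGaussian (EuclideanSpace ℝ (Fin n)))
      ≤ (∫ z, ((S z).card : ℝ) ∂(stdGaussian (EuclideanSpace ℝ (Fin n))))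
        * logRatio p (∫ z, ((S z).card : ℝ) ∂(stdGaussian (EuclideanSpace ℝ (Fin n)))) := by
  set γ := stdGaussian (EuclideanSpace ℝ (Fin n))
  set m := ∫ z, ((S z).card : ℝ) ∂γ with hm
  have hi : Integrable (fun z => if 1 < m then m - ((S z).card : ℝ) else 0) γ := by
    split_ifs
    · exact (integrable_const m).sub H.integrable_card
    · exact integrable_zero _ _ _
  refine (integral_mono (H.integrable_card_mul_logRatio hp)
    ((H.integrable_card.mul_const (logRatio p m)).add hi)
    fun z => mul_logRatio_le hp (Nat.cast_nonneg _)).trans ?_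
  have e := integral_add (H.integrable_card.mul_const (logRatio p m)) hi
  simp only [Pi.add_apply] at e ⊢
  rw [e, integral_mul_const]
  have : ∫ z, (if 1 < m then m - ((S z).card : ℝ) else 0) ∂γ = 0 := by
    split_ifs
    · rw [integral_sub (integrable_const _) H.integrable_card]
      simp [hm, γ]
    · simp
  rw [this, add_zero]

lemma integral_norm_proj_sq_le_dim :
    ∫ z, ‖proj X (S z) z‖ ^ 2 ∂(stdGaussian (EuclideanSpace ℝ (Fin n))) ≤ n := by
  set γ := stdGaussian (EuclideanSpace ℝ (Fin n))
  have h : ∫ z, ‖z‖ ^ 2 ∂γ = n := by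
    have e := integral_inner_eq_integral_divergence
      (polyLip_id : PolyLip fun z : EuclideanSpace ℝ (Fin n) => z)
    simp only [real_inner_self_eq_norm_sq] at e
    rw [e]
    simp
  rw [← h]
  refine integral_mono H.integrable_norm_proj_sq
    ((polyGrowth_id.norm.pow 2).integrable (by fun_prop)) fun z => ?_
  have := norm_proj_le X (S z) z
  simp only
  gcongr

end IsSparseFit

end LassoSize

/-! ### From the standard Gaussian vector back to the Lasso. -/

namespace LassoSize

open Filter Topology GaussianCalculus

variable {n p : ℕ}

/-- The outer factor `σ⁻¹` cancels the inner `σ` in the chain rule, so the derivative is that of the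
Lasso at `m + σ z`. Null sets pull back to null sets under this affine change of variables. -/
lemma isSparseFit_lasso (hn : 0 < n) {X : Matrix (Fin n) (Fin p) ℝ} (hX : RankCondition X)
    {lam : ℝ} (hlam : 0 < lam) {σ : ℝ} (hσ : 0 < σ) (m : EuclideanSpace ℝ (Fin n)) :
    IsSparseFit X (fun z => σ⁻¹ • lasso X lam (m + σ • z)) fun z => selected X lam (m + σ • z) := by
  have hd : ∀ᵐ z ∂(stdGaussian (EuclideanSpace ℝ (Fin n))),
      DifferentiableAt ℝ (fun z => σ⁻¹ • lasso X lam (m + σ • z)) z ∧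
      (∀ v, fit X (fderiv ℝ (fun z => σ⁻¹ • lasso X lam (m + σ • z)) z v)
        = proj X (selected X lam (m + σ • z)) v) ∧
      fderiv ℝ (fun z => σ⁻¹ • lasso X lam (m + σ • z)) z
        (fit X (σ⁻¹ • lasso X lam (m + σ • z))) = σ⁻¹ • lasso X lam (m + σ • z) := by
    have hq : Measure.QuasiMeasurePreserving (fun z : EuclideanSpace ℝ (Fin n) => m + σ • z)
        volume volume :=
      (measurePreserving_add_left volume m).quasiMeasurePreserving.comp
        (Measure.quasiMeasurePreserving_smul volume hσ.ne')
    refine stdGaussian_absolutelyContinuous.ae_le ?_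
    filter_upwards [hq.ae (ae_fderiv_lasso hn hX hlam)] with z hz
    obtain ⟨h1, h2, h3⟩ := hz
    have h0 : HasFDerivAt (fun z : EuclideanSpace ℝ (Fin n) => m + σ • z)
        (σ • ContinuousLinearMap.id ℝ _) z := ((hasFDerivAt_id z).const_smul σ).const_add m
    have h4 : HasFDerivAt (fun z => lasso X lam (m + σ • z))
      ((fderiv ℝ (lasso X lam) (m + σ • z)).comp (σ • ContinuousLinearMap.id ℝ _)) z :=
      HasFDerivAt.comp (g := lasso X lam) z h1.hasFDerivAt h0
    have h5 : HasFDerivAt (fun z => σ⁻¹ • lasso X lam (m + σ • z))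
        (fderiv ℝ (lasso X lam) (m + σ • z)) z := by
      refine (h4.const_smul σ⁻¹).congr_fderiv ?_
      ext1 v
      simp [smul_smul, hσ.ne']
    refine ⟨h5.differentiableAt, fun v => ?_, ?_⟩
    · rw [h5.fderiv, h2]
    · rw [h5.fderiv, fit_smul, map_smul, h3]
  exact {
    polyLip := (polyLip_const σ⁻¹).smul ((polyLip_lasso hn hX hlam).comp_lipschitz σ fun x y => by
      rw [add_sub_add_left_eq_sub, ← smul_sub, norm_smul, Real.norm_of_nonneg hσ.le])
    mem_iff := fun z j => by
      rw [mem_selected, PiLp.smul_apply, smul_eq_mul, mul_ne_zero_iff]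
      exact ⟨fun h => ⟨(inv_pos.2 hσ).ne', h⟩, fun h => h.2⟩
    finrank_eq := fun z => finrank_span_selected hn hX hlam _
    ae_differentiableAt := hd.mono fun z h => h.1
    ae_fit_fderiv := hd.mono fun z h => h.2.1
    ae_fderiv_fit := hd.mono fun z h => h.2.2 }

lemma hasLaw_smul_stdGaussian {Ω : Type*} [MeasurableSpace Ω] {P : Measure Ω} {σ : ℝ} (hσ : 0 < σ)
    {ε : Ω → EuclideanSpace ℝ (Fin n)}
    (hε : HasLaw ε (multivariateGaussian 0 (σ ^ 2 • (1 : Matrix (Fin n) (Fin n) ℝ))) P) :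
    HasLaw (fun ω => σ⁻¹ • ε ω) (stdGaussian (EuclideanSpace ℝ (Fin n))) P where
  aemeasurable := hε.aemeasurable.fun_const_smul _
  map_eq := by
    have h : P.map (fun ω => σ⁻¹ • ε ω) = (P.map ε).map (σ⁻¹ • ·) := by
      rw [AEMeasurable.map_map_of_aemeasurable (by fun_prop) hε.aemeasurable]
      rfl
    have : IsProbabilityMeasure P := hε.isProbabilityMeasure
    have : IsProbabilityMeasure (P.map fun ω => σ⁻¹ • ε ω) :=
      Measure.isProbabilityMeasure_map (hε.aemeasurable.fun_const_smul _)
    refine Measure.ext_of_charFun ?_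
    funext t
    rw [h, hε.map_eq, charFun_map_smul, charFun_stdGaussian,
      charFun_multivariateGaussian (Matrix.PosSemidef.one.smul (sq_nonneg σ))]
    congr 1
    have e : WithLp.ofLp (σ⁻¹ • t) ⬝ᵥ (σ ^ 2 • (1 : Matrix (Fin n) (Fin n) ℝ))
        *ᵥ WithLp.ofLp (σ⁻¹ • t) = ‖t‖ ^ 2 := by
      rw [Matrix.smul_mulVec, Matrix.one_mulVec, EuclideanSpace.real_norm_sq_eq]
      simp only [dotProduct, PiLp.smul_apply, Pi.smul_apply, smul_eq_mul]
      refine Finset.sum_congr rfl fun i _ => ?_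
      field_simp
    rw [e]
    simp [neg_div]

lemma integrable_comp_of_hasLaw {Ω 𝓧 : Type*} [MeasurableSpace Ω] [MeasurableSpace 𝓧]
    {P : Measure Ω} {μ : Measure 𝓧} {Z : Ω → 𝓧} (hZ : HasLaw Z μ P) {f : 𝓧 → ℝ}
    (hf : Integrable f μ) : Integrable (fun ω => f (Z ω)) P :=
  (hZ.map_eq ▸ hf : Integrable f (P.map Z)).comp_aemeasurable hZ.aemeasurable

end LassoSize

end

open LassoSize GaussianCalculus

theorem mainTheorem5 {n p : ℕ} (hn : 0 < n) (hp : 0 < p)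
    (X : Matrix (Fin n) (Fin p) ℝ) (hX : LassoSize.RankCondition X)
    (β : EuclideanSpace ℝ (Fin p)) (lam : ℝ) (hlam : 0 < lam) (σ : ℝ) (hσ : 0 < σ)
    {Ω : Type*} [MeasurableSpace Ω] (P : Measure Ω) [IsProbabilityMeasure P]
    (ε : Ω → EuclideanSpace ℝ (Fin n))
    (hε : HasLaw ε (multivariateGaussian 0 (σ ^ 2 • (1 : Matrix (Fin n) (Fin n) ℝ))) P)
    (S : Ω → Finset (Fin p))
    (hS : ∀ ω, S ω = LassoSize.selected X lam (LassoSize.fit X β + ε ω))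
    (g : EuclideanSpace ℝ (Fin n) → ℝ) (hg : g = LassoSize.stein X β lam σ) :
    -- the Lasso is well defined, and all moments and gradients below exist
    (∀ y, ∃! b, LassoSize.IsLassoSolution X lam y b) ∧
    MemLp (fun ω => ((S ω).card : ℝ)) 2 P ∧
    Integrable (fun ω => ‖LassoSize.proj X (S ω) (ε ω)‖ ^ 2 / σ ^ 2) P ∧
    MemLp (fun ω => g (ε ω)) 2 P ∧
    (∀ᵐ ω ∂P, DifferentiableAt ℝ g (ε ω)) ∧
    Integrable (fun ω => ‖gradient g (ε ω)‖ ^ 2) P ∧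
    -- the variance formula
    variance (fun ω => ((S ω).card : ℝ)) P
      = (∫ ω, ((S ω).card : ℝ) ∂P)
        + (∫ ω, ‖LassoSize.proj X (S ω) (ε ω)‖ ^ 2 / σ ^ 2 ∂P)
        + (variance (fun ω => g (ε ω)) P - σ ^ 2 * ∫ ω, ‖gradient g (ε ω)‖ ^ 2 ∂P) ∧
    variance (fun ω => g (ε ω)) P - σ ^ 2 * (∫ ω, ‖gradient g (ε ω)‖ ^ 2 ∂P) ≤ 0 ∧
    variance (fun ω => ((S ω).card : ℝ)) P
      ≤ (∫ ω, ((S ω).card : ℝ) ∂P)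
        + (∫ ω, ‖LassoSize.proj X (S ω) (ε ω)‖ ^ 2 / σ ^ 2 ∂P) ∧
    -- the consequences
    variance (fun ω => ((S ω).card : ℝ)) P ≤ 2 * (n : ℝ) ∧
    variance (fun ω => ((S ω).card : ℝ)) P
      ≤ 3 * (∫ ω, ((S ω).card : ℝ) ∂P)
        + 4 * (∫ ω, ((S ω).card : ℝ)
            * Real.log (Real.exp 1 * (p : ℝ) / max 1 ((S ω).card : ℝ)) ∂P) ∧
    3 * (∫ ω, ((S ω).card : ℝ) ∂P)
        + 4 * (∫ ω, ((S ω).card : ℝ)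
            * Real.log (Real.exp 1 * (p : ℝ) / max 1 ((S ω).card : ℝ)) ∂P)
      ≤ 3 * (∫ ω, ((S ω).card : ℝ) ∂P)
        + 4 * (∫ ω, ((S ω).card : ℝ) ∂P)
            * Real.log (Real.exp 1 * (p : ℝ) / max 1 (∫ ω, ((S ω).card : ℝ) ∂P)) := by
  set γ := stdGaussian (EuclideanSpace ℝ (Fin n)) with hγ
  have H := isSparseFit_lasso hn hX hlam hσ (fit X β)
  set B := fun z : EuclideanSpace ℝ (Fin n) => σ⁻¹ • lasso X lam (fit X β + σ • z) with hB
  set T := fun z : EuclideanSpace ℝ (Fin n) => selected X lam (fit X β + σ • z) with hT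
  -- With this `c`, `g e = G (σ⁻¹ • e)`; hence `σ² ‖∇g‖²` at `ε` is `‖∇G‖²` at `Z`, and the bracket
  -- of the theorem is the Poincaré deficit of `G`.
  set c := σ⁻¹ • fit X β
  set G := fun z => ⟪z, fit X (B z) - c⟫ with hG
  set Z := fun ω => σ⁻¹ • ε ω with hZdef
  have hZ : HasLaw Z γ P := hasLaw_smul_stdGaussian hσ hε
  have hεZ : ∀ ω, ε ω = σ • Z ω := fun ω => by simp only [hZdef]; rw [smul_inv_smul₀ hσ.ne']
  have hST : ∀ ω, S ω = T (Z ω) := fun ω => by rw [hS, hεZ]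
  have hproj : ∀ ω, ‖proj X (S ω) (ε ω)‖ ^ 2 / σ ^ 2 = ‖proj X (T (Z ω)) (Z ω)‖ ^ 2 := fun ω => by
    rw [hST, hεZ, map_smul, norm_smul, Real.norm_of_nonneg hσ.le, mul_pow,
      mul_div_cancel_left₀ _ (by positivity)]
  have hgG : g = fun e => G (σ⁻¹ • e) := by
    funext e
    rw [hg, stein]
    simp only [hG, hB, c]
    rw [smul_inv_smul₀ hσ.ne', fit_smul, ← smul_sub, real_inner_smul_left, real_inner_smul_right,
      fit_sub]
    field_simp
  have hgZ : ∀ ω, g (ε ω) = G (Z ω) := fun ω => by rw [hgG]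
  have hgrad : ∀ ω, σ ^ 2 * ‖gradient g (ε ω)‖ ^ 2 = ‖gradient G (Z ω)‖ ^ 2 := fun ω => by
    rw [norm_gradient, norm_gradient, hgG, fderiv_comp_smul, norm_smul, norm_inv,
      Real.norm_of_nonneg hσ.le, mul_pow, inv_pow, mul_inv_cancel_left₀ (by positivity)]
  have hGL : PolyLip G := polyLip_id.inner (H.polyLip_fit.sub (polyLip_const c))
  have hGd : ∀ᵐ ω ∂P, DifferentiableAt ℝ g (ε ω) := by
    have h := hGL.ae_differentiableAt_stdGaussian
    rw [← hγ, ← hZ.map_eq] at h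
    filter_upwards [ae_of_ae_map hZ.aemeasurable h] with ω hω
    rw [hgG]
    exact DifferentiableAt.comp (g := G) (ε ω) hω (differentiableAt_id.const_smul σ⁻¹)
  have iN := integrable_comp_of_hasLaw hZ H.integrable_card
  have iN2 := integrable_comp_of_hasLaw hZ H.integrable_card_sq
  have iW := integrable_comp_of_hasLaw hZ H.integrable_norm_proj_sq
  have hGm := hGL.continuous.aestronglyMeasurable (μ := γ)
  have hG2 : MemLp G 2 γ := hGL.polyGrowth.memLp_two hGm
  have iD0 : Integrable (fun z => ‖gradient G z‖ ^ 2) γ :=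
    (hGL.polyGrowth_gradient.norm.pow 2).integrable
      ((measurable_gradient G).norm.pow_const 2).aestronglyMeasurable
  have iD := integrable_comp_of_hasLaw hZ iD0
  have eN : ∫ ω, ((S ω).card : ℝ) ∂P = ∫ z, ((T z).card : ℝ) ∂γ := by
    simp_rw [hST]
    exact hZ.integral_comp H.measurable_card.aestronglyMeasurable
  have eW : ∫ ω, ‖proj X (S ω) (ε ω)‖ ^ 2 / σ ^ 2 ∂P = ∫ z, ‖proj X (T z) z‖ ^ 2 ∂γ := by
    simp_rw [hproj]
    exact hZ.integral_comp H.integrable_norm_proj_sq.aestronglyMeasurable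
  have eD : σ ^ 2 * ∫ ω, ‖gradient g (ε ω)‖ ^ 2 ∂P = ∫ z, ‖gradient G z‖ ^ 2 ∂γ := by
    rw [← integral_const_mul]
    simp_rw [hgrad]
    exact hZ.integral_comp iD0.aestronglyMeasurable
  have eΛ : ∫ ω, ((S ω).card : ℝ) * Real.log (Real.exp 1 * (p : ℝ) / max 1 ((S ω).card : ℝ)) ∂P
      = ∫ z, (T z).card * logRatio p (T z).card ∂γ := by
    simp_rw [hST]
    exact hZ.integral_comp H.measurable_card_mul_logRatio.aestronglyMeasurable
  have mN : MemLp (fun ω => ((S ω).card : ℝ)) 2 P := by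
    simp_rw [hST]
    exact (memLp_two_iff_integrable_sq iN.aestronglyMeasurable).2 iN2
  have mG : MemLp (fun ω => g (ε ω)) 2 P := by
    simp_rw [hgZ]
    exact (hZ.map_eq ▸ hG2 : MemLp G 2 (P.map Z)).comp_of_map hZ.aemeasurable
  have vN : variance (fun ω => ((S ω).card : ℝ)) P
      = ∫ z, ((T z).card : ℝ) ^ 2 ∂γ - (∫ z, ((T z).card : ℝ) ∂γ) ^ 2 := by
    rw [variance_eq_sub mN, ← eN]
    congr 1
    simp only [Pi.pow_apply, hST]
    exact hZ.integral_comp H.integrable_card_sq.aestronglyMeasurable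
  have vG : variance (fun ω => g (ε ω)) P = ∫ z, G z ^ 2 ∂γ - (∫ z, G z ∂γ) ^ 2 := by
    rw [variance_eq_sub mG]
    simp only [Pi.pow_apply, hgZ]
    congr 1
    · exact hZ.integral_comp (hGm.pow 2)
    · congr 1
      exact hZ.integral_comp hGm
  have hVar := H.variance_sub_integral_gradient c
  have hPoin := gaussian_poincare hGL
  have hN : ∫ z, ((T z).card : ℝ) ∂γ ≤ n := by
    refine (integral_mono H.integrable_card (integrable_const (n : ℝ)) fun z => ?_).trans (by simp)
    exact Nat.cast_le.2 (card_selected_le hn hX hlam _)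
  have hW := H.integral_norm_proj_sq_le_dim
  refine ⟨existsUnique_isLassoSolution hn hX hlam, mN, ?_, mG, hGd, ?_, ?_, ?_, ?_, ?_, ?_, ?_⟩
  · simp_rw [hproj]; exact iW
  · have : (fun ω => ‖gradient g (ε ω)‖ ^ 2) = fun ω => (σ ^ 2)⁻¹ * ‖gradient G (Z ω)‖ ^ 2 := by
      funext ω
      rw [← hgrad]
      field_simp
    rw [this]
    exact iD.const_mul _
  · rw [vN, vG, eN, eW, eD]; linarith
  · rw [vG, eD]; linarith
  · rw [vN, eN, eW]; exact H.gaussian_poincare_card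
  · rw [vN]; linarith [H.gaussian_poincare_card]
  · rw [vN, eN, eΛ]; exact H.variance_card_le hp
  · rw [eN, eΛ, mul_assoc]
    have := H.integral_card_mul_logRatio_le hp
    rw [logRatio] at this
    linarith
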